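/- Let $K$ be an algebraically closed field of characteristic $0$, let $S=K[x_0,\dots,x_n]$, and let $g=(a_{ij})\in \mathrm{GL}_{n+1}(K)$ act on $S$ by the $K$-algebra automorphism with $g\cdot x_i=\sum_j a_{ji}x_j$. Let $I\subseteq S$ be a saturated homogeneous ideal, defining $Z\subseteq\mathbb P^n$, let $P$ be the Hilbert polynomial of $S/I$, and let $m$ be the Gotzmann number of $P$, i.e. the least integer $m\ge 0$ such that every saturated homogeneous ideal with Hilbert polynomial $P$ is $m$-regular. The Hilbert scheme $\mathrm{Hilb}$ of subschemes of $\mathbb P^n$ with Hilbert polynomial $P$ is viewed inside the Grassmannian of subspaces of $S_m$, a saturated ideal $J$ with Hilbert polynomial $P$ corresponding to the point $J_m$. Let $f_1,\dots,f_r$ be a basis of $I_m$. Let $w=(w_0,\dots,w_n)\in\mathbb Z^{n+1}$ satisfy $w_0>w_1>\dots>w_n$ and distinguish monomials in every degree $d\le rm$: if $x^A\ne x^B$ are monomials of degree $d$, then $w\cdot A\neq w\cdot B$. For $t\in K^\times$ let $\lambda_w(t)=\mathrm{diag}(t^{-w_0},\dots,t^{-w_n})$. Let $G=(G_{ij})$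 be a matrix of indeterminates, and expand $Gf_1\wedge\dots\wedge Gf_r$ in the wedge products $x^{B_1}\wedge\dots\wedge x^{B_r}$ of monomials of degree $m$, the coefficients being polynomials in the $G_{ij}$. Let $U=U(f)\subseteq\mathrm{GL}_{n+1}(K)$ be the set of $g$ at which none of the not identically zero coefficients vanishes. Then $U$ is Zariski open and dense in $\mathrm{GL}_{n+1}(K)$, and for every $g\in U$ the following hold. 1. The path $t\mapsto \lambda_w(t)\,g I_m$, $t\ne0$, extends uniquely to a morphism $\gamma:\mathbb A^1\to\mathrm{Hilb}$, and its limit $\gamma(0)\in \mathrm{Hilb}$ as $t\to 0$ is fixed by the Borel group $B$ of invertible upper triangular matrices. 2. Suppose that $Z\neq\emptyset$ and $Z\ne\mathbb P^n$ (i.e. $I\neq S$ and $I\ne 0$), and put $V=\gamma(0)\subseteq S_m$. Then $\gamma$ has a unique tangent vector at $V$, meaning its first nonvanishing derivative at $t=0$: there is exactly one nonzero $\varphi\in\mathrm{Hom}_K(V,S_m/V)$ such that, for some $k\ge1$, every $v\in V$ extends to a section of the family $\gamma$ over $\mathbb A^1$ of the form $v+t^k u+O(t^{k+1})$ with $u\in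 S_m$ representing $\varphi(v)$. This $\varphi$ lies in the tangent space $T_V\mathrm{Hilb}\subseteq\mathrm{Hom}_K(V,S_m/V)$ (the ideal of $S[\varepsilon]$, $\varepsilon^2=0$, generated by all $v+\varepsilon u$ with $v\in V$ and $u$ representing $\varphi(v)$ has quotient flat over $K[\varepsilon]$), and it is an eigenvector for $B$: for every $h\in B$ there is $c\in K$ with $h\circ\varphi\circ h^{-1}=c\,\varphi$. -/

import Mathlib

namespace InfGalligo

open MvPolynomial
open scoped Polynomial

noncomputable section

/-! ### Forms, linear substitutions and base change -/

/-- The module `S_m` of forms of degree `m` in `x_0, …, x_n` with coefficients in `R`. -/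
abbrev Forms (R : Type*) [CommRing R] (n m : ℕ) :
    Submodule R (MvPolynomial (Fin (n + 1)) R) :=
  homogeneousSubmodule (Fin (n + 1)) R m

/-- The action of a matrix on polynomials: `g · x_i = ∑ j, g j i * x_j`. -/
def linSubst {R : Type*} [CommRing R] {n : ℕ} (g : Matrix (Fin (n + 1)) (Fin (n + 1)) R) :
    MvPolynomial (Fin (n + 1)) R →ₐ[R] MvPolynomial (Fin (n + 1)) R :=
  aeval fun i => ∑ j, C (g j i) * X j

theorem linSubst_mem {R : Type*} [CommRing R] {n m : ℕ}
    (g : Matrix (Fin (n + 1)) (Fin (n + 1)) R) (p : MvPolynomial (Fin (n + 1)) R)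
    (hp : p ∈ Forms R n m) : linSubst g p ∈ Forms R n m := by
  rw [mem_homogeneousSubmodule] at hp ⊢
  have h := hp.aeval (fun i => ∑ j, C (g j i) * X j) (n := 1) (fun i =>
    IsHomogeneous.sum _ _ _ fun j _ => by
      simpa using (isHomogeneous_C (Fin (n + 1)) (g j i)).mul (isHomogeneous_X R j))
  simpa [linSubst] using h

theorem linSubst_mul {R : Type*} [CommRing R] {n : ℕ}
    (g h : Matrix (Fin (n + 1)) (Fin (n + 1)) R) (p : MvPolynomial (Fin (n + 1)) R) :
    linSubst g (linSubst h p) = linSubst (g * h) p := by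
  have : (linSubst g).comp (linSubst h) = linSubst (g * h) := by
    apply MvPolynomial.algHom_ext
    intro i
    simp only [linSubst, AlgHom.comp_apply, aeval_X, map_sum, map_mul, Matrix.mul_apply,
      Finset.sum_mul, Finset.mul_sum, algHom_C, algebraMap_eq]
    rw [Finset.sum_comm]
    refine Finset.sum_congr rfl fun j _ => Finset.sum_congr rfl fun k _ => by ring
  exact DFunLike.congr_fun this p

theorem linSubst_one {R : Type*} [CommRing R] {n : ℕ} (p : MvPolynomial (Fin (n + 1)) R) :
    linSubst (1 : Matrix (Fin (n + 1)) (Fin (n + 1)) R) p = p := by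
  have : linSubst (1 : Matrix (Fin (n + 1)) (Fin (n + 1)) R) = AlgHom.id R _ := by
    apply MvPolynomial.algHom_ext
    intro i
    simp [linSubst, Matrix.one_apply]
  rw [this]; rfl

/-- The action of a matrix on `S_m`. -/
def matAct {R : Type*} [CommRing R] {n : ℕ} (m : ℕ)
    (g : Matrix (Fin (n + 1)) (Fin (n + 1)) R) : Forms R n m →ₗ[R] Forms R n m :=
  (linSubst g).toLinearMap.restrict fun p hp => linSubst_mem g p hp

/-- The action of an element of `GL_{n+1}` on `S_m`. -/
def glAct {R : Type*} [CommRing R] {n : ℕ} (m : ℕ) (g : GL (Fin (n + 1)) R) :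
    Forms R n m ≃ₗ[R] Forms R n m :=
  LinearEquiv.ofLinearMap (matAct m (g : Matrix (Fin (n + 1)) (Fin (n + 1)) R))
    (matAct m ((g⁻¹ : GL (Fin (n + 1)) R) : Matrix (Fin (n + 1)) (Fin (n + 1)) R))
    (by
      ext1 p
      apply Subtype.ext
      change linSubst _ (linSubst _ (p : MvPolynomial (Fin (n + 1)) R)) = p
      rw [linSubst_mul, ← Units.val_mul, mul_inv_cancel, Units.val_one, linSubst_one])
    (by
      ext1 p
      apply Subtype.ext
      change linSubst _ (linSubst _ (p : MvPolynomial (Fin (n + 1)) R)) = p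
      rw [linSubst_mul, ← Units.val_mul, inv_mul_cancel, Units.val_one, linSubst_one])

/-- Change of coefficients on forms along a ring homomorphism. -/
def coeffMap {R R' : Type*} [CommRing R] [CommRing R'] {n m : ℕ} (φ : R →+* R')
    (p : Forms R n m) : Forms R' n m :=
  ⟨MvPolynomial.map φ p.1,
    (mem_homogeneousSubmodule m _).2
      (IsHomogeneous.map ((mem_homogeneousSubmodule m _).1 p.2) φ)⟩

/-! ### Points of the Hilbert scheme, regularity and the Gotzmann number -/

section Hilbert

variable {K : Type*} [Field K] {n : ℕ}

/-- The graded piece `I_d`, as a subspace of `S_d`. -/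
def gradedPiece (I : Ideal (MvPolynomial (Fin (n + 1)) K)) (d : ℕ) :
    Submodule K (Forms K n d) :=
  (I.restrictScalars K).comap (Forms K n d).subtype

/-- `I` is a homogeneous ideal that is saturated with respect to `(x_0, …, x_n)`. These ideals
correspond to the closed subschemes of projective `n`-space. -/
def IsSaturatedIdeal (I : Ideal (MvPolynomial (Fin (n + 1)) K)) : Prop :=
  (∀ p ∈ I, ∀ d : ℕ, homogeneousComponent d p ∈ I) ∧
    ∀ p : MvPolynomial (Fin (n + 1)) K, (∀ i, ∃ k : ℕ, X i ^ k * p ∈ I) → p ∈ I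

/-- `P` is the Hilbert polynomial of `S / I`. -/
def HasHilbertPoly (I : Ideal (MvPolynomial (Fin (n + 1)) K)) (P : ℚ[X]) : Prop :=
  ∃ N : ℕ, ∀ d ≥ N,
    (Module.finrank K (Forms K n d ⧸ gradedPiece I d) : ℚ) = P.eval (d : ℚ)

/-- The `K`-points of the Hilbert scheme of projective `n`-space with Hilbert polynomial `P`,
as a set of subspaces of `S_m`: the graded pieces `I_m` of the saturated ideals `I` with Hilbert
polynomial `P`. -/
def hilb (K : Type*) [Field K] (n : ℕ) (P : ℚ[X]) (m : ℕ) : Set (Submodule K (Forms K n m)) :=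
  {V | ∃ I : Ideal (MvPolynomial (Fin (n + 1)) K),
    IsSaturatedIdeal I ∧ HasHilbertPoly I P ∧ V = gradedPiece I m}

/-- A minimal graded free resolution of a homogeneous ideal `I`:
`0 ← I ← ⨁_j S(-e_{0j}) ← ⋯ ← ⨁_j S(-e_{nj}) ← 0`, where `e_{ij} = deg i j`. -/
structure MinGradedFreeRes (I : Ideal (MvPolynomial (Fin (n + 1)) K)) where
  /-- the ranks of the free modules -/
  rank : ℕ → ℕ
  /-- the degrees of the basis elements -/
  deg : (i : ℕ) → Fin (rank i) → ℕ
  /-- the images in `I` of the basis elements of the first free module -/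
  gen : Fin (rank 0) → MvPolynomial (Fin (n + 1)) K
  /-- the matrices of the differentials -/
  diff : (i : ℕ) → Matrix (Fin (rank i)) (Fin (rank (i + 1))) (MvPolynomial (Fin (n + 1)) K)
  gen_homogeneous : ∀ j, (gen j).IsHomogeneous (deg 0 j)
  /-- the differentials have degree zero, and no entry is a nonzero constant -/
  diff_homogeneous : ∀ i k j, diff i k j = 0 ∨
    (deg i k < deg (i + 1) j ∧ (diff i k j).IsHomogeneous (deg (i + 1) j - deg i k))
  span_gen : Ideal.span (Set.range gen) = I
  exact_zero : ∀ v : Fin (rank 0) → MvPolynomial (Fin (n + 1)) K,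
    ∑ j, v j * gen j = 0 ↔ ∃ u, v = (diff 0).mulVec u
  exact_succ : ∀ (i : ℕ) (v : Fin (rank (i + 1)) → MvPolynomial (Fin (n + 1)) K),
    (diff i).mulVec v = 0 ↔ ∃ u, v = (diff (i + 1)).mulVec u
  length_le : ∀ i > n, rank i = 0

/-- The ideal `I` is `m`-regular: in its minimal graded free resolution, `e_{ij} - i ≤ m`. -/
def IsRegular (m : ℕ) (I : Ideal (MvPolynomial (Fin (n + 1)) K)) : Prop :=
  ∃ F : MinGradedFreeRes I, ∀ i j, F.deg i j ≤ m + i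

/-- `m` is the Gotzmann number of `P`: the least bound for the regularity of all saturated ideals
with Hilbert polynomial `P`. -/
def IsGotzmannNumber (K : Type*) [Field K] (n : ℕ) (P : ℚ[X]) (m : ℕ) : Prop :=
  IsLeast {m : ℕ | ∀ I : Ideal (MvPolynomial (Fin (n + 1)) K),
    IsSaturatedIdeal I → HasHilbertPoly I P → IsRegular m I} m

/-! ### Curves and tangent vectors on the Hilbert scheme -/

/-- The fibre over `t = a` of a family of subspaces of `S_m` over the affine line. -/
def fibre {m : ℕ} (M : Submodule K[X] (Forms K[X] n m)) (a : K) : Submodule K (Forms K n m) :=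
  Submodule.span K (coeffMap (Polynomial.evalRingHom a) '' (M : Set (Forms K[X] n m)))

/-- `M` is a morphism from the affine line to the Hilbert scheme: a `K[t]`-point of the
Grassmannian of `S_m` (a submodule of `S_m ⊗ K[t]` with flat, hence locally free, quotient) all
of whose fibres are points of the Hilbert scheme. -/
def IsHilbCurve {m : ℕ} (P : ℚ[X]) (M : Submodule K[X] (Forms K[X] n m)) : Prop :=
  Module.Flat K[X] (Forms K[X] n m ⧸ M) ∧ ∀ a : K, fibre M a ∈ hilb K n P m

/-- The diagonal matrix `λ_w(t)` with entries `t ^ (-w_0), …, t ^ (-w_n)`. -/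
def oneParam (w : Fin (n + 1) → ℤ) (t : K) : Matrix (Fin (n + 1)) (Fin (n + 1)) K :=
  Matrix.diagonal fun i => t ^ (-w i)

/-- `M` is the extension to the affine line of the path `t ↦ λ_w(t) g V`, `t ≠ 0`, on the Hilbert
scheme; its fibre at `0` is the limit of the path. -/
def IsPath {m : ℕ} (P : ℚ[X]) (w : Fin (n + 1) → ℤ) (g : GL (Fin (n + 1)) K)
    (V : Submodule K (Forms K n m)) (M : Submodule K[X] (Forms K[X] n m)) : Prop :=
  IsHilbCurve P M ∧
    ∀ a : K, a ≠ 0 → fibre M a = (V.map (glAct m g).toLinearMap).map (matAct m (oneParam w a))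

/-- The tangent space `Hom(V, S_m / V)` of the Grassmannian of `S_m` at `V`. -/
abbrev GrassTangent {m : ℕ} (V : Submodule K (Forms K n m)) : Type _ :=
  V →ₗ[K] (Forms K n m ⧸ V)

/-- The ideal of `S[ε]` generated by the elements `v + ε u` with `v ∈ V` and `u ∈ S_m` a
representative of `φ v`. -/
def deformationIdeal {m : ℕ} (V : Submodule K (Forms K n m)) (φ : GrassTangent V) :
    Ideal (MvPolynomial (Fin (n + 1)) (DualNumber K)) :=
  Ideal.span {q | ∃ (v : V) (u : Forms K n m), V.mkQ u = φ v ∧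
    q = MvPolynomial.map (algebraMap K (DualNumber K)) (v : Forms K n m).1 +
      C DualNumber.eps * MvPolynomial.map (algebraMap K (DualNumber K)) u.1}

/-- `φ` is tangent to the Hilbert scheme at its point `V`: the corresponding first order
deformation is flat over `K[ε]`. -/
def IsHilbTangent {m : ℕ} (V : Submodule K (Forms K n m)) (φ : GrassTangent V) : Prop :=
  Module.Flat (DualNumber K)
    (MvPolynomial (Fin (n + 1)) (DualNumber K) ⧸ deformationIdeal V φ)

/-- `φ` is the tangent vector at `t = 0` to the curve `M`: its first nonvanishing derivative at
`t = 0`. That is, `φ ≠ 0` and, for some `k ≥ 1`, every `v` in the fibre `V` of `M` at `0` extends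
to a section `v + t^k u + O(t^(k+1))` of `M` where `u` represents `φ v` modulo `V`. -/
def IsTangentVectorAtZero {m : ℕ} (M : Submodule K[X] (Forms K[X] n m))
    (φ : GrassTangent (fibre M 0)) : Prop :=
  φ ≠ 0 ∧ ∃ k : ℕ, 1 ≤ k ∧ ∀ v : fibre M 0, ∃ (u : Forms K n m) (q : Forms K[X] n m),
    (fibre M 0).mkQ u = φ v ∧
    coeffMap Polynomial.C (v : Forms K n m) +
      (Polynomial.X ^ k : K[X]) • coeffMap Polynomial.C u +
      (Polynomial.X ^ (k + 1) : K[X]) • q ∈ M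

/-! ### The Borel group -/

/-- `g` is upper triangular. -/
def IsUpperTri (g : GL (Fin (n + 1)) K) : Prop :=
  ∀ i j : Fin (n + 1), j < i → (g : Matrix (Fin (n + 1)) (Fin (n + 1)) K) i j = 0

/-- `V` is fixed by the Borel group of upper triangular matrices. -/
def BorelFixed {m : ℕ} (V : Submodule K (Forms K n m)) : Prop :=
  ∀ h : GL (Fin (n + 1)) K, IsUpperTri h → V.map (glAct m h).toLinearMap = V

/-- The action `φ ↦ h ∘ φ ∘ h⁻¹` of an element `h` of the stabilizer of `V` on tangent vectors
at `V`. -/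
def tangentAct {m : ℕ} {V : Submodule K (Forms K n m)} (h : GL (Fin (n + 1)) K)
    (hV : V.map (glAct m h).toLinearMap = V) (φ : GrassTangent V) : GrassTangent V :=
  (Submodule.Quotient.equiv V V (glAct m h) hV).toLinearMap ∘ₗ φ ∘ₗ
    ((glAct m h).ofSubmodules V V hV).symm.toLinearMap

/-- `φ` is an eigenvector for the Borel group. -/
def IsBorelEigenvector {m : ℕ} {V : Submodule K (Forms K n m)} (hV : BorelFixed V)
    (φ : GrassTangent V) : Prop :=
  φ ≠ 0 ∧ ∀ (h : GL (Fin (n + 1)) K) (hh : IsUpperTri h),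
    ∃ c : K, tangentAct h (hV h hh) φ = c • φ

/-! ### Weights and generic coordinates -/

/-- The weight vector `w` distinguishes the monomials of degree `d`. -/
def Distinguishes (w : Fin (n + 1) → ℤ) (d : ℕ) : Prop :=
  ∀ A B : Fin (n + 1) →₀ ℕ, A.degree = d → B.degree = d → A ≠ B →
    ∑ i, w i * (A i : ℤ) ≠ ∑ i, w i * (B i : ℤ)

/-- For `f = f_1 ∧ ⋯ ∧ f_r` and the generic matrix `G = (G_ij)`, the coefficient of the state
`x^{B_1} ∧ ⋯ ∧ x^{B_r}` in `G f = G f_1 ∧ ⋯ ∧ G f_r`, a polynomial in the `G_ij`. It is the minor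
of the coefficients of `x^{B_1}, …, x^{B_r}` in `G f_1, …, G f_r`. -/
def stateCoeff {r : ℕ} (f : Fin r → MvPolynomial (Fin (n + 1)) K)
    (B : Fin r → (Fin (n + 1) →₀ ℕ)) : MvPolynomial (Fin (n + 1) × Fin (n + 1)) K :=
  Matrix.det (Matrix.of fun i j => coeff (B j)
    (linSubst (Matrix.mvPolynomialX (Fin (n + 1)) (Fin (n + 1)) K) (MvPolynomial.map C (f i))))

/-- The value at `g` of a polynomial in the matrix entries. -/
def evalMatrix (g : GL (Fin (n + 1)) K) (p : MvPolynomial (Fin (n + 1) × Fin (n + 1)) K) : K :=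
  MvPolynomial.eval (fun ij => (g : Matrix (Fin (n + 1)) (Fin (n + 1)) K) ij.1 ij.2) p

/-- The set `U(f)` for `f = f_1 ∧ ⋯ ∧ f_r`, with `f_i` of degree `m`: the `g` in `GL_{n+1}` at
which none of the not identically zero coefficients of `G f` vanishes. -/
def genericSet {r : ℕ} (m : ℕ) (f : Fin r → MvPolynomial (Fin (n + 1)) K) :
    Set (GL (Fin (n + 1)) K) :=
  {g | ∀ B : Fin r → (Fin (n + 1) →₀ ℕ), (∀ j, (B j).degree = m) →
    stateCoeff f B ≠ 0 → evalMatrix g (stateCoeff f B) ≠ 0}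

/-- Zariski open subsets of `GL_{n+1}(K)`. -/
def IsZariskiOpen (U : Set (GL (Fin (n + 1)) K)) : Prop :=
  ∃ T : Set (MvPolynomial (Fin (n + 1) × Fin (n + 1)) K),
    U = {g | ∃ p ∈ T, evalMatrix g p ≠ 0}

/-- Zariski dense subsets of `GL_{n+1}(K)`. -/
def IsZariskiDense (U : Set (GL (Fin (n + 1)) K)) : Prop :=
  ∀ O : Set (GL (Fin (n + 1)) K), IsZariskiOpen O → O.Nonempty → (O ∩ U).Nonempty

end Hilbert

end

end InfGalligo

/-! Put J = gI and W = J_m, and call a tuple of r monomials a state of W when its Plücker coordinate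
on W is nonzero. The Plücker coordinates of hI_m are polynomials in the entries of h. Hence U is the
nonvanishing locus of one nonzero polynomial, the product `stateProd`, and for g in U every state of
a translate of W is already a state of W (`IsGeneric`).

Take a state b_1, …, b_r of W of maximal total weight and the basis F_i of W dual to it. Exchanging
b_i for A gives a state exactly when x^A occurs in F_i, so by maximality w·A ≤ w·b_i for all such A
(`exists_isReduced`). Rescaled, λ_w(t)F_i is the sum of c_{iA} t^(w·b_i − w·A) x^A, which is
polynomial in t. These sections span a free family with torsion-free quotient, the only flat
extension of the path. The same construction in each degree d shows that the limit ideal has the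
Hilbert function of J. Regularity at the Gotzmann number then makes it agree with its saturation
from degree m on, so the limit V lies on the Hilbert scheme. Since w separates monomials, V is
spanned by the x^{b_i}.

The Borel statements rest on one exchange argument, `coeff_ne_zero_of_adjugate_ne_zero`. Apply h to
the family and solve by Cramer's rule for the coefficients at x^A in terms of those at b. If the
i-th entry is nonzero, then b with b_i replaced by A is a state of some translate hλ_w(a)W, hence of
W, so x^A occurs in F_i. This bounds w·A above by w·b_i. An upper triangular h, on the other hand,
only adds heavier monomials, because w is decreasing. At t = 0 the two constraints collide at an
index of maximal weight, and V is h-stable (`coeff_linSubst_monomial_eq_zero`).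

Let k be the least positive gap w·b_i − w·A over the monomials of the F_i. It exists when 0 ≠ I ≠ S,
because in characteristic 0 a generic reduced basis cannot be monomial (`exists_coeff_ne_zero`). The
tangent vector sends x^{b_i} to the part of F_i of weight w·b_i − k. The exchange argument at order
t^k gives w·A + k ≤ w·b_i, and against the raising of weights only the diagonal of h survives
(`exists_coeff_glAct_gapForm_eq`). The diagonal acts by a single scalar: the monomials x^A ∏_{j≠i}
x^{b_j} coming from the tangent vector all have degree rm and the same weight, so they coincide.
Tangency to the Hilbert scheme follows from the t-saturation of the family ideal and generation of
the limit in degree m (`isHilbTangent_of_isTangentVectorAtZero`). -/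

namespace InfGalligo

open MvPolynomial
open scoped Polynomial

noncomputable section

/-! ### Homogeneous components and homogeneous ideals -/

section Homogeneous

variable {σ R R' : Type*} [CommRing R] [CommRing R']

attribute [local instance] MvPolynomial.gradedAlgebra in
theorem homogeneousComponent_mul_of_isHomogeneous {p q : MvPolynomial σ R} {a : ℕ}
    (hp : p.IsHomogeneous a) (N : ℕ) :
    homogeneousComponent N (p * q) = if a ≤ N then p * homogeneousComponent (N - a) q else 0 := by
  have e : ∀ (x : MvPolynomial σ R) (k : ℕ),
      (DirectSum.decompose (homogeneousSubmodule σ R) x k : MvPolynomial σ R) =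
        homogeneousComponent k x := fun x k => decomposition.decompose'_apply x k
  rw [← e, ← e]
  exact DirectSum.coe_decompose_mul_of_left_mem (𝒜 := homogeneousSubmodule σ R) (b := q) N
    ((mem_homogeneousSubmodule a p).2 hp)

theorem homogeneousComponent_map (φ : R →+* R') (d : ℕ) (p : MvPolynomial σ R) :
    homogeneousComponent d (map φ p) = map φ (homogeneousComponent d p) := by
  ext A
  simp only [coeff_homogeneousComponent, coeff_map]
  split_ifs <;> simp

/-- An ideal that contains the homogeneous components of its elements. -/
def IsHomogeneousIdeal (I : Ideal (MvPolynomial σ R)) : Prop :=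
  ∀ p ∈ I, ∀ d : ℕ, homogeneousComponent d p ∈ I

theorem mem_of_homogeneousComponent_mem {I : Ideal (MvPolynomial σ R)} {p : MvPolynomial σ R}
    (h : ∀ d, homogeneousComponent d p ∈ I) : p ∈ I := by
  rw [← sum_homogeneousComponent p]
  exact Ideal.sum_mem _ fun d _ => h d

attribute [local instance] MvPolynomial.gradedAlgebra in
theorem isHomogeneousIdeal_span {s : Set (MvPolynomial σ R)} (m : ℕ)
    (hs : ∀ p ∈ s, p.IsHomogeneous m) : IsHomogeneousIdeal (Ideal.span s) := by
  intro p hp d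
  exact homogeneousComponent_mem_of_mem
    (Ideal.homogeneous_span _ s fun x hx => ⟨m, (mem_homogeneousSubmodule m x).2 (hs x hx)⟩) hp d

theorem homogeneousComponent_eq_zero_of_mem_span {s : Set (MvPolynomial σ R)} {m d : ℕ}
    (hs : ∀ p ∈ s, p.IsHomogeneous m) (hd : d < m) {p : MvPolynomial σ R}
    (hp : p ∈ Ideal.span s) : homogeneousComponent d p = 0 := by
  induction hp using Submodule.span_induction with
  | mem x hx =>
    rw [homogeneousComponent_of_mem ((mem_homogeneousSubmodule m x).2 (hs x hx)), if_neg hd.ne]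
  | zero => simp
  | add x y _ _ hx hy => simp [hx, hy]
  | smul a x hx' hx =>
    -- Vanishing for x alone does not survive multiplication by a; the inner induction proves it for
    -- all multiples of x at once.
    clear hx
    revert a
    induction hx' using Submodule.span_induction with
    | mem x hx =>
      intro a
      rw [smul_eq_mul, mul_comm, homogeneousComponent_mul_of_isHomogeneous (hs x hx),
        if_neg (by omega)]
    | zero => simp
    | add x y _ _ hx hy => intro a; rw [smul_add, map_add, hx, hy, add_zero]
    | smul b x _ hx => intro a; rw [smul_smul]; exact hx _

theorem isHomogeneousIdeal_map {I : Ideal (MvPolynomial σ R)} (hI : IsHomogeneousIdeal I)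
    (φ : R →+* R') (hφ : Function.Surjective φ) :
    IsHomogeneousIdeal (I.map (MvPolynomial.map φ)) := by
  intro p hp d
  obtain ⟨q, hq, rfl⟩ := (Ideal.mem_map_iff_of_surjective _ (map_surjective φ hφ)).1 hp
  rw [homogeneousComponent_map]
  exact Ideal.mem_map_of_mem _ (hI q hq d)

end Homogeneous

/-! ### Forms -/

section Forms

variable {R : Type*} [CommRing R] {n : ℕ}

/-- The exponents of the monomials of degree `d`. -/
abbrev Exps (n d : ℕ) : Finset (Fin (n + 1) →₀ ℕ) := Finset.univ.finsuppAntidiag d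

theorem mem_exps {d : ℕ} {A : Fin (n + 1) →₀ ℕ} : A ∈ Exps n d ↔ A.degree = d := by
  simp [Exps, Finset.mem_finsuppAntidiag, Finsupp.degree_eq_sum]

theorem card_exps (n d : ℕ) : (Exps n d).card = (d + n).choose n := by
  rw [Exps, Finset.card_finsuppAntidiag_nat_eq_choose]
  simp only [Finset.card_univ, Fintype.card_fin]
  rw [show n + 1 + d - 1 = d + n by omega, ← Nat.choose_symm_of_eq_add (add_comm d n)]

theorem Forms.coeff_eq_zero {d : ℕ} (p : Forms R n d) {A : Fin (n + 1) →₀ ℕ}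
    (hA : A.degree ≠ d) : coeff A p.1 = 0 :=
  ((mem_homogeneousSubmodule d p.1).1 p.2).coeff_eq_zero hA

/-- A form is determined by its coefficients. -/
def formsEquiv (R : Type*) [CommRing R] (n d : ℕ) : Forms R n d ≃ₗ[R] (Exps n d → R) where
  toFun p A := coeff A.1 p.1
  map_add' p q := by ext A; simp
  map_smul' c p := by ext A; simp
  invFun v := ⟨∑ A : Exps n d, monomial A.1 (v A), Submodule.sum_mem _ fun A _ =>
    (mem_homogeneousSubmodule d _).2 (isHomogeneous_monomial _ (mem_exps.1 A.2))⟩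
  left_inv p := by
    apply Subtype.ext
    ext B
    simp only [coeff_sum, coeff_monomial]
    by_cases hB : B ∈ Exps n d
    · rw [Finset.sum_eq_single ⟨B, hB⟩] <;> simp +contextual [Subtype.ext_iff]
    · rw [Finset.sum_eq_zero, Forms.coeff_eq_zero p fun h => hB (mem_exps.2 h)]
      intro A _
      rw [if_neg]
      rintro rfl
      exact hB A.2
  right_inv v := by
    ext B
    simp only [coeff_sum, coeff_monomial]
    rw [Finset.sum_eq_single B]
    · simp
    · intro A _ hA
      rw [if_neg fun h => hA (Subtype.ext h)]
    · simp

instance (d : ℕ) : Module.Finite R (Forms R n d) :=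
  Module.Finite.equiv (formsEquiv R n d).symm

theorem finrank_forms [StrongRankCondition R] (n d : ℕ) :
    Module.finrank R (Forms R n d) = (d + n).choose n := by
  rw [(formsEquiv R n d).finrank_eq, Module.finrank_fintype_fun_eq_card, Fintype.card_coe,
    card_exps]

/-- The monomial with exponent `A`, as a form. -/
def monoForm (R : Type*) [CommRing R] {n d : ℕ} (A : Fin (n + 1) →₀ ℕ) (hA : A.degree = d) :
    Forms R n d :=
  ⟨monomial A 1, (mem_homogeneousSubmodule d _).2 (isHomogeneous_monomial _ hA)⟩

/-- The forms of degree `d` in an ideal. -/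
def idealForms (I : Ideal (MvPolynomial (Fin (n + 1)) R)) (d : ℕ) : Submodule R (Forms R n d) :=
  (I.restrictScalars R).comap (Forms R n d).subtype

theorem mem_idealForms {I : Ideal (MvPolynomial (Fin (n + 1)) R)} {d : ℕ} {p : Forms R n d} :
    p ∈ idealForms I d ↔ p.1 ∈ I := Iff.rfl

theorem mem_gradedPiece {K : Type*} [Field K] {I : Ideal (MvPolynomial (Fin (n + 1)) K)} {d : ℕ}
    {p : Forms K n d} : p ∈ gradedPiece I d ↔ p.1 ∈ I := Iff.rfl

theorem linSubst_homogeneousComponent (g : Matrix (Fin (n + 1)) (Fin (n + 1)) R) (d : ℕ)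
    (p : MvPolynomial (Fin (n + 1)) R) :
    linSubst g (homogeneousComponent d p) = homogeneousComponent d (linSubst g p) := by
  conv_rhs => rw [← sum_homogeneousComponent p]
  simp only [map_sum]
  rw [Finset.sum_congr rfl fun i _ => homogeneousComponent_of_mem
    (linSubst_mem g _ (homogeneousComponent_mem i p))]
  rw [Finset.sum_ite_eq]
  split_ifs with h
  · rfl
  · rw [homogeneousComponent_eq_zero, map_zero]
    simpa [Nat.lt_succ_iff] using h

theorem glAct_apply {m : ℕ} (g : GL (Fin (n + 1)) R) (p : Forms R n m) :
    (glAct m g p).1 = linSubst (g : Matrix (Fin (n + 1)) (Fin (n + 1)) R) p.1 := rfl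

theorem coeffMap_add {R' : Type*} [CommRing R'] {m : ℕ} (φ : R →+* R') (p q : Forms R n m) :
    coeffMap φ (p + q) = coeffMap φ p + coeffMap φ q := Subtype.ext (by simp [coeffMap])

theorem coeffMap_zero {R' : Type*} [CommRing R'] {m : ℕ} (φ : R →+* R') :
    coeffMap φ (0 : Forms R n m) = 0 := Subtype.ext (by simp [coeffMap])

theorem coeffMap_smul {R' : Type*} [CommRing R'] {m : ℕ} (φ : R →+* R') (c : R)
    (p : Forms R n m) : coeffMap φ (c • p) = φ c • coeffMap φ p :=
  Subtype.ext (by simp [coeffMap, smul_eq_C_mul])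

@[simp]
theorem coeff_coeffMap {R' : Type*} [CommRing R'] {m : ℕ} (φ : R →+* R')
    (p : Forms R n m) (A : Fin (n + 1) →₀ ℕ) :
    coeff A (coeffMap φ p).1 = φ (coeff A p.1) :=
  coeff_map _ _ _

theorem Forms.ext_coeff {m : ℕ} {p q : Forms R n m} (h : ∀ A, coeff A p.1 = coeff A q.1) :
    p = q := Subtype.ext (MvPolynomial.ext _ _ h)

/-- A coefficient, as a linear map on forms. -/
def coeffForm {m : ℕ} (A : Fin (n + 1) →₀ ℕ) : Forms R n m →ₗ[R] R :=
  lcoeff R A ∘ₗ (Forms R n m).subtype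

theorem Forms.coeff_sum {ι : Type*} {m : ℕ} (s : Finset ι) (p : ι → Forms R n m)
    (A : Fin (n + 1) →₀ ℕ) : coeff A (∑ i ∈ s, p i).1 = ∑ i ∈ s, coeff A (p i).1 :=
  map_sum (coeffForm A) p s

theorem Forms.coeff_smul {m : ℕ} (c : R) (p : Forms R n m) (A : Fin (n + 1) →₀ ℕ) :
    coeff A (c • p).1 = c * coeff A p.1 :=
  MvPolynomial.coeff_smul A c p.1

theorem Forms.coeff_add {m : ℕ} (p q : Forms R n m) (A : Fin (n + 1) →₀ ℕ) :
    coeff A (p + q).1 = coeff A p.1 + coeff A q.1 :=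
  MvPolynomial.coeff_add A p.1 q.1

theorem Forms.coeff_sub {m : ℕ} (p q : Forms R n m) (A : Fin (n + 1) →₀ ℕ) :
    coeff A (p - q).1 = coeff A p.1 - coeff A q.1 :=
  map_sub (coeffForm A) p q

theorem Forms.coeff_zero {m : ℕ} (A : Fin (n + 1) →₀ ℕ) : coeff A (0 : Forms R n m).1 = 0 :=
  MvPolynomial.coeff_zero A

end Forms

/-! ### Fibres of families -/

section Fibre

variable {K : Type*} [Field K] {n : ℕ}

theorem mem_fibre {m : ℕ} {M : Submodule K[X] (Forms K[X] n m)} {a : K} {v : Forms K n m} :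
    v ∈ fibre M a ↔ ∃ q ∈ M, coeffMap (Polynomial.evalRingHom a) q = v := by
  refine ⟨fun h => ?_, fun ⟨q, hq, h⟩ => h ▸ Submodule.subset_span ⟨q, hq, rfl⟩⟩
  induction h using Submodule.span_induction with
  | mem x hx => exact hx
  | zero => exact ⟨0, M.zero_mem, coeffMap_zero _⟩
  | add x y _ _ hx hy =>
    obtain ⟨q, hq, rfl⟩ := hx
    obtain ⟨q', hq', rfl⟩ := hy
    exact ⟨q + q', M.add_mem hq hq', coeffMap_add _ _ _⟩
  | smul c x _ hx =>
    obtain ⟨q, hq, rfl⟩ := hx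
    exact ⟨Polynomial.C c • q, M.smul_mem _ hq, by rw [coeffMap_smul]; simp⟩

theorem evalRingHom_surjective (a : K) : Function.Surjective (Polynomial.evalRingHom a) :=
  fun c => ⟨Polynomial.C c, by simp⟩

/-- Evaluation at `a` is surjective, so the image of `J` is already an ideal; homogeneity lets a
lift of a form be replaced by its component of degree `d`. -/
theorem fibre_idealForms {J : Ideal (MvPolynomial (Fin (n + 1)) K[X])}
    (hJ : IsHomogeneousIdeal J) (d : ℕ) (a : K) :
    fibre (idealForms J d) a =
      gradedPiece (J.map (MvPolynomial.map (Polynomial.evalRingHom a))) d := by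
  ext v
  rw [mem_fibre, mem_gradedPiece,
    Ideal.mem_map_iff_of_surjective _ (map_surjective _ (evalRingHom_surjective a))]
  constructor
  · rintro ⟨q, hq, rfl⟩
    exact ⟨q.1, hq, rfl⟩
  · rintro ⟨q, hq, hqv⟩
    refine ⟨⟨homogeneousComponent d q, homogeneousComponent_mem d q⟩, hJ q hq d, Subtype.ext ?_⟩
    change MvPolynomial.map _ (homogeneousComponent d q) = v.1
    rw [← homogeneousComponent_map, hqv]
    exact homogeneousComponent_eq_self v.2

end Fibre

/-! ### Regularity and Hilbert functions -/

section Regularity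

variable {K : Type*} [Field K] {n : ℕ}

/-- The Hilbert polynomial of `S(-e)`. -/
def shiftPoly (n e : ℕ) : ℚ[X] :=
  Polynomial.C ((n.factorial : ℚ)⁻¹) *
    (ascPochhammer ℚ n).comp (Polynomial.X + Polynomial.C (1 - (e : ℚ)))

/-- The polynomial (x+1−e)⋯(x+n−e)/n! vanishes at e−n, …, e−1, so it is correct n degrees before the
generator appears. This margin absorbs the shifts m + i, i ≤ n, of a regular resolution. -/
theorem eval_shiftPoly {n e d : ℕ} (h : e ≤ d + n) :
    (shiftPoly n e).eval (d : ℚ) = if e ≤ d then ((d - e + n).choose n : ℚ) else 0 := by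
  have hn : (n.factorial : ℚ) ≠ 0 := by exact_mod_cast n.factorial_ne_zero
  simp only [shiftPoly, Polynomial.eval_mul, Polynomial.eval_C, Polynomial.eval_comp,
    Polynomial.eval_add, Polynomial.eval_X]
  split_ifs with hd
  · obtain ⟨z, rfl⟩ := Nat.exists_eq_add_of_le hd
    rw [show ((e + z : ℕ) : ℚ) + (1 - e) = ((z + 1 : ℕ) : ℚ) by push_cast; ring,
      ← ascPochhammer_eval_cast, ascPochhammer_nat_eq_ascFactorial,
      Nat.ascFactorial_eq_factorial_mul_choose]
    rw [Nat.add_sub_cancel_left]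
    push_cast
    field_simp
  · obtain ⟨z, rfl⟩ := Nat.exists_eq_add_of_lt (not_le.1 hd)
    rw [show (d : ℚ) + (1 - ((d + z + 1 : ℕ) : ℚ)) = -(z : ℚ) by push_cast; ring,
      ascPochhammer_eval_neg_coe_nat_of_lt (by omega), mul_zero]

/-- The forms of degree `d` in the graded module `S(-e)`. -/
def shiftForms (K : Type*) [Field K] (n e d : ℕ) :
    Submodule K (MvPolynomial (Fin (n + 1)) K) :=
  if e ≤ d then Forms K n (d - e) else ⊥

/-- The component of degree `d` of an element of `S(-e)`. -/
def shiftComponent (K : Type*) [Field K] (n e d : ℕ) :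
    MvPolynomial (Fin (n + 1)) K →ₗ[K] MvPolynomial (Fin (n + 1)) K :=
  if e ≤ d then homogeneousComponent (d - e) else 0

theorem shiftForms_of_le {e d : ℕ} (h : e ≤ d) : shiftForms K n e d = Forms K n (d - e) :=
  if_pos h

theorem shiftForms_of_lt {e d : ℕ} (h : ¬e ≤ d) : shiftForms K n e d = ⊥ :=
  if_neg h

instance (e d : ℕ) : Module.Finite K (shiftForms K n e d) := by
  by_cases h : e ≤ d
  · rw [shiftForms_of_le h]
    infer_instance
  · rw [shiftForms_of_lt h]
    infer_instance

theorem finrank_shiftForms {e d : ℕ} (h : e ≤ d + n) :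
    (Module.finrank K (shiftForms K n e d) : ℚ) = (shiftPoly n e).eval (d : ℚ) := by
  rw [eval_shiftPoly h]
  split_ifs with hd
  · rw [shiftForms_of_le hd, finrank_forms]
  · rw [shiftForms_of_lt hd]
    simp

theorem shiftComponent_mem (e d : ℕ) (p : MvPolynomial (Fin (n + 1)) K) :
    shiftComponent K n e d p ∈ shiftForms K n e d := by
  unfold shiftComponent shiftForms
  split_ifs
  · exact homogeneousComponent_mem _ _
  · simp

theorem shiftComponent_of_mem {e d : ℕ} {p : MvPolynomial (Fin (n + 1)) K}
    (hp : p ∈ shiftForms K n e d) : shiftComponent K n e d p = p := by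
  unfold shiftComponent
  unfold shiftForms at hp
  split_ifs at hp ⊢
  · exact homogeneousComponent_eq_self hp
  · simp_all

theorem shiftComponent_mul {e e' d : ℕ} {p q : MvPolynomial (Fin (n + 1)) K}
    (h : p = 0 ∨ (e ≤ e' ∧ p.IsHomogeneous (e' - e))) :
    shiftComponent K n e d (p * q) = p * shiftComponent K n e' d q := by
  obtain rfl | ⟨h, hp⟩ := h
  · simp
  · unfold shiftComponent
    by_cases h1 : e ≤ d
    · rw [if_pos h1, homogeneousComponent_mul_of_isHomogeneous hp]
      by_cases h2 : e' ≤ d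
      · rw [if_pos (by omega), if_pos h2, show d - e - (e' - e) = d - e' by omega]
      · rw [if_neg (by omega), if_neg h2]
        simp
    · rw [if_neg h1, if_neg (by omega)]
      simp

/-- The forms of degree `d` in the graded free module `⨁ S(-e_j)`. -/
def freeForms (K : Type*) [Field K] (n : ℕ) {k : ℕ} (e : Fin k → ℕ) (d : ℕ) :
    Submodule K (Fin k → MvPolynomial (Fin (n + 1)) K) :=
  Submodule.pi Set.univ fun j => shiftForms K n (e j) d

/-- The forms of degree `d` in a graded free module, componentwise. -/
def freeFormsEquiv {k : ℕ} (e : Fin k → ℕ) (d : ℕ) :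
    freeForms K n e d ≃ₗ[K] ((j : Fin k) → shiftForms K n (e j) d) where
  toFun v j := ⟨v.1 j, v.2 j trivial⟩
  map_add' _ _ := rfl
  map_smul' _ _ := rfl
  invFun v := ⟨fun j => (v j).1, fun j _ => (v j).2⟩
  left_inv _ := rfl
  right_inv _ := rfl

instance {k : ℕ} (e : Fin k → ℕ) (d : ℕ) : Module.Finite K (freeForms K n e d) :=
  Module.Finite.equiv (freeFormsEquiv e d).symm

theorem finrank_freeForms {k : ℕ} {e : Fin k → ℕ} {d : ℕ} (h : ∀ j, e j ≤ d + n) :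
    (Module.finrank K (freeForms K n e d) : ℚ) = (∑ j, shiftPoly n (e j)).eval (d : ℚ) := by
  rw [(freeFormsEquiv e d).finrank_eq, Module.finrank_pi_fintype, Polynomial.eval_finsetSum,
    Nat.cast_sum]
  exact Finset.sum_congr rfl fun j _ => finrank_shiftForms (h j)

/-- The component of degree `d` of an element of a graded free module. -/
def freeComponent {k : ℕ} (e : Fin k → ℕ) (d : ℕ) (v : Fin k → MvPolynomial (Fin (n + 1)) K) :
    Fin k → MvPolynomial (Fin (n + 1)) K :=
  fun j => shiftComponent K n (e j) d (v j)

theorem freeComponent_mem {k : ℕ} (e : Fin k → ℕ) (d : ℕ)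
    (v : Fin k → MvPolynomial (Fin (n + 1)) K) : freeComponent e d v ∈ freeForms K n e d :=
  fun j _ => shiftComponent_mem (e j) d (v j)

theorem freeComponent_of_mem {k : ℕ} {e : Fin k → ℕ} {d : ℕ}
    {v : Fin k → MvPolynomial (Fin (n + 1)) K} (hv : v ∈ freeForms K n e d) :
    freeComponent e d v = v :=
  funext fun j => shiftComponent_of_mem (hv j trivial)

/-- Since the differentials have degree zero, the ungraded exactness of a resolution can be read off
one degree at a time. -/
theorem freeComponent_mulVec {k l : ℕ} {e : Fin k → ℕ} {e' : Fin l → ℕ}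
    {D : Matrix (Fin k) (Fin l) (MvPolynomial (Fin (n + 1)) K)}
    (hD : ∀ i j, D i j = 0 ∨ (e i ≤ e' j ∧ (D i j).IsHomogeneous (e' j - e i))) (d : ℕ)
    (v : Fin l → MvPolynomial (Fin (n + 1)) K) :
    freeComponent e d (D.mulVec v) = D.mulVec (freeComponent e' d v) := by
  funext i
  simp only [freeComponent, Matrix.mulVec, dotProduct, map_sum]
  exact Finset.sum_congr rfl fun j _ => shiftComponent_mul (hD i j)

/-- Multiplication by a matrix of polynomials, as a linear map over the base field. -/
def mulVecMap {k l : ℕ} (D : Matrix (Fin k) (Fin l) (MvPolynomial (Fin (n + 1)) K)) :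
    (Fin l → MvPolynomial (Fin (n + 1)) K) →ₗ[K] (Fin k → MvPolynomial (Fin (n + 1)) K) :=
  D.mulVecLin.restrictScalars K

theorem mulVecMap_apply {k l : ℕ} (D : Matrix (Fin k) (Fin l) (MvPolynomial (Fin (n + 1)) K))
    (v : Fin l → MvPolynomial (Fin (n + 1)) K) : mulVecMap D v = D.mulVec v := rfl

theorem mulVecMap_freeForms_le {k l : ℕ} {e : Fin k → ℕ} {e' : Fin l → ℕ}
    {D : Matrix (Fin k) (Fin l) (MvPolynomial (Fin (n + 1)) K)}
    (hD : ∀ i j, D i j = 0 ∨ (e i ≤ e' j ∧ (D i j).IsHomogeneous (e' j - e i))) (d : ℕ) :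
    (freeForms K n e' d).map (mulVecMap D) ≤ freeForms K n e d := by
  rintro _ ⟨v, hv, rfl⟩
  rw [mulVecMap_apply, ← freeComponent_of_mem hv, ← freeComponent_mulVec hD]
  exact freeComponent_mem _ _ _

theorem finrank_inf_ker_add_finrank_map {V W : Type*} [AddCommGroup V] [Module K V]
    [AddCommGroup W] [Module K W] (G : Submodule K V) [Module.Finite K G] (f : V →ₗ[K] W) :
    Module.finrank K (G ⊓ LinearMap.ker f : Submodule K V) + Module.finrank K (G.map f) =
      Module.finrank K G := by
  rw [← (f.domRestrict G).finrank_range_add_finrank_ker, add_comm]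
  congr 1
  · rw [LinearMap.range_domRestrict]
  · rw [LinearMap.ker_domRestrict, ← Submodule.finrank_map_subtype_eq G,
      Submodule.map_comap_subtype]

/-- A function on the natural numbers that agrees with a polynomial from `m` on. -/
def PolyFrom (m : ℕ) (f : ℕ → ℕ) : Prop :=
  ∃ Q : ℚ[X], ∀ d ≥ m, (f d : ℚ) = Q.eval (d : ℚ)

theorem PolyFrom.of_add {m : ℕ} {f g h : ℕ → ℕ} (hg : PolyFrom m g) (hh : PolyFrom m h)
    (e : ∀ d ≥ m, g d + f d = h d) : PolyFrom m f := by
  obtain ⟨Q, hQ⟩ := hg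
  obtain ⟨Q', hQ'⟩ := hh
  refine ⟨Q' - Q, fun d hd => ?_⟩
  rw [Polynomial.eval_sub, ← hQ d hd, ← hQ' d hd, ← e d hd]
  push_cast
  ring

theorem polyFrom_finrank_freeForms {m k : ℕ} {e : Fin k → ℕ} (h : ∀ j, e j ≤ m + n) :
    PolyFrom m fun d => Module.finrank K (freeForms K n e d) :=
  ⟨_, fun d hd => finrank_freeForms fun j => (h j).trans (by omega)⟩

namespace MinGradedFreeRes

variable {I : Ideal (MvPolynomial (Fin (n + 1)) K)} (F : MinGradedFreeRes I)

/-- The map from the first free module onto the ideal, as a matrix with one row. -/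
def genRow : Matrix (Fin 1) (Fin (F.rank 0)) (MvPolynomial (Fin (n + 1)) K) :=
  Matrix.of fun _ j => F.gen j

theorem genRow_mulVec (v : Fin (F.rank 0) → MvPolynomial (Fin (n + 1)) K) (i : Fin 1) :
    F.genRow.mulVec v i = ∑ j, v j * F.gen j := by
  simp [genRow, Matrix.mulVec, dotProduct, mul_comm]

/-- The syzygies of degree `d` in the `i`-th free module. -/
def syz (d : ℕ) : (i : ℕ) → Submodule K (Fin (F.rank i) → MvPolynomial (Fin (n + 1)) K)
  | 0 => freeForms K n (F.deg 0) d ⊓ LinearMap.ker (mulVecMap F.genRow)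
  | i + 1 => freeForms K n (F.deg (i + 1)) d ⊓ LinearMap.ker (mulVecMap (F.diff i))

theorem diff_homogeneous' (i : ℕ) (k : Fin (F.rank i)) (j : Fin (F.rank (i + 1))) :
    F.diff i k j = 0 ∨
      (F.deg i k ≤ F.deg (i + 1) j ∧
        (F.diff i k j).IsHomogeneous (F.deg (i + 1) j - F.deg i k)) :=
  (F.diff_homogeneous i k j).imp_right fun h => ⟨h.1.le, h.2⟩

/-- Exactness gives a preimage that need not be homogeneous; its component of degree `d` is a
preimage as well. -/
theorem map_freeForms_eq_syz (d i : ℕ) :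
    (freeForms K n (F.deg (i + 1)) d).map (mulVecMap (F.diff i)) = F.syz d i := by
  have key : ∀ v : Fin (F.rank i) → MvPolynomial (Fin (n + 1)) K, v ∈ F.syz d i ↔
      v ∈ freeForms K n (F.deg i) d ∧ ∃ u, v = (F.diff i).mulVec u := by
    cases i with
    | zero =>
      intro v
      rw [← F.exact_zero, syz, Submodule.mem_inf, LinearMap.mem_ker, mulVecMap_apply, funext_iff]
      simp [genRow_mulVec]
    | succ i =>
      intro v
      rw [← F.exact_succ, syz, Submodule.mem_inf, LinearMap.mem_ker, mulVecMap_apply]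
  ext v
  rw [key]
  constructor
  · rintro ⟨u, hu, rfl⟩
    exact ⟨mulVecMap_freeForms_le (F.diff_homogeneous' i) d ⟨u, hu, rfl⟩, u, rfl⟩
  · rintro ⟨hv, u, rfl⟩
    refine ⟨freeComponent (F.deg (i + 1)) d u, freeComponent_mem _ _ _, ?_⟩
    rw [mulVecMap_apply, ← freeComponent_mulVec (F.diff_homogeneous' i), freeComponent_of_mem hv]

theorem finrank_syz_add (d i : ℕ) :
    Module.finrank K (F.syz d (i + 1)) + Module.finrank K (F.syz d i) =
      Module.finrank K (freeForms K n (F.deg (i + 1)) d) := by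
  rw [← finrank_inf_ker_add_finrank_map (freeForms K n (F.deg (i + 1)) d)
    (mulVecMap (F.diff i)), map_freeForms_eq_syz]
  rfl

/-- The syzygies are the image of the next free module, which has rank 0 here. This starts the
descending induction on `i`. -/
theorem finrank_syz_eq_zero (d : ℕ) {i : ℕ} (hi : n ≤ i) : Module.finrank K (F.syz d i) = 0 := by
  have h := F.finrank_syz_add d i
  have h0 : Module.finrank K (freeForms K n (F.deg (i + 1)) d) = 0 := by
    have := F.length_le (i + 1) (by omega)
    rw [(freeFormsEquiv _ d).finrank_eq, Module.finrank_pi_fintype]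
    exact Finset.sum_eq_zero fun j _ => absurd j.2 (by omega)
  omega

theorem polyFrom_finrank_syz {m : ℕ} (hF : ∀ i j, F.deg i j ≤ m + i) (i : ℕ) :
    PolyFrom m fun d => Module.finrank K (F.syz d i) := by
  obtain hi | hi := le_total n i
  · exact ⟨0, fun d _ => by simp [F.finrank_syz_eq_zero d hi]⟩
  · induction hi using Nat.decreasingInduction with
    | self => exact ⟨0, fun d _ => by simp [F.finrank_syz_eq_zero d le_rfl]⟩
    | of_succ i hi ih =>
      -- As i < n, the shifts are at most m + i + 1 ≤ m + n, so the dimensions of the free module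
      -- are polynomial from degree m on.
      exact ih.of_add (polyFrom_finrank_freeForms fun j => (hF (i + 1) j).trans (by omega))
        fun d _ => F.finrank_syz_add d i

theorem gen_mem (j : Fin (F.rank 0)) : F.gen j ∈ I :=
  F.span_gen.le (Ideal.subset_span ⟨j, rfl⟩)

theorem exists_eq_sum {p : MvPolynomial (Fin (n + 1)) K} (hp : p ∈ I) :
    ∃ v : Fin (F.rank 0) → MvPolynomial (Fin (n + 1)) K, ∑ j, v j * F.gen j = p := by
  rw [← F.span_gen] at hp
  exact (Ideal.mem_span_range_iff_exists_fun).1 hp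

theorem genRow_homogeneous (i : Fin 1) (j : Fin (F.rank 0)) :
    F.genRow i j = 0 ∨
      ((fun _ => 0 : Fin 1 → ℕ) i ≤ F.deg 0 j ∧
        (F.genRow i j).IsHomogeneous (F.deg 0 j - (fun _ => 0 : Fin 1 → ℕ) i)) :=
  Or.inr ⟨Nat.zero_le _, F.gen_homogeneous j⟩

theorem finrank_map_genRow (d : ℕ) :
    Module.finrank K ((freeForms K n (F.deg 0) d).map (mulVecMap F.genRow)) =
      Module.finrank K (gradedPiece I d) := by
  refine LinearEquiv.finrank_eq (LinearEquiv.symm ?_)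
  refine LinearEquiv.ofBijective
    (M := gradedPiece I d)
    (M₂ := (freeForms K n (F.deg 0) d).map (mulVecMap F.genRow))
    { toFun := fun p => ⟨fun _ => p.1.1, ?_⟩
      map_add' := fun _ _ => rfl
      map_smul' := fun _ _ => rfl } ⟨?_, ?_⟩
  · obtain ⟨v, hv⟩ := F.exists_eq_sum p.2
    refine ⟨freeComponent (F.deg 0) d v, freeComponent_mem _ _ _, ?_⟩
    rw [mulVecMap_apply, ← freeComponent_mulVec F.genRow_homogeneous]
    funext i
    rw [freeComponent, genRow_mulVec, hv]
    refine shiftComponent_of_mem ?_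
    simp [shiftForms]
  · intro p q h
    exact Subtype.ext (Subtype.ext (congrFun (congrArg Subtype.val h) 0))
  · rintro ⟨_, v, hv, rfl⟩
    have h := mulVecMap_freeForms_le F.genRow_homogeneous d ⟨v, hv, rfl⟩ 0 trivial
    rw [mulVecMap_apply, genRow_mulVec] at h
    refine ⟨⟨⟨∑ j, v j * F.gen j, by simpa [shiftForms] using h⟩, ?_⟩, Subtype.ext ?_⟩
    · change ∑ j, v j * F.gen j ∈ I
      exact Ideal.sum_mem _ fun j _ => Ideal.mul_mem_left _ _ (F.gen_mem j)
    · funext i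
      exact (F.genRow_mulVec v i).symm

theorem polyFrom_finrank_gradedPiece {m : ℕ} (hF : ∀ i j, F.deg i j ≤ m + i) :
    PolyFrom m fun d => Module.finrank K (gradedPiece I d) := by
  refine (F.polyFrom_finrank_syz hF 0).of_add (polyFrom_finrank_freeForms
    (K := K) (n := n) (e := F.deg 0) fun j => (hF 0 j).trans (by omega)) fun d _ => ?_
  rw [← finrank_inf_ker_add_finrank_map (freeForms K n (F.deg 0) d) (mulVecMap F.genRow),
    F.finrank_map_genRow]
  rfl

end MinGradedFreeRes

theorem finrank_quotient_gradedPiece (I : Ideal (MvPolynomial (Fin (n + 1)) K)) (d : ℕ) :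
    Module.finrank K (Forms K n d ⧸ gradedPiece I d) + Module.finrank K (gradedPiece I d) =
      (d + n).choose n := by
  rw [Submodule.finrank_quotient_add_finrank, finrank_forms]

theorem polynomial_eq_of_eventually_eval_nat {P Q : ℚ[X]} {N : ℕ}
    (h : ∀ d ≥ N, P.eval (d : ℚ) = Q.eval (d : ℚ)) : P = Q := by
  refine Polynomial.eq_of_infinite_eval_eq P Q ?_
  refine Set.Infinite.mono (s := (fun d : ℕ => (d : ℚ)) '' Set.Ici N) ?_
    ((Set.Ici_infinite N).image Nat.cast_injective.injOn)
  rintro _ ⟨d, hd, rfl⟩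
  exact h d hd

/-- The Hilbert function of an `m`-regular ideal agrees with its Hilbert polynomial from `m` on. -/
theorem IsRegular.finrank_eq {I : Ideal (MvPolynomial (Fin (n + 1)) K)} {m : ℕ} {P : ℚ[X]}
    (hm : IsRegular m I) (hP : HasHilbertPoly I P) {d : ℕ} (hd : m ≤ d) :
    (Module.finrank K (gradedPiece I d) : ℚ) = ((d + n).choose n : ℕ) - P.eval (d : ℚ) := by
  obtain ⟨F, hF⟩ := hm
  obtain ⟨Q, hQ⟩ := F.polyFrom_finrank_gradedPiece hF
  obtain ⟨N, hN⟩ := hP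
  have hchoose : ∀ d : ℕ, (((d + n).choose n : ℕ) : ℚ) = (shiftPoly n 0).eval (d : ℚ) := by
    intro d
    rw [eval_shiftPoly (Nat.zero_le _)]
    simp
  -- `P` is prescribed only in large degrees, but two polynomials that agree there are equal; this
  -- carries the formula down to degree `m`.
  have hPQ : P = shiftPoly n 0 - Q := by
    refine polynomial_eq_of_eventually_eval_nat (N := max N m) fun d hd => ?_
    rw [Polynomial.eval_sub, ← hN d (le_of_max_le_left hd), ← hQ d (le_of_max_le_right hd),
      ← hchoose, ← finrank_quotient_gradedPiece I d]
    push_cast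
    ring
  rw [hQ d hd, hPQ, Polynomial.eval_sub, ← hchoose]
  ring

/-- An `m`-regular ideal is generated in degree `m`, in degrees `d ≥ m`. -/
theorem IsRegular.gradedPiece_span {I : Ideal (MvPolynomial (Fin (n + 1)) K)} {m : ℕ}
    (hm : IsRegular m I) {d : ℕ} (hd : m ≤ d) :
    gradedPiece (Ideal.span ((fun p : Forms K n m => p.1) '' (gradedPiece I m : Set _))) d =
      gradedPiece I d := by
  obtain ⟨F, hF⟩ := hm
  apply le_antisymm
  · intro p hp
    refine Ideal.span_le.2 ?_ hp
    rintro _ ⟨q, hq, rfl⟩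
    exact hq
  · intro p hp
    rw [mem_gradedPiece] at hp ⊢
    obtain ⟨v, hv⟩ := F.exists_eq_sum hp
    rw [← homogeneousComponent_eq_self p.2, ← hv, map_sum]
    refine Ideal.sum_mem _ fun j _ => ?_
    rw [mul_comm, homogeneousComponent_mul_of_isHomogeneous (F.gen_homogeneous j)]
    split_ifs with hj
    swap
    · exact Ideal.zero_mem _
    have hje := hF 0 j
    rw [(homogeneousComponent (d - F.deg 0 j) (v j)).as_sum, Finset.mul_sum]
    refine Ideal.sum_mem _ fun A hA => ?_
    have hdeg : A.degree = d - F.deg 0 j := by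
      by_contra h
      rw [mem_support_iff, coeff_homogeneousComponent, if_neg h] at hA
      exact hA rfl
    obtain ⟨B, hBA, hB⟩ : ∃ B ≤ A, B.degree = m - F.deg 0 j := by
      have : m - F.deg 0 j ≤ A.degree := by omega
      exact Finsupp.exists_le_degree_eq A _ this
    obtain ⟨B', rfl⟩ := exists_add_of_le hBA
    rw [show ∀ c : K, F.gen j * monomial (B + B') c =
      monomial B' c * (F.gen j * monomial B 1) by
        intro c
        rw [mul_left_comm, monomial_mul, mul_one, add_comm B]]
    refine Ideal.mul_mem_left _ _ (Ideal.subset_span ⟨⟨F.gen j * monomial B 1, ?_⟩, ?_, rfl⟩)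
    · rw [mem_homogeneousSubmodule]
      have := (F.gen_homogeneous j).mul (isHomogeneous_monomial (1 : K) hB)
      rwa [show F.deg 0 j + (m - F.deg 0 j) = m by omega] at this
    · exact Ideal.mul_mem_right _ _ (F.gen_mem j)

end Regularity

/-! ### States of a space of forms -/

section States

variable {K : Type*} [Field K] {n m r : ℕ}

/-- The coefficients of the monomials `x^{B_1}, …, x^{B_r}` determine the elements of `W`. If `W`
has dimension `r`, this says that the coefficient of `x^{B_1} ∧ ⋯ ∧ x^{B_r}` in `⋀^r W` does not
vanish. -/
def IsState (W : Submodule K (Forms K n m)) (B : Fin r → (Fin (n + 1) →₀ ℕ)) : Prop :=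
  ∀ x ∈ W, (∀ j, coeff (B j) x.1 = 0) → x = 0

/-- An element of `W` killed by all `c j` is, in the basis `e`, a row vector in the left kernel of
the matrix. -/
theorem det_ne_zero_iff_of_basis {E : Type*} [AddCommGroup E] [Module K E] {W : Submodule K E}
    (e : Module.Basis (Fin r) K W) (c : Fin r → E →ₗ[K] K) :
    (∀ x ∈ W, (∀ j, c j x = 0) → x = 0) ↔
      (Matrix.of fun i j => c j (e i : E)).det ≠ 0 := by
  rw [Ne, ← Matrix.exists_vecMul_eq_zero_iff, not_exists]
  have key : ∀ v : Fin r → K, ∀ j, c j (∑ i, v i • e i : W) =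
      Matrix.vecMul v (Matrix.of fun i j => c j (e i : E)) j := by
    intro v j
    simp [Matrix.vecMul, dotProduct]
  constructor
  · rintro h v ⟨hv, hv0⟩
    refine hv (funext fun i => ?_)
    let x : W := ∑ i, v i • e i
    have h2 : x = 0 := Subtype.ext (h x.1 x.2 fun j => (key v j).trans (congrFun hv0 j))
    exact Fintype.linearIndependent_iff.1 e.linearIndependent v h2 i
  · intro h x hx hx0
    by_contra hne
    refine h (e.repr ⟨x, hx⟩) ⟨fun h0 => hne ?_, funext fun j => ?_⟩
    · have : (⟨x, hx⟩ : W) = 0 := by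
        rw [← e.sum_repr ⟨x, hx⟩]
        exact Finset.sum_eq_zero fun i _ => by rw [congrFun h0 i]; exact zero_smul _ _
      exact congrArg Subtype.val this
    · rw [← key, e.sum_repr]
      exact hx0 j

/-- A maximal independent subfamily of the functionals restricted to `W` has the same span, hence
the same common zeros. Independence bounds its size by r from above, injectivity of its joint
evaluation from below. -/
theorem exists_coordinates {E ι : Type*} [AddCommGroup E] [Module K E] [Finite ι]
    {W : Submodule K E} [Module.Finite K W] (hr : Module.finrank K W = r) (c : ι → E →ₗ[K] K)
    (hc : ∀ x, (∀ i, c i x = 0) → x = 0) :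
    ∃ B : Fin r → ι, ∀ x ∈ W, (∀ j, c (B j) x = 0) → x = 0 := by
  let v : ι → Module.Dual K W := fun A => c A ∘ₗ W.subtype
  obtain ⟨κ, a, ha, hspan, hli⟩ := exists_linearIndependent' K v
  have : Finite κ := Finite.of_injective a ha
  have := Fintype.ofFinite κ
  have hker : ∀ x : W, (∀ k, v (a k) x = 0) → x = 0 := by
    intro x hx
    have h1 : ∀ ℓ ∈ Submodule.span K (Set.range (v ∘ a)), ℓ x = 0 := by
      intro ℓ hℓ
      induction hℓ using Submodule.span_induction with
      | mem y hy => obtain ⟨k, rfl⟩ := hy; exact hx k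
      | zero => rfl
      | add y z _ _ hy hz => rw [LinearMap.add_apply, hy, hz, add_zero]
      | smul c y _ hy => rw [LinearMap.smul_apply, hy, smul_zero]
    rw [hspan] at h1
    exact Subtype.ext (hc x fun A => h1 (v A) (Submodule.subset_span ⟨A, rfl⟩))
  have hcard : Fintype.card κ = r := by
    apply le_antisymm
    · rw [← hr, ← Subspace.dual_finrank_eq (K := K) (V := W)]
      exact hli.fintype_card_le_finrank
    · rw [← hr, ← Module.finrank_fintype_fun_eq_card K (η := κ)]
      refine LinearMap.finrank_le_finrank_of_injective (f := LinearMap.pi fun k => v (a k)) ?_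
      exact LinearMap.ker_eq_bot.1 (LinearMap.ker_eq_bot'.2 fun x hx =>
        hker x fun k => congrFun hx k)
  let ε := Fintype.equivFinOfCardEq hcard
  refine ⟨fun j => a (ε.symm j), fun x hx h => ?_⟩
  have := hker ⟨x, hx⟩ fun k => by
    have := h (ε k)
    simp only [ε.symm_apply_apply] at this
    exact this
  exact congrArg Subtype.val this

theorem exists_dual_of_coordinates {E : Type*} [AddCommGroup E] [Module K E]
    {W : Submodule K E} [Module.Finite K W] (hr : Module.finrank K W = r) (c : Fin r → E →ₗ[K] K)
    (hc : ∀ x ∈ W, (∀ i, c i x = 0) → x = 0) :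
    ∃ F : Fin r → E, (∀ i, F i ∈ W) ∧ ∀ i j, c j (F i) = if i = j then 1 else 0 := by
  let T : W →ₗ[K] (Fin r → K) := LinearMap.pi fun j => c j ∘ₗ W.subtype
  have hT : Function.Injective T := LinearMap.ker_eq_bot.1 (LinearMap.ker_eq_bot'.2 fun x hx =>
    Subtype.ext (hc x.1 x.2 fun j => congrFun hx j))
  have hfin : Module.finrank K W = Module.finrank K (Fin r → K) := by
    rw [hr, Module.finrank_fintype_fun_eq_card, Fintype.card_fin]
  have hT2 : Function.Surjective T :=
    (LinearMap.injective_iff_surjective_of_finrank_eq_finrank hfin).1 hT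
  choose F hF using fun i : Fin r => hT2 (Pi.single i 1)
  refine ⟨fun i => (F i).1, fun i => (F i).2, fun i j => ?_⟩
  have := congrFun (hF i) j
  rw [Pi.single_apply] at this
  simpa [T, eq_comm] using this

theorem isState_iff_det_ne_zero {W : Submodule K (Forms K n m)} (e : Module.Basis (Fin r) K W)
    (B : Fin r → (Fin (n + 1) →₀ ℕ)) :
    IsState W B ↔ (Matrix.of fun i j => coeff (B j) (e i).1.1).det ≠ 0 :=
  det_ne_zero_iff_of_basis e fun j => coeffForm (B j)

theorem exists_isState {W : Submodule K (Forms K n m)} (hr : Module.finrank K W = r) :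
    ∃ B : Fin r → (Fin (n + 1) →₀ ℕ), (∀ j, (B j).degree = m) ∧ IsState W B := by
  obtain ⟨B, hB⟩ := exists_coordinates hr (fun A : Exps n m => coeffForm A.1) fun x hx =>
    Forms.ext_coeff fun A => by
      by_cases hA : A ∈ Exps n m
      · exact hx ⟨A, hA⟩
      · rw [Forms.coeff_eq_zero x fun h => hA (mem_exps.2 h), Forms.coeff_zero]
  exact ⟨fun j => (B j).1, fun j => mem_exps.1 (B j).2, hB⟩

/-- The basis of `W` dual to the coefficients of a state. -/
theorem IsState.exists_dual {W : Submodule K (Forms K n m)} (hr : Module.finrank K W = r)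
    {B : Fin r → (Fin (n + 1) →₀ ℕ)} (hB : IsState W B) :
    ∃ F : Fin r → Forms K n m, (∀ i, F i ∈ W) ∧
      ∀ i j, coeff (B j) (F i).1 = if i = j then 1 else 0 :=
  exists_dual_of_coordinates hr (fun j => coeffForm (B j)) hB

/-- The weight of a monomial. -/
def wt (w : Fin (n + 1) → ℤ) (A : Fin (n + 1) →₀ ℕ) : ℤ := ∑ i, w i * (A i : ℤ)

/-- `F` is the reduced basis of `W` with leading monomials `x^{b_1}, …, x^{b_r}`. -/
structure IsReduced (w : Fin (n + 1) → ℤ) (W : Submodule K (Forms K n m))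
    (b : Fin r → (Fin (n + 1) →₀ ℕ)) (F : Fin r → Forms K n m) : Prop where
  degree_eq : ∀ i, (b i).degree = m
  mem : ∀ i, F i ∈ W
  coeff_eq : ∀ i j, coeff (b j) (F i).1 = if i = j then 1 else 0
  isState : IsState W b
  wt_le : ∀ i A, coeff A (F i).1 ≠ 0 → wt w A ≤ wt w (b i)

/-- `x` is a combination of the reduced basis, with its coefficients at `b`. -/
theorem IsState.eq_sum {W : Submodule K (Forms K n m)} {b : Fin r → (Fin (n + 1) →₀ ℕ)}
    (hb : IsState W b) {F : Fin r → Forms K n m} (hF : ∀ i, F i ∈ W)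
    (hc : ∀ i j, coeff (b j) (F i).1 = if i = j then 1 else 0) {x : Forms K n m} (hx : x ∈ W) :
    x = ∑ i, coeff (b i) x.1 • F i := by
  rw [← sub_eq_zero]
  refine hb _ (W.sub_mem hx (W.sum_mem fun i _ => W.smul_mem _ (hF i))) fun j => ?_
  rw [Forms.coeff_sub, Forms.coeff_sum]
  simp [hc]

/-- The coefficient matrix of `F` at the exchanged tuple is the identity with column `i` replaced,
and its determinant is the coefficient of x^A in F_i. Occurrence of monomials is thereby turned into
a question about states. -/
theorem isState_update_iff {W : Submodule K (Forms K n m)} {b : Fin r → (Fin (n + 1) →₀ ℕ)}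
    (hb : IsState W b) {F : Fin r → Forms K n m} (hF : ∀ i, F i ∈ W)
    (hc : ∀ i j, coeff (b j) (F i).1 = if i = j then 1 else 0) (i : Fin r)
    (A : Fin (n + 1) →₀ ℕ) :
    IsState W (Function.update b i A) ↔ coeff A (F i).1 ≠ 0 := by
  constructor
  · intro h h0
    have h1 : F i = 0 := by
      refine h _ (hF i) fun j => ?_
      by_cases hj : j = i
      · subst hj; simpa using h0
      · rw [Function.update_of_ne hj, hc, if_neg (Ne.symm hj)]
    have h2 := hc i i
    rw [h1] at h2
    simp at h2
  · intro h x hx h0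
    have h1 : x = coeff (b i) x.1 • F i := by
      conv_lhs => rw [hb.eq_sum hF hc hx]
      refine Finset.sum_eq_single i (fun j _ hj => ?_) (by simp)
      have := h0 j
      rw [Function.update_of_ne hj] at this
      rw [this, zero_smul]
    have h2 := h0 i
    rw [Function.update_self, h1] at h2
    have h3 : coeff (b i) x.1 = 0 := by
      rw [Forms.coeff_smul] at h2
      exact (mul_eq_zero.1 h2).resolve_right h
    rw [h1, h3, zero_smul]

/-- Among the finitely many states take one of largest total weight: a monomial of F_i heavier than
b_i could be exchanged for b_i and would increase the total. -/
theorem exists_isReduced (w : Fin (n + 1) → ℤ) {W : Submodule K (Forms K n m)}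
    (hr : Module.finrank K W = r) :
    ∃ (b : Fin r → (Fin (n + 1) →₀ ℕ)) (F : Fin r → Forms K n m), IsReduced w W b F := by
  let s : Set (Fin r → Exps n m) := {B | IsState W fun j => (B j).1}
  obtain ⟨B₀, hB₀, hB₀s⟩ := exists_isState hr
  have hs : s.Nonempty := ⟨fun j => ⟨B₀ j, mem_exps.2 (hB₀ j)⟩, hB₀s⟩
  obtain ⟨b, hb, hmax⟩ := s.exists_max_image (fun B => ∑ j, wt w (B j).1) (Set.toFinite s) hs
  obtain ⟨F, hF, hc⟩ := IsState.exists_dual hr hb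
  refine ⟨fun j => (b j).1, F, fun j => mem_exps.1 (b j).2, hF, hc, hb, fun i A hA => ?_⟩
  have hAm : A.degree = m := by
    by_contra h
    exact hA (Forms.coeff_eq_zero (F i) h)
  have h1 := (isState_update_iff hb hF hc i A).2 hA
  have e : Function.update (fun j => (b j).1) i A =
      fun j => (Function.update b i ⟨A, mem_exps.2 hAm⟩ j).1 := by
    funext j
    by_cases hj : j = i
    · subst hj; simp
    · simp [hj]
  rw [e] at h1
  have h2 := hmax _ h1
  rw [← Finset.add_sum_erase _ _ (Finset.mem_univ i),
    ← Finset.add_sum_erase _ (fun j => wt w (b j).1) (Finset.mem_univ i)] at h2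
  have h3 : ∑ j ∈ Finset.univ.erase i, wt w (Function.update b i ⟨A, mem_exps.2 hAm⟩ j).1 =
      ∑ j ∈ Finset.univ.erase i, wt w (b j).1 :=
    Finset.sum_congr rfl fun j hj => by rw [Function.update_of_ne (Finset.ne_of_mem_erase hj)]
  rw [h3, Function.update_self] at h2
  linarith

theorem IsReduced.wt_lt {w : Fin (n + 1) → ℤ} {W : Submodule K (Forms K n m)}
    {b : Fin r → (Fin (n + 1) →₀ ℕ)} {F : Fin r → Forms K n m} (h : IsReduced w W b F)
    (hw : Distinguishes w m) {i : Fin r} {A : Fin (n + 1) →₀ ℕ} (hA : coeff A (F i).1 ≠ 0)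
    (hne : A ≠ b i) : wt w A < wt w (b i) := by
  refine lt_of_le_of_ne (h.wt_le i A hA) (hw A (b i) ?_ (h.degree_eq i) hne)
  by_contra hd
  exact hA (Forms.coeff_eq_zero (F i) hd)

end States

/-! ### Generic coordinates -/

section Generic

variable {K : Type*} [Field K] {n m r : ℕ}

theorem map_linSubst {R R' : Type*} [CommRing R] [CommRing R'] (φ : R →+* R')
    (G : Matrix (Fin (n + 1)) (Fin (n + 1)) R) (p : MvPolynomial (Fin (n + 1)) R) :
    MvPolynomial.map φ (linSubst G p) = linSubst (G.map φ) (MvPolynomial.map φ p) := by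
  induction p using MvPolynomial.induction_on with
  | C a => simp [linSubst, MvPolynomial.algebraMap_eq]
  | add p q hp hq => simp only [map_add, hp, hq]
  | mul_X p i hp =>
    simp only [map_mul, hp]
    simp [linSubst]

theorem eval_coeff_linSubst_mvPolynomialX (g : GL (Fin (n + 1)) K)
    (p : MvPolynomial (Fin (n + 1)) K) (A : Fin (n + 1) →₀ ℕ) :
    evalMatrix g (coeff A (linSubst (Matrix.mvPolynomialX (Fin (n + 1)) (Fin (n + 1)) K)
      (MvPolynomial.map C p))) =
      coeff A (linSubst (g : Matrix (Fin (n + 1)) (Fin (n + 1)) K) p) := by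
  have e1 : (Matrix.mvPolynomialX (Fin (n + 1)) (Fin (n + 1)) K).map
      (MvPolynomial.eval fun ij => (g : Matrix (Fin (n + 1)) (Fin (n + 1)) K) ij.1 ij.2) =
        (g : Matrix (Fin (n + 1)) (Fin (n + 1)) K) := by
    ext i j
    simp
  have e2 : (MvPolynomial.eval fun ij : Fin (n + 1) × Fin (n + 1) =>
      (g : Matrix (Fin (n + 1)) (Fin (n + 1)) K) ij.1 ij.2).comp C = RingHom.id K := by
    ext x
    simp
  rw [evalMatrix, ← coeff_map, map_linSubst, MvPolynomial.map_map, e1, e2, MvPolynomial.map_id]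

theorem evalMatrix_stateCoeff (g : GL (Fin (n + 1)) K) (f : Fin r → MvPolynomial (Fin (n + 1)) K)
    (B : Fin r → (Fin (n + 1) →₀ ℕ)) :
    evalMatrix g (stateCoeff f B) = (Matrix.of fun i j =>
      coeff (B j) (linSubst (g : Matrix (Fin (n + 1)) (Fin (n + 1)) K) (f i))).det := by
  rw [evalMatrix, stateCoeff, RingHom.map_det]
  congr 1
  ext i j
  exact eval_coeff_linSubst_mvPolynomialX g (f i) (B j)

theorem isState_map_glAct_iff {W : Submodule K (Forms K n m)} (f : Module.Basis (Fin r) K W)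
    (g : GL (Fin (n + 1)) K) (B : Fin r → (Fin (n + 1) →₀ ℕ)) :
    IsState (W.map (glAct m g).toLinearMap) B ↔
      evalMatrix g (stateCoeff (fun i => (f i).1.1) B) ≠ 0 := by
  rw [isState_iff_det_ne_zero (f.map ((glAct m g).submoduleMap W)), evalMatrix_stateCoeff]
  rfl

/-- A coordinate that is nonzero at `g'` is not identically zero, and those are the coordinates that
do not vanish at `g`. -/
theorem isState_of_mem_genericSet {W : Submodule K (Forms K n m)} (f : Module.Basis (Fin r) K W)
    {g : GL (Fin (n + 1)) K} (hg : g ∈ genericSet m fun i => (f i).1.1)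
    (g' : GL (Fin (n + 1)) K) {B : Fin r → (Fin (n + 1) →₀ ℕ)} (hB : ∀ j, (B j).degree = m)
    (h : IsState (W.map (glAct m g').toLinearMap) B) :
    IsState (W.map (glAct m g).toLinearMap) B := by
  rw [isState_map_glAct_iff f] at h ⊢
  refine hg B hB fun h0 => h ?_
  rw [h0, evalMatrix, map_zero]

theorem exists_evalMatrix_ne_zero [Infinite K]
    {p : MvPolynomial (Fin (n + 1) × Fin (n + 1)) K} (hp : p ≠ 0) :
    ∃ g : GL (Fin (n + 1)) K, evalMatrix g p ≠ 0 := by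
  let D := (Matrix.mvPolynomialX (Fin (n + 1)) (Fin (n + 1)) K).det
  have hD : D ≠ 0 := Matrix.det_mvPolynomialX_ne_zero _ _
  -- The factor `D` forces the point found to be an invertible matrix.
  obtain ⟨x, hx⟩ : ∃ x, MvPolynomial.eval x (p * D) ≠ 0 := by
    by_contra! h
    exact mul_ne_zero hp hD (MvPolynomial.funext fun x => by rw [h, map_zero])
  rw [map_mul] at hx
  have hdet : (Matrix.of fun i j => x (i, j)).det ≠ 0 := by
    have := right_ne_zero_of_mul hx
    rw [RingHom.map_det] at this
    convert! this
    ext i j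
    simp
  refine ⟨Matrix.GeneralLinearGroup.mkOfDetNeZero _ hdet, ?_⟩
  exact left_ne_zero_of_mul hx

/-- The product of the state coefficients that do not vanish identically. -/
def stateProd (m : ℕ) (f : Fin r → MvPolynomial (Fin (n + 1)) K) :
    MvPolynomial (Fin (n + 1) × Fin (n + 1)) K :=
  open Classical in
  ∏ B : Fin r → Exps n m,
    if stateCoeff f (fun j => (B j).1) = 0 then 1 else stateCoeff f fun j => (B j).1

theorem stateProd_ne_zero (m : ℕ) (f : Fin r → MvPolynomial (Fin (n + 1)) K) :
    stateProd m f ≠ 0 := by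
  refine Finset.prod_ne_zero_iff.2 fun B _ => ?_
  split_ifs with h
  · exact one_ne_zero
  · exact h

theorem mem_genericSet_iff (m : ℕ) (f : Fin r → MvPolynomial (Fin (n + 1)) K)
    (g : GL (Fin (n + 1)) K) : g ∈ genericSet m f ↔ evalMatrix g (stateProd m f) ≠ 0 := by
  rw [evalMatrix, stateProd, map_prod, Finset.prod_ne_zero_iff]
  constructor
  · intro hg B _
    split_ifs with h
    · simp
    · exact hg _ (fun j => mem_exps.1 (B j).2) h
  · intro h B hB hne
    have := h (fun j => ⟨B j, mem_exps.2 (hB j)⟩) (Finset.mem_univ _)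
    rwa [if_neg hne] at this

theorem isZariskiOpen_genericSet (m : ℕ) (f : Fin r → MvPolynomial (Fin (n + 1)) K) :
    IsZariskiOpen (genericSet m f) :=
  ⟨{stateProd m f}, by ext g; simp [mem_genericSet_iff]⟩

theorem isZariskiDense_genericSet [Infinite K] (m : ℕ)
    (f : Fin r → MvPolynomial (Fin (n + 1)) K) : IsZariskiDense (genericSet m f) := by
  rintro O ⟨T, rfl⟩ ⟨g, p, hpT, hp⟩
  have hp0 : p ≠ 0 := by
    rintro rfl
    simp [evalMatrix] at hp
  obtain ⟨g', hg'⟩ := exists_evalMatrix_ne_zero (mul_ne_zero hp0 (stateProd_ne_zero m f))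
  rw [evalMatrix, map_mul] at hg'
  exact ⟨g', ⟨p, hpT, left_ne_zero_of_mul hg'⟩,
    (mem_genericSet_iff m f g').2 (right_ne_zero_of_mul hg')⟩

end Generic

/-! ### Translates of ideals and the family of translates by a one-parameter subgroup -/

section Translate

variable {K : Type*} [Field K] {n : ℕ}

/-- The ideal `h I`. -/
def translate (h : GL (Fin (n + 1)) K) (I : Ideal (MvPolynomial (Fin (n + 1)) K)) :
    Ideal (MvPolynomial (Fin (n + 1)) K) :=
  I.comap (linSubst ((h⁻¹ : GL (Fin (n + 1)) K) : Matrix (Fin (n + 1)) (Fin (n + 1)) K))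

theorem mem_translate {h : GL (Fin (n + 1)) K} {I : Ideal (MvPolynomial (Fin (n + 1)) K)}
    {p : MvPolynomial (Fin (n + 1)) K} : p ∈ translate h I ↔
      linSubst ((h⁻¹ : GL (Fin (n + 1)) K) : Matrix (Fin (n + 1)) (Fin (n + 1)) K) p ∈ I :=
  Iff.rfl

theorem linSubst_inv_linSubst (h : GL (Fin (n + 1)) K) (p : MvPolynomial (Fin (n + 1)) K) :
    linSubst ((h⁻¹ : GL (Fin (n + 1)) K) : Matrix (Fin (n + 1)) (Fin (n + 1)) K)
      (linSubst (h : Matrix (Fin (n + 1)) (Fin (n + 1)) K) p) = p := by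
  rw [linSubst_mul, ← Units.val_mul, inv_mul_cancel, Units.val_one, linSubst_one]

theorem linSubst_mem_translate {h : GL (Fin (n + 1)) K}
    {I : Ideal (MvPolynomial (Fin (n + 1)) K)} {p : MvPolynomial (Fin (n + 1)) K} :
    linSubst (h : Matrix (Fin (n + 1)) (Fin (n + 1)) K) p ∈ translate h I ↔ p ∈ I := by
  rw [mem_translate, linSubst_inv_linSubst]

theorem gradedPiece_translate (h : GL (Fin (n + 1)) K)
    (I : Ideal (MvPolynomial (Fin (n + 1)) K)) (m : ℕ) :
    gradedPiece (translate h I) m = (gradedPiece I m).map (glAct m h).toLinearMap := by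
  ext p
  rw [mem_gradedPiece]
  constructor
  · intro hp
    exact ⟨(glAct m h).symm p, hp, (glAct m h).apply_symm_apply p⟩
  · rintro ⟨q, hq, rfl⟩
    exact linSubst_mem_translate.2 hq

theorem finrank_gradedPiece_translate (h : GL (Fin (n + 1)) K)
    (I : Ideal (MvPolynomial (Fin (n + 1)) K)) (m : ℕ) :
    Module.finrank K (gradedPiece (translate h I) m) = Module.finrank K (gradedPiece I m) := by
  rw [gradedPiece_translate]
  exact ((glAct m h).submoduleMap (gradedPiece I m)).finrank_eq.symm

theorem hasHilbertPoly_of_finrank_eq {I J : Ideal (MvPolynomial (Fin (n + 1)) K)} {P : ℚ[X]}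
    (hI : HasHilbertPoly I P) {N : ℕ} (h : ∀ d ≥ N, Module.finrank K (gradedPiece J d) =
      Module.finrank K (gradedPiece I d)) : HasHilbertPoly J P := by
  obtain ⟨N', hN'⟩ := hI
  refine ⟨max N N', fun d hd => ?_⟩
  rw [← hN' d (le_of_max_le_right hd)]
  have h1 := finrank_quotient_gradedPiece I d
  have h2 := finrank_quotient_gradedPiece J d
  have h3 := h d (le_of_max_le_left hd)
  congr 1
  omega

theorem isHomogeneousIdeal_translate (h : GL (Fin (n + 1)) K)
    {I : Ideal (MvPolynomial (Fin (n + 1)) K)} (hI : IsHomogeneousIdeal I) :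
    IsHomogeneousIdeal (translate h I) := by
  intro p hp d
  rw [mem_translate, linSubst_homogeneousComponent]
  exact hI _ hp d

/-- Saturation is tested on the variables, which `h` turns into linear forms. The elements with a
power multiplying p into the ideal form the radical of a colon ideal, so with the variables it
contains every linear form. -/
theorem isSaturatedIdeal_translate (h : GL (Fin (n + 1)) K)
    {I : Ideal (MvPolynomial (Fin (n + 1)) K)} (hI : IsSaturatedIdeal I) :
    IsSaturatedIdeal (translate h I) := by
  refine ⟨isHomogeneousIdeal_translate h hI.1, fun p hp => hI.2 _ fun i => ?_⟩
  let T : Ideal (MvPolynomial (Fin (n + 1)) K) := ((translate h I).colon {p}).radical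
  have hX : ∀ i, X i ∈ T := by
    intro i
    obtain ⟨k, hk⟩ := hp i
    exact ⟨k, Submodule.mem_colon_singleton.2 hk⟩
  have hT : linSubst (h : Matrix (Fin (n + 1)) (Fin (n + 1)) K) (X i) ∈ T := by
    rw [linSubst, aeval_X]
    exact Ideal.sum_mem _ fun j _ => Ideal.mul_mem_left _ _ (hX j)
  obtain ⟨k, hk⟩ := hT
  have hk := Submodule.mem_colon_singleton.1 hk
  refine ⟨k, ?_⟩
  rw [smul_eq_mul, mem_translate, map_mul, map_pow, linSubst_inv_linSubst] at hk
  exact hk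

theorem coeff_linSubst_diagonal {R : Type*} [CommRing R] (c : Fin (n + 1) → R)
    (p : MvPolynomial (Fin (n + 1)) R) (A : Fin (n + 1) →₀ ℕ) :
    coeff A (linSubst (Matrix.diagonal c) p) = (∏ i, c i ^ A i) * coeff A p := by
  have hX : ∀ i, linSubst (Matrix.diagonal c) (X i) = C (c i) * X i := by
    intro i
    rw [linSubst, aeval_X, Finset.sum_eq_single i]
    · rw [Matrix.diagonal_apply_eq]
    · intro j _ hj
      rw [Matrix.diagonal_apply_ne _ hj, C_0, zero_mul]
    · simp
  have hmono : ∀ (B : Fin (n + 1) →₀ ℕ) (a : R), linSubst (Matrix.diagonal c) (monomial B a) =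
      monomial B ((∏ i, c i ^ B i) * a) := by
    intro B a
    rw [monomial_eq, map_mul, Finsupp.prod_fintype _ _ (by simp), map_prod]
    simp only [map_pow, hX, mul_pow, Finset.prod_mul_distrib]
    rw [monomial_eq, Finsupp.prod_fintype _ _ (by simp), C_mul, map_prod]
    simp only [C_pow]
    have : linSubst (Matrix.diagonal c) (C a) = C a := by
      rw [linSubst, algHom_C, algebraMap_eq]
    rw [this]
    ring
  induction p using MvPolynomial.induction_on' with
  | monomial B a =>
    rw [hmono, coeff_monomial, coeff_monomial]
    split_ifs with h
    · rw [h]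
    · rw [mul_zero]
  | add p q hp hq => rw [map_add, MvPolynomial.coeff_add, MvPolynomial.coeff_add, hp, hq, mul_add]

theorem coeff_linSubst_oneParam (w : Fin (n + 1) → ℤ) {a : K} (ha : a ≠ 0)
    (p : MvPolynomial (Fin (n + 1)) K) (A : Fin (n + 1) →₀ ℕ) :
    coeff A (linSubst (oneParam w a) p) = a ^ (-wt w A) * coeff A p := by
  rw [oneParam, coeff_linSubst_diagonal]
  congr 1
  have key : ∀ s : Finset (Fin (n + 1)),
      ∏ i ∈ s, (a ^ (-w i)) ^ A i = a ^ (-∑ i ∈ s, w i * (A i : ℤ)) := by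
    intro s
    induction s using Finset.induction_on with
    | empty => simp
    | insert i s hi ih =>
      rw [Finset.prod_insert hi, Finset.sum_insert hi, ih, neg_add, zpow_add₀ ha, ← zpow_natCast,
        ← zpow_mul, neg_mul]
  exact key Finset.univ

theorem oneParam_mul_oneParam_inv (w : Fin (n + 1) → ℤ) {a : K} (ha : a ≠ 0) :
    oneParam w a * oneParam w a⁻¹ = 1 := by
  rw [oneParam, oneParam, Matrix.diagonal_mul_diagonal, ← Matrix.diagonal_one]
  congr 1
  funext i
  rw [← mul_zpow, mul_inv_cancel₀ ha, one_zpow]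

/-- The element `λ_w(a)` of the general linear group. -/
def oneParamGL (w : Fin (n + 1) → ℤ) (a : K) (ha : a ≠ 0) : GL (Fin (n + 1)) K where
  val := oneParam w a
  inv := oneParam w a⁻¹
  val_inv := oneParam_mul_oneParam_inv w ha
  inv_val := by
    have := oneParam_mul_oneParam_inv w (inv_ne_zero ha)
    rwa [inv_inv] at this

theorem translate_mul (g h : GL (Fin (n + 1)) K) (I : Ideal (MvPolynomial (Fin (n + 1)) K)) :
    translate (g * h) I = translate g (translate h I) := by
  ext p
  rw [mem_translate, mem_translate, mem_translate, linSubst_mul, mul_inv_rev, Units.val_mul]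

/-- The ideal of the family over the affine line whose fibre at `a ≠ 0` is `λ_w(a) J`. -/
def familyIdeal (w : Fin (n + 1) → ℤ) (J : Ideal (MvPolynomial (Fin (n + 1)) K)) :
    Ideal (MvPolynomial (Fin (n + 1)) K[X]) :=
  ⨅ (a : K) (ha : a ≠ 0),
    (translate (oneParamGL w a ha) J).comap (MvPolynomial.map (Polynomial.evalRingHom a))

theorem mem_familyIdeal {w : Fin (n + 1) → ℤ} {J : Ideal (MvPolynomial (Fin (n + 1)) K)}
    {q : MvPolynomial (Fin (n + 1)) K[X]} : q ∈ familyIdeal w J ↔ ∀ (a : K) (ha : a ≠ 0),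
      MvPolynomial.map (Polynomial.evalRingHom a) q ∈ translate (oneParamGL w a ha) J := by
  simp [familyIdeal]

theorem isHomogeneousIdeal_familyIdeal (w : Fin (n + 1) → ℤ)
    {J : Ideal (MvPolynomial (Fin (n + 1)) K)} (hJ : IsHomogeneousIdeal J) :
    IsHomogeneousIdeal (familyIdeal w J) := by
  intro p hp d
  rw [mem_familyIdeal] at hp ⊢
  intro a ha
  rw [← homogeneousComponent_map]
  exact isHomogeneousIdeal_translate _ hJ _ (hp a ha) d

/-- t is a unit at each a ≠ 0, and the family ideal imposes no condition at a = 0. This t-saturation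
is the input for flatness of the first order deformation. -/
theorem mem_familyIdeal_of_X_pow_smul {w : Fin (n + 1) → ℤ}
    {J : Ideal (MvPolynomial (Fin (n + 1)) K)} {q : MvPolynomial (Fin (n + 1)) K[X]} {k : ℕ}
    (h : C (Polynomial.X ^ k) * q ∈ familyIdeal w J) : q ∈ familyIdeal w J := by
  rw [mem_familyIdeal] at h ⊢
  intro a ha
  have := h a ha
  rw [map_mul, map_C] at this
  have h2 := Ideal.mul_mem_left _ (C (a ^ k)⁻¹) this
  rw [← mul_assoc, ← C_mul] at h2
  simpa [ha] using h2

end Translate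

/-! ### Spaces of forms given as graphs -/

section Graph

variable {R : Type*} [CommRing R] {n d r : ℕ}

/-- The forms whose coefficients are the combinations with coefficients `γ` of those at `b`. -/
def graphForms (b : Fin r → (Fin (n + 1) →₀ ℕ)) (γ : Fin r → (Fin (n + 1) →₀ ℕ) → R) :
    Submodule R (Forms R n d) where
  carrier := {q | ∀ A, coeff A q.1 = ∑ i, coeff (b i) q.1 * γ i A}
  add_mem' {p q} hp hq A := by
    simp only [Forms.coeff_add, hp A, hq A, add_mul, Finset.sum_add_distrib]
  zero_mem' A := by simp
  smul_mem' c q hq A := by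
    simp only [Forms.coeff_smul, mul_assoc, ← Finset.mul_sum]
    rw [hq A]

theorem mem_graphForms {b : Fin r → (Fin (n + 1) →₀ ℕ)} {γ : Fin r → (Fin (n + 1) →₀ ℕ) → R}
    {q : Forms R n d} :
    q ∈ graphForms b γ ↔ ∀ A, coeff A q.1 = ∑ i, coeff (b i) q.1 * γ i A := Iff.rfl

/-- Coefficients `γ` that define a graph over the span of the monomials `x^{b_i}`. -/
structure IsGraphData (d : ℕ) (b : Fin r → (Fin (n + 1) →₀ ℕ))
    (γ : Fin r → (Fin (n + 1) →₀ ℕ) → R) : Prop where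
  degree_eq : ∀ i A, γ i A ≠ 0 → A.degree = d
  apply_eq : ∀ i j, γ i (b j) = if i = j then 1 else 0

/-- The section of a graph over the monomial `x^{b_i}`. -/
def graphSection (d : ℕ) (γ : Fin r → (Fin (n + 1) →₀ ℕ) → R) (i : Fin r) : Forms R n d :=
  (formsEquiv R n d).symm fun A => γ i A.1

variable {b : Fin r → (Fin (n + 1) →₀ ℕ)} {γ : Fin r → (Fin (n + 1) →₀ ℕ) → R}

theorem coeff_formsEquiv_symm (v : (Fin (n + 1) →₀ ℕ) → R) (hv : ∀ A, v A ≠ 0 → A.degree = d)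
    (A : Fin (n + 1) →₀ ℕ) :
    coeff A ((formsEquiv R n d).symm fun B => v B.1).1 = v A := by
  by_cases hA : A.degree = d
  · exact congrFun ((formsEquiv R n d).apply_symm_apply fun B => v B.1) ⟨A, mem_exps.2 hA⟩
  · rw [Forms.coeff_eq_zero _ hA]
    by_contra h
    exact hA (hv A (Ne.symm h))

theorem IsGraphData.coeff_graphSection (h : IsGraphData d b γ) (i : Fin r)
    (A : Fin (n + 1) →₀ ℕ) : coeff A (graphSection d γ i).1 = γ i A :=
  coeff_formsEquiv_symm (γ i) (h.degree_eq i) A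

theorem IsGraphData.graphSection_mem (h : IsGraphData d b γ) (i : Fin r) :
    graphSection d γ i ∈ graphForms b γ := by
  intro A
  simp [h.coeff_graphSection, h.apply_eq]

theorem IsGraphData.eq_sum (h : IsGraphData d b γ) {q : Forms R n d} (hq : q ∈ graphForms b γ) :
    q = ∑ i, coeff (b i) q.1 • graphSection d γ i := by
  refine Forms.ext_coeff fun A => ?_
  rw [Forms.coeff_sum, hq A]
  exact Finset.sum_congr rfl fun i _ => by rw [Forms.coeff_smul, h.coeff_graphSection]

/-- A graph is a free module. -/
def IsGraphData.equiv (h : IsGraphData d b γ) :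
    (graphForms b γ : Submodule R (Forms R n d)) ≃ₗ[R] (Fin r → R) where
  toFun q i := coeff (b i) q.1.1
  map_add' _ _ := by ext; simp
  map_smul' _ _ := by ext; simp
  invFun v := ⟨∑ i, v i • graphSection d γ i,
    Submodule.sum_mem _ fun i _ => Submodule.smul_mem _ _ (h.graphSection_mem i)⟩
  left_inv q := Subtype.ext (h.eq_sum q.2).symm
  right_inv v := by
    ext j
    change coeff (b j) (∑ i, v i • graphSection d γ i : Forms R n d).1 = v j
    rw [Forms.coeff_sum]
    simp only [Forms.coeff_smul, h.coeff_graphSection, h.apply_eq]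
    simp

theorem IsGraphData.finrank_eq [StrongRankCondition R] (h : IsGraphData d b γ) :
    Module.finrank R (graphForms b γ : Submodule R (Forms R n d)) = r := by
  rw [h.equiv.finrank_eq, Module.finrank_fintype_fun_eq_card, Fintype.card_fin]

theorem IsGraphData.map {R' : Type*} [CommRing R'] (h : IsGraphData d b γ) (φ : R →+* R') :
    IsGraphData d b fun i A => φ (γ i A) where
  degree_eq i A hA := h.degree_eq i A fun h0 => hA (by rw [h0, map_zero])
  apply_eq i j := by
    rw [h.apply_eq]
    split_ifs <;> simp

theorem coeffMap_mem_graphForms {R' : Type*} [CommRing R'] (φ : R →+* R') {q : Forms R n d}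
    (hq : q ∈ graphForms b γ) : coeffMap φ q ∈ graphForms b fun i A => φ (γ i A) := by
  intro A
  simp only [coeff_coeffMap]
  rw [hq A, map_sum]
  simp

variable {K : Type*} [Field K] {γ : Fin r → (Fin (n + 1) →₀ ℕ) → K[X]}

theorem IsGraphData.fibre_eq (h : IsGraphData d b γ) (a : K) :
    fibre (graphForms b γ : Submodule K[X] (Forms K[X] n d)) a =
      graphForms b fun i A => (γ i A).eval a := by
  have h' := h.map (Polynomial.evalRingHom a)
  ext v
  rw [mem_fibre]
  constructor
  · rintro ⟨q, hq, rfl⟩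
    exact coeffMap_mem_graphForms _ hq
  · intro hv
    refine ⟨∑ i, Polynomial.C (coeff (b i) v.1) • graphSection d γ i,
      Submodule.sum_mem _ fun i _ => Submodule.smul_mem _ _ (h.graphSection_mem i),
      Forms.ext_coeff fun A => ?_⟩
    rw [coeff_coeffMap, Forms.coeff_sum, hv A, map_sum]
    refine Finset.sum_congr rfl fun i _ => ?_
    rw [Forms.coeff_smul, h.coeff_graphSection, map_mul]
    simp

/-- K[t] is a principal ideal domain, so flat means torsion-free. -/
theorem flat_quotient_iff {E : Type*} [AddCommGroup E] [Module K[X] E] (M : Submodule K[X] E) :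
    Module.Flat K[X] (E ⧸ M) ↔ ∀ (p : K[X]) (q : E), p ≠ 0 → p • q ∈ M → q ∈ M := by
  constructor
  · intro h p q hp hq
    have h1 := Module.Flat.isSMulRegular_of_isRegular (M := E ⧸ M) (isRegular_iff_ne_zero.2 hp)
    rw [← Submodule.Quotient.mk_eq_zero] at hq ⊢
    refine h1 ?_
    change p • Submodule.Quotient.mk q = p • (0 : E ⧸ M)
    rw [← Submodule.Quotient.mk_smul, hq, smul_zero]
  · intro h
    have : Module.IsTorsionFree K[X] (E ⧸ M) := by
      refine Module.IsTorsionFree.of_smul_eq_zero fun p x hx => ?_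
      by_contra! hne
      obtain ⟨q, rfl⟩ := Submodule.Quotient.mk_surjective M x
      rw [← Submodule.Quotient.mk_smul, Submodule.Quotient.mk_eq_zero] at hx
      exact hne.2 ((Submodule.Quotient.mk_eq_zero M).2 (h p q hne.1 hx))
    infer_instance

theorem flat_quotient_graphForms :
    Module.Flat K[X] (Forms K[X] n d ⧸ (graphForms b γ : Submodule K[X] (Forms K[X] n d))) := by
  refine (flat_quotient_iff _).2 fun p q hp hq A => ?_
  have h := hq A
  simp only [Forms.coeff_smul, mul_assoc, ← Finset.mul_sum] at h
  exact mul_left_cancel₀ hp h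

theorem polynomial_eq_of_eval_eq_of_ne_zero [Infinite K] {p q : K[X]}
    (h : ∀ a : K, a ≠ 0 → p.eval a = q.eval a) : p = q := by
  refine Polynomial.eq_of_infinite_eval_eq p q (Set.Infinite.mono (s := {0}ᶜ) ?_ ?_)
  · exact fun a ha => h a ha
  · exact (Set.finite_singleton 0).infinite_compl

/-- A flat family is determined by its fibres off `0`. -/
theorem IsGraphData.eq_of_fibre_eq [Infinite K] (h : IsGraphData d b γ)
    {M : Submodule K[X] (Forms K[X] n d)} (hM : Module.Flat K[X] (Forms K[X] n d ⧸ M))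
    (hf : ∀ a : K, a ≠ 0 → fibre M a = graphForms b fun i A => (γ i A).eval a) :
    M = graphForms b γ := by
  -- The graph equations hold at every a ≠ 0, hence identically in t.
  have hle : M ≤ graphForms b γ := by
    intro q hq A
    refine polynomial_eq_of_eval_eq_of_ne_zero fun a ha => ?_
    have h1 : coeffMap (Polynomial.evalRingHom a) q ∈ fibre M a := mem_fibre.2 ⟨q, hq, rfl⟩
    rw [hf a ha] at h1
    have h2 := h1 A
    simp only [coeff_coeffMap, Polynomial.coe_evalRingHom] at h2
    rw [h2, Polynomial.eval_finsetSum]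
    simp
  refine le_antisymm hle fun q hq => ?_
  have h1 := h.map (Polynomial.evalRingHom 1)
  have hq : ∀ i : Fin r, ∃ q ∈ M, coeffMap (Polynomial.evalRingHom 1) q =
      graphSection d (fun i A => Polynomial.evalRingHom 1 (γ i A)) i := by
    intro i
    rw [← mem_fibre, hf 1 one_ne_zero]
    exact h1.graphSection_mem i
  choose s hs hs1 using hq
  -- The `s i` specialise at t = 1 to the graph sections, so `T` is the identity there and its
  -- determinant is nonzero. Cramer's rule puts det T times each graph section in `M`, and
  -- torsion-freeness removes the factor.
  let T : Matrix (Fin r) (Fin r) K[X] := Matrix.of fun i j => coeff (b j) (s i).1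
  have hT : T.det ≠ 0 := by
    intro h0
    have h2 : (T.map (Polynomial.evalRingHom 1)) = 1 := by
      ext i j
      change Polynomial.evalRingHom 1 (coeff (b j) (s i).1) = _
      rw [← coeff_coeffMap, hs1, h1.coeff_graphSection, h1.apply_eq, Matrix.one_apply]
    have h3 := RingHom.map_det (Polynomial.evalRingHom (1 : K)) T
    rw [h0, RingHom.mapMatrix_apply, h2, map_zero, Matrix.det_one] at h3
    exact zero_ne_one h3
  have hsec : ∀ k, graphSection d γ k ∈ M := by
    intro k
    refine (flat_quotient_iff M).1 hM T.det _ hT ?_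
    have h2 : T.det • graphSection d γ k = ∑ i, T.adjugate k i • s i := by
      refine Forms.ext_coeff fun A => ?_
      rw [Forms.coeff_sum, Forms.coeff_smul, h.coeff_graphSection]
      have h3 : ∀ i, coeff A (s i).1 = ∑ j, T i j * γ j A := fun i => hle (hs i) A
      simp only [Forms.coeff_smul, h3, Finset.mul_sum]
      rw [Finset.sum_comm]
      simp only [← mul_assoc, ← Finset.sum_mul]
      have h4 : ∀ j, ∑ i, T.adjugate k i * T i j = if k = j then T.det else 0 := by
        intro j
        rw [← Matrix.mul_apply, Matrix.adjugate_mul, Matrix.smul_apply, Matrix.one_apply]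
        simp
      simp [h4]
    rw [h2]
    exact M.sum_mem fun i _ => M.smul_mem _ (hs i)
  rw [h.eq_sum hq]
  exact M.sum_mem fun i _ => M.smul_mem _ (hsec i)

end Graph

/-! ### The limit of a family of translates -/

section Limit

variable {K : Type*} [Field K] {n d r : ℕ} {w : Fin (n + 1) → ℤ}
  {J : Ideal (MvPolynomial (Fin (n + 1)) K)} {b : Fin r → (Fin (n + 1) →₀ ℕ)}
  {F : Fin r → Forms K n d}

/-- The coefficients of the family of reduced bases of `λ_w(t) W`. -/
def familyCoeff (w : Fin (n + 1) → ℤ) (b : Fin r → (Fin (n + 1) →₀ ℕ)) (F : Fin r → Forms K n d)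
    (i : Fin r) (A : Fin (n + 1) →₀ ℕ) : K[X] :=
  Polynomial.C (coeff A (F i).1) * Polynomial.X ^ (wt w (b i) - wt w A).toNat

theorem IsReduced.isGraphData {W : Submodule K (Forms K n d)} (h : IsReduced w W b F) :
    IsGraphData d b (familyCoeff w b F) where
  degree_eq i A hA := by
    by_contra hd
    refine hA ?_
    rw [familyCoeff, Forms.coeff_eq_zero _ hd, map_zero, zero_mul]
  apply_eq i j := by
    rw [familyCoeff, h.coeff_eq]
    split_ifs with hij
    · simp [hij]
    · simp

/-- Truncating the exponent at 0 is harmless: a monomial heavier than b_i has coefficient 0 in F_i.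
-/
theorem IsReduced.eval_familyCoeff {W : Submodule K (Forms K n d)} (h : IsReduced w W b F)
    {a : K} (ha : a ≠ 0) (i : Fin r) (A : Fin (n + 1) →₀ ℕ) :
    (familyCoeff w b F i A).eval a = a ^ (wt w (b i)) * a ^ (-wt w A) * coeff A (F i).1 := by
  rw [familyCoeff, Polynomial.eval_mul, Polynomial.eval_C, Polynomial.eval_pow,
    Polynomial.eval_X, mul_comm]
  by_cases h0 : coeff A (F i).1 = 0
  · rw [h0, mul_zero, mul_zero]
  · have := h.wt_le i A h0
    rw [← zpow_natCast, Int.toNat_of_nonneg (by omega), ← zpow_add₀ ha, sub_eq_add_neg]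

/-- λ_w(a) multiplies x^A by a^(−w·A); normalising the coefficient of x^{b_i} back to 1 costs the
factor a^(w·b_i). -/
theorem IsReduced.gradedPiece_translate_eq (h : IsReduced w (gradedPiece J d) b F) {a : K}
    (ha : a ≠ 0) : gradedPiece (translate (oneParamGL w a ha) J) d =
      graphForms b fun i A => (familyCoeff w b F i A).eval a := by
  have key : ∀ v : Forms K n d, ∀ A, coeff A (linSubst (((oneParamGL w a ha)⁻¹ :
      GL (Fin (n + 1)) K) : Matrix (Fin (n + 1)) (Fin (n + 1)) K) v.1) =
        a ^ (wt w A) * coeff A v.1 := by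
    intro v A
    change coeff A (linSubst (oneParam w a⁻¹) v.1) = _
    rw [coeff_linSubst_oneParam w (inv_ne_zero ha), inv_zpow', neg_neg]
  ext v
  let v' : Forms K n d := matAct d ((oneParamGL w a ha)⁻¹ : GL (Fin (n + 1)) K).1 v
  have hv' : v ∈ gradedPiece (translate (oneParamGL w a ha) J) d ↔ v' ∈ gradedPiece J d := Iff.rfl
  have hk : ∀ A, coeff A v'.1 = a ^ (wt w A) * coeff A v.1 := key v
  have hz : ∀ A, a ^ (-wt w A) * a ^ wt w A = 1 := by
    intro A
    rw [← zpow_add₀ ha, neg_add_cancel, zpow_zero]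
  rw [hv']
  constructor
  · intro hv A
    have h1 : coeff A v'.1 = ∑ i, coeff (b i) v'.1 * coeff A (F i).1 := by
      conv_lhs => rw [h.isState.eq_sum h.mem h.coeff_eq hv]
      rw [Forms.coeff_sum]
      exact Finset.sum_congr rfl fun i _ => Forms.coeff_smul _ _ _
    have h2 : coeff A v.1 = a ^ (-wt w A) * coeff A v'.1 := by
      rw [hk, ← mul_assoc, hz, one_mul]
    rw [h2, h1, Finset.mul_sum]
    refine Finset.sum_congr rfl fun i _ => ?_
    beta_reduce
    rw [h.eval_familyCoeff ha, hk]
    ring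
  · intro hv
    have h1 : v' = ∑ i, coeff (b i) v'.1 • F i := by
      refine Forms.ext_coeff fun A => ?_
      rw [Forms.coeff_sum, hk, hv A, Finset.mul_sum]
      refine Finset.sum_congr rfl fun i _ => ?_
      beta_reduce
      rw [h.eval_familyCoeff ha, Forms.coeff_smul, hk]
      have := hz A
      linear_combination (coeff (b i) v.1 * a ^ wt w (b i) * coeff A (F i).1) * this
    rw [h1]
    exact Submodule.sum_mem _ fun i _ => Submodule.smul_mem _ _ (h.mem i)

/-- Membership in the family ideal is a condition at each a ≠ 0 and the graph equations are
polynomial identities in t; over an infinite field the two agree. This gives the ideal an explicit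
basis in each degree. -/
theorem IsReduced.idealForms_familyIdeal_eq [Infinite K]
    (h : IsReduced w (gradedPiece J d) b F) :
    idealForms (familyIdeal w J) d = graphForms b (familyCoeff w b F) := by
  ext q
  rw [mem_idealForms, mem_familyIdeal]
  constructor
  · intro hq A
    refine polynomial_eq_of_eval_eq_of_ne_zero fun a ha => ?_
    have h1 : coeffMap (Polynomial.evalRingHom a) q ∈
      gradedPiece (translate (oneParamGL w a ha) J) d := hq a ha
    rw [h.gradedPiece_translate_eq ha] at h1
    have h2 := h1 A
    simp only [coeff_coeffMap, Polynomial.coe_evalRingHom] at h2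
    rw [h2, Polynomial.eval_finsetSum]
    simp
  · intro hq a ha
    have h1 : coeffMap (Polynomial.evalRingHom a) q ∈
        gradedPiece (translate (oneParamGL w a ha) J) d := by
      rw [h.gradedPiece_translate_eq ha]
      exact coeffMap_mem_graphForms (Polynomial.evalRingHom a) hq
    exact h1

end Limit

/-! ### Saturation -/

section Saturation

variable {K : Type*} [Field K] {n : ℕ}

/-- The saturation of an ideal with respect to `(x_0, …, x_n)`. -/
def saturation (L : Ideal (MvPolynomial (Fin (n + 1)) K)) :
    Ideal (MvPolynomial (Fin (n + 1)) K) where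
  carrier := {p | ∀ i, ∃ k : ℕ, X i ^ k * p ∈ L}
  add_mem' {p q} hp hq i := by
    obtain ⟨k, hk⟩ := hp i
    obtain ⟨l, hl⟩ := hq i
    refine ⟨k + l, ?_⟩
    rw [show (X i : MvPolynomial (Fin (n + 1)) K) ^ (k + l) * (p + q) =
      X i ^ l * (X i ^ k * p) + X i ^ k * (X i ^ l * q) by ring]
    exact L.add_mem (L.mul_mem_left _ hk) (L.mul_mem_left _ hl)
  zero_mem' i := ⟨0, by simp⟩
  smul_mem' c p hp i := by
    obtain ⟨k, hk⟩ := hp i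
    refine ⟨k, ?_⟩
    rw [smul_eq_mul, mul_left_comm]
    exact L.mul_mem_left _ hk

theorem mem_saturation {L : Ideal (MvPolynomial (Fin (n + 1)) K)}
    {p : MvPolynomial (Fin (n + 1)) K} :
    p ∈ saturation L ↔ ∀ i, ∃ k : ℕ, X i ^ k * p ∈ L := Iff.rfl

theorem le_saturation (L : Ideal (MvPolynomial (Fin (n + 1)) K)) : L ≤ saturation L :=
  fun p hp i => ⟨0, by simpa using hp⟩

theorem isSaturatedIdeal_saturation {L : Ideal (MvPolynomial (Fin (n + 1)) K)}
    (hL : IsHomogeneousIdeal L) : IsSaturatedIdeal (saturation L) := by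
  constructor
  · intro p hp d i
    obtain ⟨k, hk⟩ := hp i
    refine ⟨k, ?_⟩
    have := hL _ hk (k + d)
    rwa [homogeneousComponent_mul_of_isHomogeneous (isHomogeneous_X_pow i k),
      if_pos (Nat.le_add_right k d), Nat.add_sub_cancel_left] at this
  · intro p hp i
    obtain ⟨k, hk⟩ := hp i
    obtain ⟨l, hl⟩ := hk i
    exact ⟨l + k, by rwa [pow_add, mul_assoc]⟩

theorem exists_uniform_pow_mem {L : Ideal (MvPolynomial (Fin (n + 1)) K)} {l : ℕ}
    (s : Fin l → MvPolynomial (Fin (n + 1)) K)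
    (hs : Ideal.span (Set.range s) = saturation L) :
    ∃ k : ℕ, ∀ i, ∀ p ∈ saturation L, X i ^ k * p ∈ L := by
  have h1 : ∀ (i : Fin (n + 1)) (j : Fin l), ∃ k : ℕ, X i ^ k * s j ∈ L := fun i j =>
    mem_saturation.1 (hs.le (Ideal.subset_span ⟨j, rfl⟩)) i
  choose κ hκ using h1
  refine ⟨∑ i, ∑ j, κ i j, fun i p hp => ?_⟩
  rw [← hs] at hp
  obtain ⟨c, rfl⟩ := Ideal.mem_span_range_iff_exists_fun.1 hp
  rw [Finset.mul_sum]
  refine L.sum_mem fun j _ => ?_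
  rw [mul_left_comm]
  refine L.mul_mem_left _ (L.mem_of_dvd ?_ (hκ i j))
  refine mul_dvd_mul_right (pow_dvd_pow _ ?_) _
  exact (Finset.single_le_sum (f := fun j => κ i j) (fun _ _ => Nat.zero_le _)
    (Finset.mem_univ j)).trans (Finset.single_le_sum (f := fun i => ∑ j, κ i j)
      (fun _ _ => Nat.zero_le _) (Finset.mem_univ i))

/-- In large degrees, a homogeneous ideal agrees with its saturation. -/
theorem exists_gradedPiece_saturation_eq {L : Ideal (MvPolynomial (Fin (n + 1)) K)}
    (hL : IsHomogeneousIdeal L) :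
    ∃ N : ℕ, ∀ d ≥ N, gradedPiece (saturation L) d = gradedPiece L d := by
  obtain ⟨l, s, hs⟩ := Submodule.fg_iff_exists_fin_generating_family.1
    (IsNoetherian.noetherian (saturation L))
  obtain ⟨k, hk⟩ := exists_uniform_pow_mem s hs
  let e := ∑ j, (s j).totalDegree
  -- The generators have degree at most e, so for such d the monomial multiplying a nonzero
  -- component has degree above (n+1)k; some variable then has exponent at least k and moves the
  -- product into `L`.
  refine ⟨(n + 1) * k + e + 1, fun d hd => le_antisymm (fun p hp => ?_)
    fun p hp => le_saturation L hp⟩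
  rw [mem_gradedPiece] at hp ⊢
  obtain ⟨c, hc⟩ := Ideal.mem_span_range_iff_exists_fun.1 (hs.ge hp)
  rw [← homogeneousComponent_eq_self p.2, ← hc, map_sum]
  refine L.sum_mem fun j _ => ?_
  rw [(c j).as_sum, Finset.sum_mul, map_sum]
  refine L.sum_mem fun B _ => ?_
  rw [homogeneousComponent_mul_of_isHomogeneous (isHomogeneous_monomial _ rfl)]
  split_ifs with hB
  swap
  · exact L.zero_mem
  by_cases hdeg : (s j).totalDegree < d - B.degree
  · rw [homogeneousComponent_eq_zero _ _ hdeg, mul_zero]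
    exact L.zero_mem
  have hje : (s j).totalDegree ≤ e :=
    Finset.single_le_sum (f := fun j => (s j).totalDegree) (fun _ _ => Nat.zero_le _)
      (Finset.mem_univ j)
  have hBk : ∃ i, k ≤ B i := by
    by_contra! h
    have h1 : B.degree ≤ (n + 1) * k := by
      rw [Finsupp.degree_eq_sum]
      refine (Finset.sum_le_card_nsmul Finset.univ _ k fun i _ => (h i).le).trans ?_
      simp
    omega
  obtain ⟨i, hi⟩ := hBk
  have hsj : homogeneousComponent (d - B.degree) (s j) ∈ saturation L :=
    (isSaturatedIdeal_saturation hL).1 _ (hs.le (Ideal.subset_span ⟨j, rfl⟩)) _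
  refine L.mem_of_dvd (mul_dvd_mul_right ?_ _) (hk i _ hsj)
  rw [X_pow_eq_monomial]
  refine monomial_dvd_monomial.2 ⟨Or.inr ?_, ?_⟩
  · simpa using hi
  · simp

end Saturation

/-! ### The limit of the path -/

section Limit

variable {K : Type*} [Field K] {n : ℕ}

/-- The ideal of the limit of `λ_w(t) J` as `t` tends to `0`. -/
def limitIdeal (w : Fin (n + 1) → ℤ) (J : Ideal (MvPolynomial (Fin (n + 1)) K)) :
    Ideal (MvPolynomial (Fin (n + 1)) K) :=
  (familyIdeal w J).map (MvPolynomial.map (Polynomial.evalRingHom 0))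

theorem isHomogeneousIdeal_limitIdeal (w : Fin (n + 1) → ℤ)
    {J : Ideal (MvPolynomial (Fin (n + 1)) K)} (hJ : IsHomogeneousIdeal J) :
    IsHomogeneousIdeal (limitIdeal w J) :=
  isHomogeneousIdeal_map (isHomogeneousIdeal_familyIdeal w hJ) _ (evalRingHom_surjective 0)

theorem fibre_zero_idealForms_familyIdeal (w : Fin (n + 1) → ℤ)
    {J : Ideal (MvPolynomial (Fin (n + 1)) K)} (hJ : IsHomogeneousIdeal J) (d : ℕ) :
    fibre (idealForms (familyIdeal w J) d) 0 = gradedPiece (limitIdeal w J) d :=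
  fibre_idealForms (isHomogeneousIdeal_familyIdeal w hJ) d 0

/-- A reduced basis of J_d makes the family a graph, whose fibres all have the same rank. Neither
generic coordinates nor a separating weight is needed, so every degree is covered. -/
theorem finrank_gradedPiece_limitIdeal [Infinite K] (w : Fin (n + 1) → ℤ)
    {J : Ideal (MvPolynomial (Fin (n + 1)) K)} (hJ : IsHomogeneousIdeal J) (d : ℕ) :
    Module.finrank K (gradedPiece (limitIdeal w J) d) =
      Module.finrank K (gradedPiece J d) := by
  obtain ⟨b, F, h⟩ := exists_isReduced w (W := gradedPiece J d) rfl
  rw [← fibre_zero_idealForms_familyIdeal w hJ, h.idealForms_familyIdeal_eq,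
    h.isGraphData.fibre_eq]
  exact (h.isGraphData.map (Polynomial.evalRingHom 0)).finrank_eq

theorem submodule_eq_of_le_of_finrank_eq {E : Type*} [AddCommGroup E] [Module K E]
    {V W : Submodule K E} [Module.Finite K W] (h : V ≤ W)
    (hf : Module.finrank K V = Module.finrank K W) : V = W :=
  Submodule.eq_of_le_of_finrank_eq h hf

variable {P : ℚ[X]} {m : ℕ} {w : Fin (n + 1) → ℤ} {J : Ideal (MvPolynomial (Fin (n + 1)) K)}

theorem hasHilbertPoly_saturation_limitIdeal [Infinite K] (w : Fin (n + 1) → ℤ)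
    (hJ : IsSaturatedIdeal J) (hP : HasHilbertPoly J P) :
    HasHilbertPoly (saturation (limitIdeal w J)) P := by
  obtain ⟨N, hN⟩ := exists_gradedPiece_saturation_eq (isHomogeneousIdeal_limitIdeal w hJ.1)
  refine hasHilbertPoly_of_finrank_eq hP (N := N) fun d hd => ?_
  rw [hN d hd, finrank_gradedPiece_limitIdeal w hJ.1]

/-- Both `J` and the saturation of the limit are m-regular with the same Hilbert polynomial, so
their Hilbert functions agree from m on. The limit ideal has the Hilbert function of `J`, which
leaves no room for a strict inclusion in its saturation. -/
theorem gradedPiece_saturation_limitIdeal [Infinite K] (w : Fin (n + 1) → ℤ)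
    (hm : IsGotzmannNumber K n P m) (hJ : IsSaturatedIdeal J) (hP : HasHilbertPoly J P) {d : ℕ}
    (hd : m ≤ d) :
    gradedPiece (saturation (limitIdeal w J)) d = gradedPiece (limitIdeal w J) d := by
  have h1 := (hm.1 J hJ hP).finrank_eq hP hd
  have hP' := hasHilbertPoly_saturation_limitIdeal w hJ hP
  have h2 := (hm.1 _ (isSaturatedIdeal_saturation (isHomogeneousIdeal_limitIdeal w hJ.1))
    hP').finrank_eq hP' hd
  rw [← h1, Nat.cast_inj] at h2
  refine (submodule_eq_of_le_of_finrank_eq ?_ ?_).symm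
  · exact fun p hp => le_saturation _ hp
  · rw [h2, finrank_gradedPiece_limitIdeal w hJ.1]

/-- The limit is a point of the Hilbert scheme. -/
theorem gradedPiece_limitIdeal_mem_hilb [Infinite K] (w : Fin (n + 1) → ℤ)
    (hm : IsGotzmannNumber K n P m) (hJ : IsSaturatedIdeal J) (hP : HasHilbertPoly J P) :
    gradedPiece (limitIdeal w J) m ∈ hilb K n P m :=
  ⟨saturation (limitIdeal w J),
    isSaturatedIdeal_saturation (isHomogeneousIdeal_limitIdeal w hJ.1),
    hasHilbertPoly_saturation_limitIdeal w hJ hP,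
    (gradedPiece_saturation_limitIdeal w hm hJ hP le_rfl).symm⟩

/-- In degrees `d ≥ m`, the ideal of the limit is generated by its forms of degree `m`. -/
theorem gradedPiece_span_limitIdeal [Infinite K] (w : Fin (n + 1) → ℤ)
    (hm : IsGotzmannNumber K n P m) (hJ : IsSaturatedIdeal J) (hP : HasHilbertPoly J P) {d : ℕ}
    (hd : m ≤ d) :
    gradedPiece (Ideal.span ((fun p : Forms K n m => p.1) ''
      (gradedPiece (limitIdeal w J) m : Set _))) d = gradedPiece (limitIdeal w J) d := by
  have h := (hm.1 _ (isSaturatedIdeal_saturation (isHomogeneousIdeal_limitIdeal w hJ.1))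
    (hasHilbertPoly_saturation_limitIdeal w hJ hP)).gradedPiece_span hd
  rwa [gradedPiece_saturation_limitIdeal w hm hJ hP hd,
    gradedPiece_saturation_limitIdeal w hm hJ hP le_rfl] at h

theorem map_map_eq_gradedPiece_translate (w : Fin (n + 1) → ℤ) (g : GL (Fin (n + 1)) K)
    (I : Ideal (MvPolynomial (Fin (n + 1)) K)) (m : ℕ) {a : K} (ha : a ≠ 0) :
    ((gradedPiece I m).map (glAct m g).toLinearMap).map (matAct m (oneParam w a)) =
      gradedPiece (translate (oneParamGL w a ha) (translate g I)) m := by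
  rw [gradedPiece_translate, gradedPiece_translate]
  rfl

/-- The path `t ↦ λ_w(t) g I_m` extends uniquely to the affine line. -/
theorem isPath_iff [Infinite K] (w : Fin (n + 1) → ℤ) (hm : IsGotzmannNumber K n P m)
    {I : Ideal (MvPolynomial (Fin (n + 1)) K)} (hI : IsSaturatedIdeal I)
    (hP : HasHilbertPoly I P) (g : GL (Fin (n + 1)) K)
    (M : Submodule K[X] (Forms K[X] n m)) :
    IsPath P w g (gradedPiece I m) M ↔ M = idealForms (familyIdeal w (translate g I)) m := by
  have hJ : IsSaturatedIdeal (translate g I) := isSaturatedIdeal_translate g hI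
  have hPJ : HasHilbertPoly (translate g I) P := hasHilbertPoly_of_finrank_eq hP (N := 0)
    fun d _ => finrank_gradedPiece_translate g I d
  obtain ⟨b, F, h⟩ := exists_isReduced w (W := gradedPiece (translate g I) m) rfl
  have hM := h.idealForms_familyIdeal_eq
  have hfib : ∀ (a : K) (ha : a ≠ 0),
      fibre (idealForms (familyIdeal w (translate g I)) m) a =
        gradedPiece (translate (oneParamGL w a ha) (translate g I)) m := by
    intro a ha
    rw [hM, h.isGraphData.fibre_eq, h.gradedPiece_translate_eq ha]
  constructor
  · rintro ⟨⟨hflat, -⟩, hpath⟩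
    rw [hM]
    refine h.isGraphData.eq_of_fibre_eq hflat fun a ha => ?_
    rw [hpath a ha, map_map_eq_gradedPiece_translate w g I m ha, h.gradedPiece_translate_eq ha]
  · rintro rfl
    refine ⟨⟨?_, fun a => ?_⟩, fun a ha => ?_⟩
    · rw [hM]
      exact flat_quotient_graphForms
    · by_cases ha : a = 0
      · subst ha
        rw [fibre_zero_idealForms_familyIdeal w hJ.1]
        exact gradedPiece_limitIdeal_mem_hilb w hm hJ hPJ
      · rw [hfib a ha]
        exact ⟨_, isSaturatedIdeal_translate _ hJ, hasHilbertPoly_of_finrank_eq hPJ (N := 0)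
          fun d _ => finrank_gradedPiece_translate _ _ d, rfl⟩
    · rw [hfib a ha, map_map_eq_gradedPiece_translate w g I m ha]

end Limit

/-! ### Flatness of first order deformations -/

section Flat

variable {K : Type*} [Field K] {n m : ℕ}

-- The ideals of K[ε] are 0, (ε) and the whole ring, all principal, so every element of I ⊗ N is a
-- pure tensor e ⊗ x. For I = (ε), εx = 0 gives x = εy, and ε ⊗ εy = ε² ⊗ y = 0.
open TensorProduct in
theorem flat_dualNumber_of_ker_le_range {N : Type*} [AddCommGroup N] [Module (DualNumber K) N]
    (h : ∀ x : N, (DualNumber.eps : DualNumber K) • x = 0 →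
      ∃ y : N, x = (DualNumber.eps : DualNumber K) • y) : Module.Flat (DualNumber K) N := by
  rw [Module.Flat.iff_lift_lsmul_comp_subtype_injective]
  rintro I -
  have key : ∀ (e : DualNumber K) (he : e ∈ I), I = Ideal.span {e} →
      ∀ t : I ⊗[DualNumber K] N, ∃ x : N, t = (⟨e, he⟩ : I) ⊗ₜ[DualNumber K] x := by
    intro e he hI t
    induction t using TensorProduct.induction_on with
    | zero => exact ⟨0, (tmul_zero _ _).symm⟩
    | tmul a x =>
      obtain ⟨c, hc⟩ := Ideal.mem_span_singleton'.1 (hI.le a.2)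
      refine ⟨c • x, ?_⟩
      rw [tmul_smul, smul_tmul']
      congr 1
      exact Subtype.ext hc.symm
    | add s t hs ht =>
      obtain ⟨x, rfl⟩ := hs
      obtain ⟨y, rfl⟩ := ht
      exact ⟨x + y, (tmul_add _ _ _).symm⟩
  have key2 : ∀ (e : DualNumber K) (he : e ∈ I), I = Ideal.span {e} →
      (∀ x : N, e • x = 0 → (⟨e, he⟩ : I) ⊗ₜ[DualNumber K] x = 0) →
      Function.Injective (TensorProduct.lift ((LinearMap.lsmul (DualNumber K) N).comp
        I.subtype)) := by
    intro e he hI hx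
    rw [← LinearMap.ker_eq_bot, LinearMap.ker_eq_bot']
    intro t ht
    obtain ⟨x, rfl⟩ := key e he hI t
    exact hx x ht
  obtain hI | hI | hI := DualNumber.ideal_trichotomy I
  · have h0 : (0 : DualNumber K) ∈ I := I.zero_mem
    refine key2 0 h0 (by rw [hI, Ideal.span_singleton_zero]) fun x _ => ?_
    exact zero_tmul _ x
  · have hε : (DualNumber.eps : DualNumber K) ∈ I := by
      rw [hI]
      exact Ideal.mem_span_singleton_self _
    refine key2 _ hε hI fun x hx => ?_
    obtain ⟨y, rfl⟩ := h x hx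
    rw [tmul_smul, smul_tmul', show (DualNumber.eps : DualNumber K) • (⟨_, hε⟩ : I) = 0 from
      Subtype.ext DualNumber.eps_mul_eps, zero_tmul]
  · have h1 : (1 : DualNumber K) ∈ I := by
      rw [hI]
      trivial
    refine key2 1 h1 (by rw [hI, Ideal.span_singleton_one]) fun x hx => ?_
    rw [one_smul] at hx
    rw [hx, tmul_zero]

theorem fst_algebraMap_dualNumber (c : K) :
    TrivSqZeroExt.fst (algebraMap K (DualNumber K) c) = c := rfl

theorem snd_algebraMap_dualNumber (c : K) :
    TrivSqZeroExt.snd (algebraMap K (DualNumber K) c) = 0 := rfl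

/-- The polynomial `p + ε q`. -/
def dualPoly {σ : Type*} (p q : MvPolynomial σ K) : MvPolynomial σ (DualNumber K) :=
  MvPolynomial.map (algebraMap K (DualNumber K)) p +
    C DualNumber.eps * MvPolynomial.map (algebraMap K (DualNumber K)) q

theorem dualPoly_add {σ : Type*} (p q p' q' : MvPolynomial σ K) :
    dualPoly p q + dualPoly p' q' = dualPoly (p + p') (q + q') := by
  simp only [dualPoly, map_add]
  ring

theorem dualPoly_mul {σ : Type*} (p q p' q' : MvPolynomial σ K) :
    dualPoly p q * dualPoly p' q' = dualPoly (p * p') (p * q' + q * p') := by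
  have h : (C DualNumber.eps : MvPolynomial σ (DualNumber K)) * C DualNumber.eps = 0 := by
    rw [← C_mul, DualNumber.eps_mul_eps, C_0]
  simp only [dualPoly, map_add, map_mul]
  linear_combination (MvPolynomial.map (algebraMap K (DualNumber K)) q *
    MvPolynomial.map (algebraMap K (DualNumber K)) q') * h

theorem exists_eq_dualPoly {σ : Type*} (y : MvPolynomial σ (DualNumber K)) :
    ∃ p q : MvPolynomial σ K, y = dualPoly p q := by
  induction y using MvPolynomial.induction_on with
  | C a =>
    refine ⟨C (TrivSqZeroExt.fst a), C (TrivSqZeroExt.snd a), ?_⟩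
    simp only [dualPoly, map_C, ← C_mul, ← C_add]
    congr 1
    ext <;> simp [fst_algebraMap_dualNumber, snd_algebraMap_dualNumber]
  | add y y' hy hy' =>
    obtain ⟨p, q, rfl⟩ := hy
    obtain ⟨p', q', rfl⟩ := hy'
    exact ⟨_, _, dualPoly_add p q p' q'⟩
  | mul_X y i hy =>
    obtain ⟨p, q, rfl⟩ := hy
    refine ⟨p * X i, q * X i, ?_⟩
    simp only [dualPoly, map_mul, map_X]
    ring

theorem dualPoly_injective {σ : Type*} {p q p' q' : MvPolynomial σ K}
    (h : dualPoly p q = dualPoly p' q') : p = p' ∧ q = q' := by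
  have key : ∀ (p q : MvPolynomial σ K) (A : σ →₀ ℕ), coeff A (dualPoly p q) =
      algebraMap K (DualNumber K) (coeff A p) +
        DualNumber.eps * algebraMap K (DualNumber K) (coeff A q) := by
    intro p q A
    simp [dualPoly, coeff_C_mul, coeff_map]
  constructor
  · ext A
    have h1 := congrArg (fun y => TrivSqZeroExt.fst (coeff A y)) h
    simpa [key, fst_algebraMap_dualNumber, snd_algebraMap_dualNumber] using h1
  · ext A
    have h1 := congrArg (fun y => TrivSqZeroExt.snd (coeff A y)) h
    simpa [key, fst_algebraMap_dualNumber, snd_algebraMap_dualNumber] using h1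

theorem dualPoly_mem_deformationIdeal {V : Submodule K (Forms K n m)} {φ : GrassTangent V}
    (v : V) {u : Forms K n m} (hu : V.mkQ u = φ v) :
    dualPoly v.1.1 u.1 ∈ deformationIdeal V φ :=
  Ideal.subset_span ⟨v, u, hu, rfl⟩

/-- The lift of a polynomial to the deformation. -/
theorem exists_dualPoly_mem_deformationIdeal {V : Submodule K (Forms K n m)}
    {φ : GrassTangent V} {s : MvPolynomial (Fin (n + 1)) K}
    (hs : s ∈ Ideal.span ((fun p : Forms K n m => p.1) '' (V : Set (Forms K n m)))) :
    ∃ s', dualPoly s s' ∈ deformationIdeal V φ := by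
  induction hs using Submodule.span_induction with
  | mem s hs =>
    obtain ⟨v, hv, rfl⟩ := hs
    obtain ⟨u, hu⟩ := V.mkQ_surjective (φ ⟨v, hv⟩)
    exact ⟨u.1, dualPoly_mem_deformationIdeal ⟨v, hv⟩ hu⟩
  | zero => exact ⟨0, by simp [dualPoly]⟩
  | add s t _ _ hs ht =>
    obtain ⟨s', hs⟩ := hs
    obtain ⟨t', ht⟩ := ht
    exact ⟨s' + t', by rw [← dualPoly_add]; exact Ideal.add_mem _ hs ht⟩
  | smul a s _ hs =>
    obtain ⟨s', hs⟩ := hs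
    refine ⟨a * s', ?_⟩
    have := Ideal.mul_mem_left _ (dualPoly a 0) hs
    rwa [dualPoly_mul, zero_mul, add_zero] at this

theorem coe_add_smul_add_smul (v u : Forms K n m) (q : Forms K[X] n m) (c c' : K[X]) :
    (coeffMap Polynomial.C v + c • coeffMap Polynomial.C u + c' • q).1 =
      MvPolynomial.map Polynomial.C v.1 + C c * MvPolynomial.map Polynomial.C u.1 +
        C c' * q.1 := by
  rw [Submodule.coe_add, Submodule.coe_add, Submodule.coe_smul, Submodule.coe_smul,
    smul_eq_C_mul, smul_eq_C_mul]
  rfl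

theorem mem_ideal_of_eq_of_mem {R : Type*} [CommRing R] {I : Ideal R} {x y : R} (h : x = y)
    (hy : y ∈ I) : x ∈ I := h ▸ hy

/-- The elements of the deformation lift to the family over the affine line. -/
theorem exists_lift_of_mem_deformationIdeal {M : Submodule K[X] (Forms K[X] n m)}
    {φ : GrassTangent (fibre M 0)} {k : ℕ}
    (hφ : ∀ v : fibre M 0, ∃ (u : Forms K n m) (q : Forms K[X] n m),
      (fibre M 0).mkQ u = φ v ∧ coeffMap Polynomial.C (v : Forms K n m) +
        (Polynomial.X ^ (k + 1) : K[X]) • coeffMap Polynomial.C u +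
        (Polynomial.X ^ (k + 1 + 1) : K[X]) • q ∈ M)
    {y : MvPolynomial (Fin (n + 1)) (DualNumber K)}
    (hy : y ∈ deformationIdeal (fibre M 0) φ) :
    ∃ p s z : MvPolynomial (Fin (n + 1)) K, ∃ q : MvPolynomial (Fin (n + 1)) K[X],
      y = dualPoly p s ∧
      z ∈ Ideal.span ((fun p : Forms K n m => p.1) '' (fibre M 0 : Set (Forms K n m))) ∧
      MvPolynomial.map Polynomial.C p +
        C (Polynomial.X ^ (k + 1)) * MvPolynomial.map Polynomial.C (s + z) +
        C (Polynomial.X ^ (k + 1 + 1)) * q ∈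
          Ideal.span ((fun p : Forms K[X] n m => p.1) '' (M : Set (Forms K[X] n m))) := by
  induction hy using Submodule.span_induction with
  | mem y hy =>
    obtain ⟨v, u, hu, rfl⟩ := hy
    obtain ⟨u', q, hu', hq⟩ := hφ v
    -- A generator of the deformation ideal may use any representative of φ(v), the section of `M`
    -- provides its own; the discrepancy in V is what `z` records.
    have hz : u' - u ∈ fibre M 0 := by
      rw [← Submodule.Quotient.mk_eq_zero, Submodule.Quotient.mk_sub]
      exact sub_eq_zero.2 (hu'.trans hu.symm)
    refine ⟨v.1.1, u.1, u'.1 - u.1, q.1, rfl, Ideal.subset_span ⟨_, hz, rfl⟩, ?_⟩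
    rw [add_sub_cancel, ← coe_add_smul_add_smul]
    exact Ideal.subset_span ⟨_, hq, rfl⟩
  | zero => exact ⟨0, 0, 0, 0, by simp [dualPoly], Ideal.zero_mem _, by simp⟩
  | add y y' _ _ hy hy' =>
    obtain ⟨p, s, z, q, rfl, hz, h⟩ := hy
    obtain ⟨p', s', z', q', rfl, hz', h'⟩ := hy'
    refine ⟨p + p', s + s', z + z', q + q', dualPoly_add _ _ _ _, Ideal.add_mem _ hz hz', ?_⟩
    refine mem_ideal_of_eq_of_mem ?_ (Ideal.add_mem _ h h')
    simp only [map_add]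
    ring
  | smul a y _ hy =>
    obtain ⟨p, s, z, q, rfl, hz, h⟩ := hy
    obtain ⟨c, c', rfl⟩ := exists_eq_dualPoly a
    -- The multiplier c + εc' lifts to c + t^(k+1)c'. The cross term of order 2(k+1) fits into the
    -- remainder because 2(k+1) ≥ k+2.
    refine ⟨c * p, c * s + c' * p, c * z, MvPolynomial.map Polynomial.C c * q +
      C (Polynomial.X ^ k) * MvPolynomial.map Polynomial.C (c' * (s + z)) +
      C (Polynomial.X ^ (k + 1)) * MvPolynomial.map Polynomial.C c' * q,
      dualPoly_mul _ _ _ _, Ideal.mul_mem_left _ _ hz, ?_⟩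
    refine mem_ideal_of_eq_of_mem ?_ (Ideal.mul_mem_left _ (MvPolynomial.map Polynomial.C c +
      C (Polynomial.X ^ (k + 1)) * MvPolynomial.map Polynomial.C c') h)
    simp only [map_add, map_mul, map_pow]
    ring

/-- A tangent vector to a curve in the Hilbert scheme, given by an ideal of polynomials over
`K[t]`, defines a flat deformation. -/
theorem isHilbTangent_of_isTangentVectorAtZero {𝓜 : Ideal (MvPolynomial (Fin (n + 1)) K[X])}
    (hhom : IsHomogeneousIdeal 𝓜)
    (hsat : ∀ (k : ℕ) (q : MvPolynomial (Fin (n + 1)) K[X]),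
      C (Polynomial.X ^ k) * q ∈ 𝓜 → q ∈ 𝓜)
    (hgen : ∀ d ≥ m, gradedPiece (Ideal.span ((fun p : Forms K n m => p.1) ''
      (gradedPiece (𝓜.map (MvPolynomial.map (Polynomial.evalRingHom 0))) m : Set _))) d =
        gradedPiece (𝓜.map (MvPolynomial.map (Polynomial.evalRingHom 0))) d)
    {φ : GrassTangent (fibre (idealForms 𝓜 m) 0)}
    (hφ : IsTangentVectorAtZero (idealForms 𝓜 m) φ) :
    IsHilbTangent (fibre (idealForms 𝓜 m) 0) φ := by
  obtain ⟨-, k', hk', hφ⟩ := hφ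
  obtain ⟨k, rfl⟩ : ∃ k, k' = k + 1 := ⟨k' - 1, by omega⟩
  refine flat_dualNumber_of_ker_le_range fun x hx => ?_
  obtain ⟨y, rfl⟩ := Ideal.Quotient.mk_surjective x
  obtain ⟨s, s', rfl⟩ := exists_eq_dualPoly y
  -- Since ε(s + εs') = εs, the kernel condition says that εs lies in the deformation ideal. It
  -- remains to put s in the ideal generated by V: subtracting a lift s + εs'' then leaves a
  -- multiple of ε.
  have h1 : dualPoly 0 s ∈ deformationIdeal (fibre (idealForms 𝓜 m) 0) φ := by
    rw [← Ideal.Quotient.eq_zero_iff_mem, ← hx]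
    have h2 : dualPoly 0 s = (DualNumber.eps : DualNumber K) • dualPoly s s' := by
      have h := dualPoly_mul 0 1 s s'
      rw [zero_mul, zero_mul, zero_add, one_mul] at h
      rw [← h, smul_eq_C_mul]
      congr 1
      simp [dualPoly]
    rw [h2]
    rfl
  obtain ⟨p, t, z, q, hpt, hz, h2⟩ := exists_lift_of_mem_deformationIdeal hφ h1
  obtain ⟨rfl, rfl⟩ := dualPoly_injective hpt
  have h3 : C (Polynomial.X ^ (k + 1)) * (MvPolynomial.map Polynomial.C (s + z) +
      C Polynomial.X * q) ∈ Ideal.span ((fun p : Forms K[X] n m => p.1) ''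
        (idealForms 𝓜 m : Set (Forms K[X] n m))) := by
    refine mem_ideal_of_eq_of_mem ?_ h2
    rw [map_zero, zero_add, pow_succ Polynomial.X (k + 1), C_mul]
    ring
  have heval : MvPolynomial.map (Polynomial.evalRingHom 0)
      (MvPolynomial.map Polynomial.C (s + z) + C Polynomial.X * q) = s + z := by
    rw [map_add, map_mul, map_C, MvPolynomial.map_map,
      show (Polynomial.evalRingHom (0 : K)).comp Polynomial.C = RingHom.id K by ext; simp,
      MvPolynomial.map_id]
    simp
  have hfib := fibre_idealForms hhom m 0
  have hspan : IsHomogeneousIdeal (Ideal.span ((fun p : Forms K n m => p.1) ''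
      (fibre (idealForms 𝓜 m) 0 : Set (Forms K n m)))) := by
    refine isHomogeneousIdeal_span m ?_
    rintro _ ⟨v, -, rfl⟩
    exact v.2
  have hs : s ∈ Ideal.span ((fun p : Forms K n m => p.1) ''
      (fibre (idealForms 𝓜 m) 0 : Set (Forms K n m))) := by
    refine mem_of_homogeneousComponent_mem fun d => ?_
    suffices h : homogeneousComponent d (s + z) ∈ Ideal.span ((fun p : Forms K n m => p.1) ''
        (fibre (idealForms 𝓜 m) 0 : Set (Forms K n m))) by
      have := Ideal.sub_mem _ h (hspan z hz d)
      rwa [map_add, add_sub_cancel_right] at this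
    -- Below degree m an ideal generated in degree m has no nonzero component. From m on,
    -- t-saturation divides out t^(k+1), and evaluation at t = 0 lands in the limit ideal, which V
    -- generates in these degrees.
    obtain hd | hd := lt_or_ge d m
    · have h4 := homogeneousComponent_eq_zero_of_mem_span (m := m) (by
        rintro _ ⟨v, -, rfl⟩
        exact v.2) hd h3
      rw [homogeneousComponent_C_mul, mul_eq_zero] at h4
      have h5 := h4.resolve_left (by simp)
      rw [← heval, homogeneousComponent_map, h5, map_zero]
      exact Ideal.zero_mem _
    · have h4 : MvPolynomial.map Polynomial.C (s + z) + C Polynomial.X * q ∈ 𝓜 := by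
        refine hsat (k + 1) _ (Ideal.span_le.2 ?_ h3)
        rintro _ ⟨v, hv, rfl⟩
        exact hv
      have h5 := Ideal.mem_map_of_mem (MvPolynomial.map (Polynomial.evalRingHom 0)) h4
      rw [heval] at h5
      have h6 := isHomogeneousIdeal_map hhom _ (evalRingHom_surjective 0) _ h5 d
      have h7 : (⟨homogeneousComponent d (s + z), homogeneousComponent_mem d _⟩ : Forms K n d) ∈
        gradedPiece (𝓜.map (MvPolynomial.map (Polynomial.evalRingHom 0))) d := h6
      rw [← hgen d hd, ← hfib] at h7
      exact h7
  obtain ⟨s'', h4⟩ := exists_dualPoly_mem_deformationIdeal (φ := φ) hs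
  refine ⟨Ideal.Quotient.mk _ (dualPoly (s' - s'') 0), ?_⟩
  have h5 : dualPoly s s' - dualPoly s s'' =
      (DualNumber.eps : DualNumber K) • dualPoly (s' - s'') 0 := by
    rw [smul_eq_C_mul]
    simp only [dualPoly, map_sub, map_zero]
    ring
  have h6 : Ideal.Quotient.mk (deformationIdeal (fibre (idealForms 𝓜 m) 0) φ)
      (dualPoly s s') = Ideal.Quotient.mk _ (dualPoly s s' - dualPoly s s'') := by
    rw [map_sub, Ideal.Quotient.eq_zero_iff_mem.2 h4, sub_zero]
  rw [h6, h5]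
  rfl

end Flat

/-! ### The action of upper triangular matrices on monomials -/

section Triangular

variable {K : Type*} [Field K] {n : ℕ}

theorem wt_add (w : Fin (n + 1) → ℤ) (A B : Fin (n + 1) →₀ ℕ) :
    wt w (A + B) = wt w A + wt w B := by
  simp [wt, mul_add, Finset.sum_add_distrib]

/-- The monomial `x^A` occurs in `p` with coefficient `c`, and all other monomials of `p` have
greater weight. -/
def HasLowest (w : Fin (n + 1) → ℤ) (A : Fin (n + 1) →₀ ℕ) (c : K)
    (p : MvPolynomial (Fin (n + 1)) K) : Prop :=
  coeff A p = c ∧ ∀ B, coeff B p ≠ 0 → B = A ∨ wt w A < wt w B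

/-- Weights add under multiplication, so any pair of monomials other than the two lowest ones has
strictly larger total weight. -/
theorem HasLowest.mul {w : Fin (n + 1) → ℤ} {A B : Fin (n + 1) →₀ ℕ} {c d : K}
    {p q : MvPolynomial (Fin (n + 1)) K} (hp : HasLowest w A c p) (hq : HasLowest w B d q) :
    HasLowest w (A + B) (c * d) (p * q) := by
  classical
  constructor
  · rw [coeff_mul, Finset.sum_eq_single (A, B), hp.1, hq.1]
    · rintro ⟨A', B'⟩ hmem hne
      by_contra h0
      have hA := hp.2 A' (left_ne_zero_of_mul h0)
      have hB := hq.2 B' (right_ne_zero_of_mul h0)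
      have hs : A' + B' = A + B := Finset.HasAntidiagonal.mem_antidiagonal.1 hmem
      have hw : wt w A' + wt w B' = wt w A + wt w B := by rw [← wt_add, hs, wt_add]
      obtain rfl | hA := hA
      · obtain rfl | hB := hB
        · exact hne rfl
        · omega
      · obtain rfl | hB := hB
        · omega
        · omega
    · intro h
      refine absurd ?_ h
      rw [Finset.HasAntidiagonal.mem_antidiagonal]
  · intro D hD
    rw [coeff_mul] at hD
    obtain ⟨⟨A', B'⟩, hmem, h0⟩ := Finset.exists_ne_zero_of_sum_ne_zero hD
    have hA := hp.2 A' (left_ne_zero_of_mul h0)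
    have hB := hq.2 B' (right_ne_zero_of_mul h0)
    have hs : A' + B' = D := Finset.HasAntidiagonal.mem_antidiagonal.1 hmem
    rw [← hs, wt_add, wt_add]
    obtain rfl | hA := hA
    · obtain rfl | hB := hB
      · exact Or.inl rfl
      · exact Or.inr (by omega)
    · obtain rfl | hB := hB
      · exact Or.inr (by omega)
      · exact Or.inr (by omega)

/-- The character by which a diagonal matrix acts on a monomial. -/
def diagChar (h : Matrix (Fin (n + 1)) (Fin (n + 1)) K) (A : Fin (n + 1) →₀ ℕ) : K :=
  ∏ i, h i i ^ A i

theorem diagChar_add (h : Matrix (Fin (n + 1)) (Fin (n + 1)) K) (A B : Fin (n + 1) →₀ ℕ) :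
    diagChar h (A + B) = diagChar h A * diagChar h B := by
  simp [diagChar, pow_add, Finset.prod_mul_distrib]

theorem hasLowest_one (w : Fin (n + 1) → ℤ) : HasLowest w 0 1 (1 : MvPolynomial _ K) := by
  refine ⟨by simp, fun B hB => Or.inl ?_⟩
  rw [coeff_one] at hB
  by_contra h
  exact hB (if_neg (Ne.symm h))

theorem wt_single (w : Fin (n + 1) → ℤ) (i : Fin (n + 1)) :
    wt w (Finsupp.single i 1) = w i := by
  rw [wt, Finset.sum_eq_single i]
  · simp
  · intro j _ hj
    rw [Finsupp.single_eq_of_ne hj]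
    simp
  · simp

/-- An upper triangular matrix sends x_i to a combination of the x_j with j ≤ i, and these are at
least as heavy because w is decreasing. -/
theorem hasLowest_linSubst_X {w : Fin (n + 1) → ℤ} (hw : StrictAnti w)
    {h : Matrix (Fin (n + 1)) (Fin (n + 1)) K} (hh : ∀ i j, j < i → h i j = 0)
    (i : Fin (n + 1)) : HasLowest w (Finsupp.single i 1) (h i i) (linSubst h (X i)) := by
  rw [linSubst, aeval_X]
  constructor
  · rw [coeff_sum, Finset.sum_eq_single i]
    · simp
    · intro j _ hj
      rw [coeff_C_mul, coeff_X, if_neg, mul_zero]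
      exact fun h => hj (Finsupp.single_left_injective one_ne_zero h)
    · simp
  · intro B hB
    rw [coeff_sum] at hB
    obtain ⟨j, -, hj⟩ := Finset.exists_ne_zero_of_sum_ne_zero hB
    rw [coeff_C_mul, coeff_X] at hj
    have hB : Finsupp.single j 1 = B := by
      by_contra h
      rw [if_neg h, mul_zero] at hj
      exact hj rfl
    subst hB
    rw [wt_single, wt_single]
    obtain hlt | rfl | hgt := lt_trichotomy j i
    · exact Or.inr (hw hlt)
    · exact Or.inl rfl
    · exact absurd (hh j i hgt) (left_ne_zero_of_mul hj)

theorem hasLowest_linSubst_monomial {w : Fin (n + 1) → ℤ} (hw : StrictAnti w)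
    {h : Matrix (Fin (n + 1)) (Fin (n + 1)) K} (hh : ∀ i j, j < i → h i j = 0)
    (A : Fin (n + 1) →₀ ℕ) : HasLowest w A (diagChar h A) (linSubst h (monomial A 1)) := by
  induction A using Finsupp.induction_linear with
  | zero =>
    rw [show (monomial 0 1 : MvPolynomial (Fin (n + 1)) K) = 1 from rfl, map_one,
      show diagChar h 0 = 1 by simp [diagChar]]
    exact hasLowest_one w
  | add A B hA hB =>
    rw [show (monomial (A + B) 1 : MvPolynomial (Fin (n + 1)) K) =
      monomial A 1 * monomial B 1 by rw [monomial_mul, mul_one], map_mul, diagChar_add]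
    exact hA.mul hB
  | single i k =>
    induction k with
    | zero =>
      rw [Finsupp.single_zero, show (monomial 0 1 : MvPolynomial (Fin (n + 1)) K) = 1 from rfl,
        map_one, show diagChar h 0 = 1 by simp [diagChar]]
      exact hasLowest_one w
    | succ k ih =>
      have h1 := hasLowest_linSubst_X hw hh i
      have h2 : diagChar h (Finsupp.single i 1) = h i i := by
        rw [diagChar, Finset.prod_eq_single i]
        · simp
        · intro j _ hj
          rw [Finsupp.single_eq_of_ne hj, pow_zero]
        · simp
      rw [Finsupp.single_add, show (monomial (Finsupp.single i k + Finsupp.single i 1) 1 :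
        MvPolynomial (Fin (n + 1)) K) = monomial (Finsupp.single i k) 1 * X i by
          rw [X, monomial_mul, mul_one], map_mul, diagChar_add, h2]
      exact ih.mul h1

theorem diagChar_ne_zero {h : GL (Fin (n + 1)) K} (hh : IsUpperTri h) (A : Fin (n + 1) →₀ ℕ) :
    diagChar (h : Matrix (Fin (n + 1)) (Fin (n + 1)) K) A ≠ 0 := by
  have h1 : (h : Matrix (Fin (n + 1)) (Fin (n + 1)) K).det ≠ 0 :=
    ((Matrix.isUnit_iff_isUnit_det _).1 h.isUnit).ne_zero
  rw [Matrix.det_of_isUpperTriangular fun i j hij => hh i j hij] at h1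
  exact Finset.prod_ne_zero_iff.2 fun i hi =>
    pow_ne_zero _ (Finset.prod_ne_zero_iff.1 h1 i hi)

/-- At an index of maximal weight in the support of `Y`, only the diagonal term survives. This
reduces the triangular systems below to one scalar equation. -/
theorem exists_mulVec_eq_of_triangular {r : ℕ} {p : Matrix (Fin r) (Fin r) K} {ω : Fin r → ℤ}
    (hp : ∀ i j, p i j ≠ 0 → i = j ∨ ω i < ω j) {Y : Fin r → K} (hY : Y ≠ 0) :
    ∃ i, Y i ≠ 0 ∧ p.mulVec Y i = p i i * Y i := by
  obtain ⟨i₀, hi₀⟩ := Function.ne_iff.1 hY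
  obtain ⟨i, hi, hmax⟩ := Set.exists_max_image {i | Y i ≠ 0} ω (Set.toFinite _) ⟨i₀, hi₀⟩
  refine ⟨i, hi, ?_⟩
  rw [Matrix.mulVec, dotProduct]
  refine Finset.sum_eq_single i (fun j _ hj => ?_) (by simp)
  by_contra h0
  obtain rfl | h := hp i j (left_ne_zero_of_mul h0)
  · exact hj rfl
  · exact absurd (hmax j (right_ne_zero_of_mul h0)) (by omega)

theorem det_ne_zero_of_triangular {r : ℕ} {p : Matrix (Fin r) (Fin r) K} {ω : Fin r → ℤ}
    (hp : ∀ i j, p i j ≠ 0 → i = j ∨ ω i < ω j) (hd : ∀ i, p i i ≠ 0) : p.det ≠ 0 := by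
  rw [Ne, ← Matrix.exists_mulVec_eq_zero_iff]
  rintro ⟨Y, hY, h0⟩
  obtain ⟨i, hi, h⟩ := exists_mulVec_eq_of_triangular hp hY
  rw [h0] at h
  exact mul_ne_zero (hd i) hi h.symm

end Triangular

/-! ### The limit of a generic translate is fixed by the Borel group -/

section Borel

variable {K : Type*} [Field K] {n m r : ℕ}

/-- `W` has all the states of its translates. -/
def IsGeneric (r : ℕ) (W : Submodule K (Forms K n m)) : Prop :=
  ∀ (h : GL (Fin (n + 1)) K) (B : Fin r → (Fin (n + 1) →₀ ℕ)), (∀ j, (B j).degree = m) →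
    IsState (W.map (glAct m h).toLinearMap) B → IsState W B

theorem isGeneric_gradedPiece_translate {I : Ideal (MvPolynomial (Fin (n + 1)) K)}
    (f : Module.Basis (Fin r) K (gradedPiece I m)) {g : GL (Fin (n + 1)) K}
    (hg : g ∈ genericSet m fun i => (f i).1.1) :
    IsGeneric r (gradedPiece (translate g I) m) := by
  intro h B hB hs
  rw [← gradedPiece_translate, ← translate_mul, gradedPiece_translate] at hs
  rw [gradedPiece_translate]
  exact isState_of_mem_genericSet f hg (h * g) hB hs

variable {w : Fin (n + 1) → ℤ} {J : Ideal (MvPolynomial (Fin (n + 1)) K)}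
  {b : Fin r → (Fin (n + 1) →₀ ℕ)} {F : Fin r → Forms K n m}

/-- The coefficients of the translates by `h` of the sections of the family. -/
def transCoeff (w : Fin (n + 1) → ℤ) (b : Fin r → (Fin (n + 1) →₀ ℕ)) (F : Fin r → Forms K n m)
    (h : GL (Fin (n + 1)) K) (i : Fin r) (A : Fin (n + 1) →₀ ℕ) : K[X] :=
  coeff A (linSubst ((h : Matrix (Fin (n + 1)) (Fin (n + 1)) K).map Polynomial.C)
    (graphSection m (familyCoeff w b F) i).1)

/-- The coefficients at `b` of the translates by `h` of the sections of the family. -/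
def transMatrix (w : Fin (n + 1) → ℤ) (b : Fin r → (Fin (n + 1) →₀ ℕ)) (F : Fin r → Forms K n m)
    (h : GL (Fin (n + 1)) K) : Matrix (Fin r) (Fin r) K[X] :=
  Matrix.of fun i j => transCoeff w b F h i (b j)

theorem eval_transCoeff (h : GL (Fin (n + 1)) K) (i : Fin r) (A : Fin (n + 1) →₀ ℕ) (a : K) :
    (transCoeff w b F h i A).eval a =
      coeff A (linSubst (h : Matrix (Fin (n + 1)) (Fin (n + 1)) K)
        (coeffMap (Polynomial.evalRingHom a) (graphSection m (familyCoeff w b F) i)).1) := by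
  rw [← Polynomial.coe_evalRingHom, transCoeff, ← coeff_map, map_linSubst, Matrix.map_map]
  have : (Polynomial.evalRingHom a : K[X] → K) ∘ Polynomial.C = id := by
    ext x
    simp
  rw [this, Matrix.map_id]
  rfl

/-- If `x^A` can replace `x^{b_i}` among the states of a translate of the family, then it occurs
in the element of the reduced basis with leading monomial `x^{b_i}`. -/
theorem coeff_ne_zero_of_adjugate_ne_zero [Infinite K] (hgen : IsGeneric r (gradedPiece J m))
    (hred : IsReduced w (gradedPiece J m) b F) (h : GL (Fin (n + 1)) K)
    (hdet : (transMatrix w b F h).det ≠ 0) {i : Fin r} {A : Fin (n + 1) →₀ ℕ}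
    (hA : ∑ j, (transMatrix w b F h).adjugate i j * transCoeff w b F h j A ≠ 0) :
    coeff A (F i).1 ≠ 0 := by
  have hAm : A.degree = m := by
    by_contra hd
    refine hA (Finset.sum_eq_zero fun j _ => ?_)
    rw [transCoeff, ((mem_homogeneousSubmodule m _).1 (linSubst_mem _ _
      (graphSection m (familyCoeff w b F) j).2)).coeff_eq_zero hd, mul_zero]
  -- The claim becomes that b with b_i exchanged for A is a state of W; by genericity a state of
  -- some translate suffices.
  rw [← isState_update_iff hred.isState hred.mem hred.coeff_eq]
  -- The factor t excludes a = 0, where λ_w is not invertible; the others keep the determinant and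
  -- the Cramer sum nonzero at a.
  obtain ⟨a, ha⟩ : ∃ a : K, (Polynomial.X * ((transMatrix w b F h).det *
      ∑ j, (transMatrix w b F h).adjugate i j * transCoeff w b F h j A)).eval a ≠ 0 := by
    by_contra! h0
    exact mul_ne_zero Polynomial.X_ne_zero (mul_ne_zero hdet hA)
      (Polynomial.funext fun a => by rw [h0, Polynomial.eval_zero])
  rw [Polynomial.eval_mul, Polynomial.eval_mul, Polynomial.eval_X] at ha
  have ha0 : a ≠ 0 := left_ne_zero_of_mul ha
  have hd := left_ne_zero_of_mul (right_ne_zero_of_mul ha)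
  have hs := right_ne_zero_of_mul (right_ne_zero_of_mul ha)
  refine hgen (h * oneParamGL w a ha0) _ (fun j => ?_) ?_
  · by_cases hj : j = i
    · subst hj
      rw [Function.update_self, hAm]
    · rw [Function.update_of_ne hj, hred.degree_eq]
  rw [← gradedPiece_translate, translate_mul, gradedPiece_translate,
    hred.gradedPiece_translate_eq ha0]
  rintro _ ⟨y, hy, rfl⟩ h0
  have hdata := hred.isGraphData.map (Polynomial.evalRingHom a)
  let Y : Fin r → K := fun k => coeff (b k) y.1
  have hsec : ∀ k, coeffMap (Polynomial.evalRingHom a) (graphSection m (familyCoeff w b F) k) =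
      graphSection m (fun i A => Polynomial.evalRingHom a (familyCoeff w b F i A)) k := by
    intro k
    refine Forms.ext_coeff fun B => ?_
    rw [coeff_coeffMap, hred.isGraphData.coeff_graphSection, hdata.coeff_graphSection]
  have hcoeff : ∀ B, coeff B (glAct m h y).1 =
      ∑ k, Y k * (transCoeff w b F h k B).eval a := by
    intro B
    conv_lhs => rw [hdata.eq_sum hy]
    rw [map_sum, Forms.coeff_sum]
    refine Finset.sum_congr rfl fun k _ => ?_
    rw [map_smul, Forms.coeff_smul, eval_transCoeff, hsec, glAct_apply]
  let p := (transMatrix w b F h).map (Polynomial.evalRingHom a)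
  have hp : ∀ i j, p i j = (transCoeff w b F h i (b j)).eval a := fun _ _ => rfl
  have hpdet : p.det = (transMatrix w b F h).det.eval a :=
    (RingHom.map_det (Polynomial.evalRingHom a) (transMatrix w b F h)).symm
  have hpadj : ∀ k l, p.adjugate k l = ((transMatrix w b F h).adjugate k l).eval a := by
    intro k l
    have := RingHom.map_adjugate (Polynomial.evalRingHom a) (transMatrix w b F h)
    exact (congrFun (congrFun this k) l).symm
  let z : K := Matrix.vecMul Y p i
  have hvec : Matrix.vecMul Y p = Pi.single i z := by
    funext j
    by_cases hj : j = i
    · subst hj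
      rw [Pi.single_eq_same]
    · rw [Pi.single_eq_of_ne hj]
      have := h0 j
      rw [Function.update_of_ne hj] at this
      exact (hcoeff (b j)).symm.trans this
  -- All entries of Yp except the i-th vanish, so det p · Y is z times the i-th row of the adjugate.
  -- The vanishing coefficient at A then reads z times a nonzero sum.
  have hYdet : ∀ k, p.det * Y k = z * p.adjugate i k := by
    intro k
    have h1 : Matrix.vecMul (Matrix.vecMul Y p) p.adjugate k = p.det * Y k := by
      rw [Matrix.vecMul_vecMul, Matrix.mul_adjugate, Matrix.vecMul_smul, Matrix.vecMul_one]
      rfl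
    rw [← h1, hvec, Matrix.single_vecMul]
    rfl
  have hz : z = 0 := by
    have h1 := h0 i
    rw [Function.update_self] at h1
    have h2 : ∑ k, Y k * (transCoeff w b F h k A).eval a = 0 := (hcoeff A).symm.trans h1
    have h3 : z * ∑ j, p.adjugate i j * (transCoeff w b F h j A).eval a = 0 := by
      rw [Finset.mul_sum]
      have : ∀ j, z * (p.adjugate i j * (transCoeff w b F h j A).eval a) =
          p.det * (Y j * (transCoeff w b F h j A).eval a) := by
        intro j
        rw [← mul_assoc, ← hYdet, mul_assoc]
      rw [Finset.sum_congr rfl fun j _ => this j, ← Finset.mul_sum, h2, mul_zero]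
    refine (mul_eq_zero.1 h3).resolve_right ?_
    rw [Polynomial.eval_finsetSum] at hs
    simpa only [hpadj, Polynomial.eval_mul] using hs
  have hY : ∀ k, Y k = 0 := by
    intro k
    have := hYdet k
    rw [hz, zero_mul, hpdet] at this
    exact (mul_eq_zero.1 this).resolve_left hd
  have hy0 : y = 0 := by
    rw [hdata.eq_sum hy]
    exact Finset.sum_eq_zero fun k _ => by rw [show coeff (b k) y.1 = 0 from hY k, zero_smul]
  rw [hy0]
  exact map_zero (glAct m h)

theorem IsReduced.b_injective {W : Submodule K (Forms K n m)} (hred : IsReduced w W b F) :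
    Function.Injective b := by
  intro i j hij
  by_contra hne
  have h1 := hred.coeff_eq i j
  rw [if_neg hne, ← hij, hred.coeff_eq, if_pos rfl] at h1
  exact one_ne_zero h1

/-- The leading monomials have greater weight than the other monomials of the reduced basis. -/
def StrictlyReduced (w : Fin (n + 1) → ℤ) (b : Fin r → (Fin (n + 1) →₀ ℕ))
    (F : Fin r → Forms K n m) : Prop :=
  ∀ i A, coeff A (F i).1 ≠ 0 → A ≠ b i → wt w A < wt w (b i)

theorem IsReduced.eval_zero_familyCoeff {W : Submodule K (Forms K n m)}
    (hred : IsReduced w W b F) (hlt : StrictlyReduced w b F) (i : Fin r)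
    (A : Fin (n + 1) →₀ ℕ) : (familyCoeff w b F i A).eval 0 = if A = b i then 1 else 0 := by
  split_ifs with h
  · rw [h, hred.isGraphData.apply_eq, if_pos rfl, Polynomial.eval_one]
  · rw [familyCoeff, Polynomial.eval_mul, Polynomial.eval_C, Polynomial.eval_pow,
      Polynomial.eval_X]
    by_cases h0 : coeff A (F i).1 = 0
    · rw [h0, zero_mul]
    · have := hlt i A h0 h
      rw [zero_pow (by omega), mul_zero]

/-- The limit is spanned by the leading monomials. -/
theorem IsReduced.mem_fibre_zero_iff {W : Submodule K (Forms K n m)}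
    (hred : IsReduced w W b F) (hlt : StrictlyReduced w b F) {v : Forms K n m} :
    v ∈ fibre (graphForms b (familyCoeff w b F) : Submodule K[X] (Forms K[X] n m)) 0 ↔
      ∀ A, A ∉ Set.range b → coeff A v.1 = 0 := by
  rw [hred.isGraphData.fibre_eq, mem_graphForms]
  simp only [hred.eval_zero_familyCoeff hlt]
  constructor
  · intro h A hA
    rw [h A]
    refine Finset.sum_eq_zero fun i _ => ?_
    rw [if_neg fun h => hA ⟨i, h.symm⟩, mul_zero]
  · intro h A
    by_cases hA : A ∈ Set.range b
    · obtain ⟨i, rfl⟩ := hA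
      rw [Finset.sum_eq_single i]
      · simp
      · intro j _ hj
        rw [if_neg fun h => hj (hred.b_injective h).symm, mul_zero]
      · simp
    · rw [h A hA]
      refine (Finset.sum_eq_zero fun i _ => ?_).symm
      rw [if_neg fun h => hA ⟨i, h.symm⟩, mul_zero]

theorem IsReduced.eval_zero_transCoeff {W : Submodule K (Forms K n m)}
    (hred : IsReduced w W b F) (hlt : StrictlyReduced w b F) (h : GL (Fin (n + 1)) K) (i : Fin r)
    (A : Fin (n + 1) →₀ ℕ) : (transCoeff w b F h i A).eval 0 =
      coeff A (linSubst (h : Matrix (Fin (n + 1)) (Fin (n + 1)) K) (monomial (b i) 1)) := by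
  rw [eval_transCoeff]
  congr 3
  ext B
  rw [coeff_coeffMap, hred.isGraphData.coeff_graphSection, Polynomial.coe_evalRingHom,
    hred.eval_zero_familyCoeff hlt, coeff_monomial]
  simp only [eq_comm]

/-- The matrix of an upper triangular matrix on the limit. -/
def limitMatrix (b : Fin r → (Fin (n + 1) →₀ ℕ)) (h : GL (Fin (n + 1)) K) :
    Matrix (Fin r) (Fin r) K :=
  Matrix.of fun i j =>
    coeff (b j) (linSubst (h : Matrix (Fin (n + 1)) (Fin (n + 1)) K) (monomial (b i) 1))

theorem map_transMatrix_eq_limitMatrix {W : Submodule K (Forms K n m)}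
    (hred : IsReduced w W b F) (hlt : StrictlyReduced w b F) (h : GL (Fin (n + 1)) K) :
    (transMatrix w b F h).map (Polynomial.evalRingHom 0) = limitMatrix b h := by
  ext i j
  exact hred.eval_zero_transCoeff hlt h i (b j)

/-- If the translates of the sections of the family have coefficients `t^k s_j` at `x^A`, then the
solution of a linear system with right hand side `s_j(0)` is supported on the `i` such that `x^A`
occurs in the `i`-th element of the reduced basis. -/
theorem coeff_ne_zero_of_limitMatrix_adjugate [Infinite K] (hgen : IsGeneric r (gradedPiece J m))
    (hred : IsReduced w (gradedPiece J m) b F) (hlt : StrictlyReduced w b F)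
    {h : GL (Fin (n + 1)) K} (hd : (limitMatrix b h).det ≠ 0) {A : Fin (n + 1) →₀ ℕ} {k : ℕ}
    {s : Fin r → K[X]} (hs : ∀ j, transCoeff w b F h j A = Polynomial.X ^ k * s j) {i : Fin r}
    (hi : (limitMatrix b h).adjugate.mulVec (fun j => (s j).eval 0) i ≠ 0) :
    coeff A (F i).1 ≠ 0 := by
  have hmap := map_transMatrix_eq_limitMatrix hred hlt h
  have hdet : (transMatrix w b F h).det ≠ 0 := by
    intro h0
    rw [← hmap, ← RingHom.mapMatrix_apply, ← RingHom.map_det, h0, map_zero] at hd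
    exact hd rfl
  refine coeff_ne_zero_of_adjugate_ne_zero hgen hred h hdet (i := i) ?_
  intro h0
  -- The common power of t is cancelled before setting t = 0, so the exchange argument sees the
  -- leading coefficients s_j(0).
  have h1 : Polynomial.X ^ k * ∑ j, (transMatrix w b F h).adjugate i j * s j = 0 := by
    rw [← h0, Finset.mul_sum]
    refine Finset.sum_congr rfl fun j _ => ?_
    rw [hs]
    ring
  have h2 := (mul_eq_zero.1 h1).resolve_left (pow_ne_zero _ Polynomial.X_ne_zero)
  apply hi
  have h3 := congrArg (Polynomial.eval 0) h2
  rw [Polynomial.eval_finsetSum, Polynomial.eval_zero] at h3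
  rw [← hmap, ← RingHom.mapMatrix_apply, ← RingHom.map_adjugate, Matrix.mulVec, dotProduct]
  refine Eq.trans ?_ h3
  refine Finset.sum_congr rfl fun j _ => ?_
  rw [Polynomial.eval_mul]
  rfl

theorem mulVec_adjugate_mulVec {p : Matrix (Fin r) (Fin r) K} (q : Fin r → K) :
    p.mulVec (p.adjugate.mulVec q) = p.det • q := by
  rw [Matrix.mulVec_mulVec, Matrix.mul_adjugate, Matrix.smul_mulVec, Matrix.one_mulVec]

theorem limitMatrix_triangular (hw : StrictAnti w) {W : Submodule K (Forms K n m)}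
    (hred : IsReduced w W b F) {h : GL (Fin (n + 1)) K} (hh : IsUpperTri h) (i j : Fin r)
    (hij : limitMatrix b h i j ≠ 0) : i = j ∨ wt w (b i) < wt w (b j) := by
  obtain h1 | h1 := (hasLowest_linSubst_monomial hw hh (b i)).2 (b j) hij
  · exact Or.inl (hred.b_injective h1).symm
  · exact Or.inr h1

theorem limitMatrix_apply_self (hw : StrictAnti w) {h : GL (Fin (n + 1)) K} (hh : IsUpperTri h)
    (i : Fin r) : limitMatrix b h i i =
      diagChar (h : Matrix (Fin (n + 1)) (Fin (n + 1)) K) (b i) :=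
  (hasLowest_linSubst_monomial hw hh (b i)).1

theorem det_limitMatrix_ne_zero (hw : StrictAnti w) {W : Submodule K (Forms K n m)}
    (hred : IsReduced w W b F) {h : GL (Fin (n + 1)) K} (hh : IsUpperTri h) :
    (limitMatrix b h).det ≠ 0 :=
  det_ne_zero_of_triangular (limitMatrix_triangular hw hred hh) fun i => by
    rw [limitMatrix_apply_self hw hh]
    exact diagChar_ne_zero hh _

theorem adjugate_limitMatrix_support [Infinite K] (hgen : IsGeneric r (gradedPiece J m))
    (hred : IsReduced w (gradedPiece J m) b F) (hlt : StrictlyReduced w b F)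
    {h : GL (Fin (n + 1)) K} (hd : (limitMatrix b h).det ≠ 0) {A : Fin (n + 1) →₀ ℕ} {i : Fin r}
    (hi : (limitMatrix b h).adjugate.mulVec (fun j => coeff A
      (linSubst (h : Matrix (Fin (n + 1)) (Fin (n + 1)) K) (monomial (b j) 1))) i ≠ 0) :
    coeff A (F i).1 ≠ 0 := by
  refine coeff_ne_zero_of_limitMatrix_adjugate hgen hred hlt hd (k := 0)
    (s := fun j => transCoeff w b F h j A) (fun j => by rw [pow_zero, one_mul]) ?_
  simpa only [hred.eval_zero_transCoeff hlt] using hi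

/-- The exchange argument gives w·A < w·b_i on the support of the Cramer solution. At its heaviest
index, x^A would occur in h x^{b_i}, which needs w·A > w·b_i since A is not b_i. So the solution is
zero, and with it the right hand side. -/
theorem coeff_linSubst_monomial_eq_zero [Infinite K] (hw : StrictAnti w)
    (hgen : IsGeneric r (gradedPiece J m)) (hred : IsReduced w (gradedPiece J m) b F)
    (hlt : StrictlyReduced w b F) {h : GL (Fin (n + 1)) K} (hh : IsUpperTri h)
    {A : Fin (n + 1) →₀ ℕ} (hA : A ∉ Set.range b) (j : Fin r) : coeff A
      (linSubst (h : Matrix (Fin (n + 1)) (Fin (n + 1)) K) (monomial (b j) 1)) = 0 := by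
  have hd := det_limitMatrix_ne_zero hw hred hh
  let q : Fin r → K := fun j =>
    coeff A (linSubst (h : Matrix (Fin (n + 1)) (Fin (n + 1)) K) (monomial (b j) 1))
  have hpY := mulVec_adjugate_mulVec (p := limitMatrix b h) q
  have hY : (limitMatrix b h).adjugate.mulVec q = 0 := by
    by_contra hY
    obtain ⟨i, hi, hpi⟩ := exists_mulVec_eq_of_triangular (limitMatrix_triangular hw hred hh) hY
    have h1 := hlt i A (adjugate_limitMatrix_support hgen hred hlt hd hi) fun h => hA ⟨i, h.symm⟩
    rw [hpY, limitMatrix_apply_self hw hh, Pi.smul_apply, smul_eq_mul] at hpi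
    have h2 : q i ≠ 0 := right_ne_zero_of_mul
      (hpi.trans_ne (mul_ne_zero (diagChar_ne_zero hh _) hi))
    obtain h3 | h3 := (hasLowest_linSubst_monomial hw hh (b i)).2 A h2
    · exact hA ⟨i, h3.symm⟩
    · exact absurd h1 h3.not_gt
  rw [hY, Matrix.mulVec_zero] at hpY
  exact (mul_eq_zero.1 (congrFun hpY.symm j)).resolve_left hd

theorem map_eq_of_map_le {E : Type*} [AddCommGroup E] [Module K E] [FiniteDimensional K E]
    {V : Submodule K E} (e : E ≃ₗ[K] E) (h : V.map e.toLinearMap ≤ V) :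
    V.map e.toLinearMap = V :=
  Submodule.eq_of_le_of_finrank_eq h (LinearEquiv.finrank_map_eq e V)

theorem eq_sum_smul_of_coeff_eq_zero (hb : Function.Injective b) {p : MvPolynomial (Fin (n + 1)) K}
    (hp : ∀ A, A ∉ Set.range b → coeff A p = 0) :
    p = ∑ i, coeff (b i) p • monomial (b i) 1 := by
  ext A
  rw [coeff_sum]
  simp only [coeff_smul, coeff_monomial, smul_eq_mul, mul_ite, mul_one, mul_zero]
  by_cases hA : A ∈ Set.range b
  · obtain ⟨i, rfl⟩ := hA
    rw [Finset.sum_eq_single i]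
    · simp
    · intro j _ hj
      rw [if_neg fun h => hj (hb h)]
    · simp
  · rw [hp A hA]
    refine (Finset.sum_eq_zero fun i _ => ?_).symm
    rw [if_neg fun h => hA ⟨i, h⟩]

/-- The limit of a generic translate is fixed by the Borel group. -/
theorem borelFixed_fibre_zero [Infinite K] (hw : StrictAnti w)
    (hgen : IsGeneric r (gradedPiece J m)) (hred : IsReduced w (gradedPiece J m) b F)
    (hlt : StrictlyReduced w b F) :
    BorelFixed (fibre (graphForms b (familyCoeff w b F) :
      Submodule K[X] (Forms K[X] n m)) 0) := by
  intro h hh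
  have hfin : FiniteDimensional K (Forms K n m) := Module.Finite.equiv (formsEquiv K n m).symm
  refine map_eq_of_map_le _ ?_
  rintro _ ⟨v, hv, rfl⟩
  have hv' := (hred.mem_fibre_zero_iff hlt).1 hv
  rw [hred.mem_fibre_zero_iff hlt]
  intro A hA
  have h1 : coeff A (linSubst (h : Matrix (Fin (n + 1)) (Fin (n + 1)) K) v.1) = 0 := by
    rw [eq_sum_smul_of_coeff_eq_zero hred.b_injective hv', map_sum, coeff_sum]
    refine Finset.sum_eq_zero fun i _ => ?_
    rw [map_smul, coeff_smul, coeff_linSubst_monomial_eq_zero hw hgen hred hlt hh hA, smul_zero]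
  exact h1

end Borel

/-! ### The limit of a generic translate differs from the translate -/

section NonInvariance

variable {n m r : ℕ}

/-- Natural number coefficients cannot cancel; casting carries positivity to nonvanishing in
characteristic 0. -/
theorem coeff_sum_X_pow_pos (m : ℕ) (A : Fin (n + 1) →₀ ℕ) (hA : A.degree = m) :
    0 < coeff A ((∑ j, X j : MvPolynomial (Fin (n + 1)) ℕ) ^ m) := by
  induction m generalizing A with
  | zero =>
    rw [Finsupp.degree_eq_zero_iff] at hA
    simp [hA]
  | succ m ih =>
    have hA0 : A ≠ 0 := by
      rintro rfl
      simp at hA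
    obtain ⟨i, hi⟩ := Finsupp.ne_iff.1 hA0
    have hle : Finsupp.single i 1 ≤ A := by
      rw [Finsupp.single_le_iff]
      exact Nat.one_le_iff_ne_zero.2 hi
    obtain ⟨B, rfl⟩ := exists_add_of_le hle
    rw [pow_succ, Finset.mul_sum, coeff_sum]
    refine Finset.sum_pos' (fun _ _ => Nat.zero_le _) ⟨i, Finset.mem_univ i, ?_⟩
    rw [add_comm (Finsupp.single i 1) B, coeff_mul_X]
    refine ih B ?_
    rw [map_add, Finsupp.degree_single] at hA
    omega

variable {K : Type*} [Field K]

theorem coeff_sum_X_pow_ne_zero [CharZero K] {A : Fin (n + 1) →₀ ℕ} (hA : A.degree = m) :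
    coeff A ((∑ j, X j : MvPolynomial (Fin (n + 1)) K) ^ m) ≠ 0 := by
  have h := coeff_map (Nat.castRingHom K) ((∑ j, X j : MvPolynomial (Fin (n + 1)) ℕ) ^ m) A
  rw [map_pow, map_sum] at h
  simp only [map_X] at h
  rw [h]
  exact Nat.cast_ne_zero.2 (coeff_sum_X_pow_pos m A hA).ne'

/-- In characteristic zero, every monomial occurs in the generic translate of a monomial. -/
theorem coeff_linSubst_mvPolynomialX_monomial_ne_zero [CharZero K] {A B : Fin (n + 1) →₀ ℕ}
    (hAB : A.degree = B.degree) :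
    coeff A (linSubst (Matrix.mvPolynomialX (Fin (n + 1)) (Fin (n + 1)) K)
      (MvPolynomial.map C (monomial B (1 : K)))) ≠ 0 := by
  intro h0
  -- With all matrix entries equal to 1, every variable goes to the sum of the variables. This
  -- matrix is not invertible for n > 0, but only nonvanishing of a polynomial is at stake.
  have h1 := congrArg (MvPolynomial.eval fun _ => (1 : K)) h0
  have e2 : (MvPolynomial.eval fun _ : Fin (n + 1) × Fin (n + 1) => (1 : K)).comp C =
      RingHom.id K := by
    ext x
    simp
  rw [← coeff_map, map_linSubst, MvPolynomial.map_map, e2, MvPolynomial.map_id, map_zero,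
    linSubst, aeval_monomial, map_one, one_mul, Finsupp.prod] at h1
  simp only [Matrix.map_apply, Matrix.mvPolynomialX_apply, eval_X, C_1, one_mul] at h1
  rw [Finset.prod_pow_eq_pow_sum, ← Finsupp.degree_apply] at h1
  exact coeff_sum_X_pow_ne_zero hAB h1

variable {w : Fin (n + 1) → ℤ} {J : Ideal (MvPolynomial (Fin (n + 1)) K)}
  {b : Fin r → (Fin (n + 1) →₀ ℕ)} {F : Fin r → Forms K n m}

/-- The reduced basis of a generic space of forms does not consist of monomials. -/
theorem exists_coeff_ne_zero [CharZero K] (hgen : IsGeneric r (gradedPiece J m))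
    (hred : IsReduced w (gradedPiece J m) b F) (hlt : StrictlyReduced w b F) (i₀ : Fin r)
    {A₀ : Fin (n + 1) →₀ ℕ} (hm : A₀.degree = m) (hA₀ : A₀ ∉ Set.range b) :
    ∃ i A, coeff A (F i).1 ≠ 0 ∧ A ≠ b i := by
  by_contra! hF
  let p₁ := stateCoeff (fun i => monomial (b i) (1 : K)) b
  have hp₁ : p₁ ≠ 0 := by
    intro h0
    have h1 := evalMatrix_stateCoeff 1 (fun i => monomial (b i) (1 : K)) b
    rw [show stateCoeff (fun i => monomial (b i) (1 : K)) b = 0 from h0, evalMatrix, map_zero] at h1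
    have h2 : (Matrix.of fun i j => coeff (b j)
        (linSubst ((1 : GL (Fin (n + 1)) K) : Matrix (Fin (n + 1)) (Fin (n + 1)) K)
          (monomial (b i) (1 : K)))) = 1 := by
      ext i j
      rw [Matrix.of_apply, Units.val_one, linSubst_one, coeff_monomial, Matrix.one_apply]
      simp only [hred.b_injective.eq_iff]
    rw [h2, Matrix.det_one] at h1
    exact zero_ne_one h1
  -- A generic h keeps b a state of the monomial span and makes x^{A₀} occur in h x^{b_{i₀}}.
  obtain ⟨h, hh⟩ := exists_evalMatrix_ne_zero (mul_ne_zero hp₁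
    (coeff_linSubst_mvPolynomialX_monomial_ne_zero (K := K) (hm.trans (hred.degree_eq i₀).symm)))
  rw [evalMatrix, map_mul] at hh
  have hd : (limitMatrix b h).det ≠ 0 := by
    have := left_ne_zero_of_mul hh
    rw [← evalMatrix, evalMatrix_stateCoeff] at this
    exact this
  have hc := right_ne_zero_of_mul hh
  rw [← evalMatrix, eval_coeff_linSubst_mvPolynomialX] at hc
  have hpY := mulVec_adjugate_mulVec (p := limitMatrix b h) fun j => coeff A₀
    (linSubst (h : Matrix (Fin (n + 1)) (Fin (n + 1)) K) (monomial (b j) 1))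
  -- If each F_i were a monomial, x^{A₀} would occur in none of them and the exchange argument would
  -- force the Cramer solution to vanish.
  have hY : (limitMatrix b h).adjugate.mulVec (fun j => coeff A₀
      (linSubst (h : Matrix (Fin (n + 1)) (Fin (n + 1)) K) (monomial (b j) 1))) = 0 := by
    funext i
    by_contra hi
    exact hA₀ ⟨i, (hF i A₀ (adjugate_limitMatrix_support hgen hred hlt hd hi)).symm⟩
  rw [hY, Matrix.mulVec_zero] at hpY
  exact mul_ne_zero hd hc (congrFun hpY i₀).symm

/-- Regularity propagates vanishing from degree m upwards; multiplication by x_0^m, which is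
injective, brings it back to the lower degrees. -/
theorem eq_bot_of_gradedPiece_eq_bot {I : Ideal (MvPolynomial (Fin (n + 1)) K)}
    (hI : IsHomogeneousIdeal I) (hm : IsRegular m I) (h : gradedPiece I m = ⊥) : I = ⊥ := by
  refine (Submodule.eq_bot_iff _).2 fun p hp => ?_
  have h1 : ∀ d ≥ m, ∀ q : Forms K n d, q.1 ∈ I → q.1 = 0 := by
    intro d hd q hq
    have h2 : q ∈ gradedPiece I d := hq
    rw [← hm.gradedPiece_span hd, h, mem_gradedPiece] at h2
    have h3 : (fun p : Forms K n m => p.1) '' ((⊥ : Submodule K (Forms K n m)) : Set _) =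
        {0} := by
      rw [Submodule.bot_coe, Set.image_singleton]
      rfl
    rw [h3, Ideal.span_singleton_eq_bot.2 rfl] at h2
    exact h2
  rw [← sum_homogeneousComponent p]
  refine Finset.sum_eq_zero fun d _ => ?_
  have h2 := h1 (m + d) (by omega) ⟨X 0 ^ m * homogeneousComponent d p,
    (mem_homogeneousSubmodule _ _).2 (((isHomogeneous_X_pow _ _)).mul
      (homogeneousComponent_isHomogeneous d p))⟩ (I.mul_mem_left _ (hI p hp d))
  exact (mul_eq_zero.1 h2).resolve_left (pow_ne_zero _ (X_ne_zero 0))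

theorem eq_top_of_gradedPiece_eq_top {I : Ideal (MvPolynomial (Fin (n + 1)) K)}
    (hI : IsSaturatedIdeal I) (h : gradedPiece I m = ⊤) : I = ⊤ := by
  rw [Ideal.eq_top_iff_one]
  refine hI.2 1 fun i => ⟨m, ?_⟩
  have h1 : (⟨X i ^ m, (mem_homogeneousSubmodule _ _).2 (isHomogeneous_X_pow _ _)⟩ :
      Forms K n m) ∈ gradedPiece I m := by
    rw [h]
    trivial
  rw [mul_one]
  exact h1

theorem eq_bot_of_finrank_eq_zero {E : Type*} [AddCommGroup E] [Module K E]
    {V : Submodule K E} [Module.Finite K V] (h : Module.finrank K V = 0) : V = ⊥ :=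
  Submodule.finrank_eq_zero.1 h

theorem eq_top_of_finrank_eq_finrank {E : Type*} [AddCommGroup E] [Module K E] [Module.Finite K E]
    {V : Submodule K E} (h : Module.finrank K V = Module.finrank K E) : V = ⊤ :=
  Submodule.eq_top_of_finrank_eq h

theorem exists_notMem_range {I : Ideal (MvPolynomial (Fin (n + 1)) K)}
    (hI : IsSaturatedIdeal I) (htop : I ≠ ⊤) (hr : Module.finrank K (gradedPiece I m) = r)
    {b : Fin r → (Fin (n + 1) →₀ ℕ)} (hinj : Function.Injective b)
    (hb : ∀ i, (b i).degree = m) :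
    ∃ A : Fin (n + 1) →₀ ℕ, A.degree = m ∧ A ∉ Set.range b := by
  by_contra! h
  refine htop (eq_top_of_gradedPiece_eq_top (m := m) hI (eq_top_of_finrank_eq_finrank ?_))
  have h1 : Finset.univ.image b = Exps n m := by
    ext A
    rw [mem_exps, Finset.mem_image]
    constructor
    · rintro ⟨i, -, rfl⟩
      exact hb i
    · intro hA
      obtain ⟨i, hi⟩ := h A hA
      exact ⟨i, Finset.mem_univ i, hi⟩
  rw [hr, finrank_forms, ← card_exps, ← h1, Finset.card_image_of_injective _ hinj,
    Finset.card_univ, Fintype.card_fin]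

end NonInvariance

/-! ### The tangent vector -/

section Tangent

variable {K : Type*} [Field K] {n m r : ℕ} {w : Fin (n + 1) → ℤ} {W : Submodule K (Forms K n m)}
  {b : Fin r → (Fin (n + 1) →₀ ℕ)} {F : Fin r → Forms K n m} {k : ℕ}

/-- `k` is the least difference between the weight of a leading monomial and of another monomial
of the reduced basis. -/
structure IsGap (w : Fin (n + 1) → ℤ) (b : Fin r → (Fin (n + 1) →₀ ℕ)) (F : Fin r → Forms K n m)
    (k : ℕ) : Prop where
  pos : 0 < k
  wt_add_le : ∀ i A, coeff A (F i).1 ≠ 0 → A ≠ b i → wt w A + k ≤ wt w (b i)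
  exists_eq : ∃ i A, coeff A (F i).1 ≠ 0 ∧ wt w A + k = wt w (b i)

theorem exists_isGap (hlt : StrictlyReduced w b F)
    (h : ∃ i A, coeff A (F i).1 ≠ 0 ∧ A ≠ b i) : ∃ k, IsGap w b F k := by
  classical
  have hex : ∃ k : ℕ, ∃ i A, (coeff A (F i).1 ≠ 0 ∧ A ≠ b i) ∧ wt w A + k = wt w (b i) := by
    obtain ⟨i, A, hA, hne⟩ := h
    have := hlt i A hA hne
    exact ⟨(wt w (b i) - wt w A).toNat, i, A, ⟨hA, hne⟩, by omega⟩
  obtain ⟨i, A, ⟨hA, hne⟩, hk⟩ := Nat.find_spec hex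
  refine ⟨Nat.find hex, ⟨?_, fun j B hB hBne => ?_, ⟨i, A, hA, hk⟩⟩⟩
  · have := hlt i A hA hne
    omega
  · have h1 := hlt j B hB hBne
    have h2 := Nat.find_min' hex (m := (wt w (b j) - wt w B).toNat)
      ⟨j, B, ⟨hB, hBne⟩, by omega⟩
    omega

/-- The coefficients of the derivative of the family. -/
def gapCoeff (w : Fin (n + 1) → ℤ) (b : Fin r → (Fin (n + 1) →₀ ℕ)) (F : Fin r → Forms K n m)
    (k : ℕ) (i : Fin r) (A : Fin (n + 1) →₀ ℕ) : K :=
  if wt w A + k = wt w (b i) then coeff A (F i).1 else 0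

theorem wt_add_eq_of_gapCoeff_ne_zero {i : Fin r} {A : Fin (n + 1) →₀ ℕ}
    (h : gapCoeff w b F k i A ≠ 0) : wt w A + k = wt w (b i) := by
  by_contra h0
  exact h (if_neg h0)

theorem degree_eq_of_gapCoeff_ne_zero {i : Fin r} {A : Fin (n + 1) →₀ ℕ}
    (h : gapCoeff w b F k i A ≠ 0) : A.degree = m := by
  by_contra h0
  refine h ?_
  rw [gapCoeff, Forms.coeff_eq_zero _ h0, ite_self]

theorem coeff_ne_zero_of_gapCoeff_ne_zero {i : Fin r} {A : Fin (n + 1) →₀ ℕ}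
    (h : gapCoeff w b F k i A ≠ 0) : coeff A (F i).1 ≠ 0 := by
  intro h0
  refine h ?_
  rw [gapCoeff, h0, ite_self]

theorem IsGap.exists_gapCoeff_ne_zero (hk : IsGap w b F k) : ∃ i A, gapCoeff w b F k i A ≠ 0 := by
  obtain ⟨i, A, hA, h⟩ := hk.exists_eq
  refine ⟨i, A, ?_⟩
  rwa [gapCoeff, if_pos h]

theorem IsGap.notMem_range (hk : IsGap w b F k) (hred : IsReduced w W b F) {i : Fin r}
    {A : Fin (n + 1) →₀ ℕ} (h : gapCoeff w b F k i A ≠ 0) : A ∉ Set.range b := by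
  rintro ⟨j, rfl⟩
  have h1 := coeff_ne_zero_of_gapCoeff_ne_zero h
  have h2 := wt_add_eq_of_gapCoeff_ne_zero h
  rw [hred.coeff_eq] at h1
  have h3 : i = j := by
    by_contra h3
    exact h1 (if_neg h3)
  subst h3
  have := hk.pos
  omega

/-- The forms with the coefficients of the derivative of the family. -/
def gapForm (w : Fin (n + 1) → ℤ) (b : Fin r → (Fin (n + 1) →₀ ℕ)) (F : Fin r → Forms K n m)
    (k : ℕ) (i : Fin r) : Forms K n m :=
  graphSection m (gapCoeff w b F k) i

theorem coeff_gapForm (i : Fin r) (A : Fin (n + 1) →₀ ℕ) :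
    coeff A (gapForm w b F k i).1 = gapCoeff w b F k i A :=
  coeff_formsEquiv_symm _ (fun _ h => degree_eq_of_gapCoeff_ne_zero h) A

/-- The remainder of the expansion of the family. -/
def tailCoeff (w : Fin (n + 1) → ℤ) (b : Fin r → (Fin (n + 1) →₀ ℕ)) (F : Fin r → Forms K n m)
    (k : ℕ) (i : Fin r) (A : Fin (n + 1) →₀ ℕ) : K[X] :=
  if wt w A + k < wt w (b i) then
    Polynomial.C (coeff A (F i).1) * Polynomial.X ^ (wt w (b i) - wt w A - k - 1).toNat
  else 0

/-- The forms with the coefficients of the remainder of the expansion of the family. -/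
def tailForm (w : Fin (n + 1) → ℤ) (b : Fin r → (Fin (n + 1) →₀ ℕ)) (F : Fin r → Forms K n m)
    (k : ℕ) (i : Fin r) : Forms K[X] n m :=
  graphSection m (tailCoeff w b F k) i

theorem coeff_tailForm (i : Fin r) (A : Fin (n + 1) →₀ ℕ) :
    coeff A (tailForm w b F k i).1 = tailCoeff w b F k i A := by
  refine coeff_formsEquiv_symm _ (fun B hB => ?_) A
  by_contra h0
  refine hB ?_
  rw [tailCoeff, Forms.coeff_eq_zero _ h0, map_zero, zero_mul, ite_self]

/-- The monomials of F_i are sorted by their weight gap to b_i: zero only for b_i itself, k for the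
derivative, and anything larger goes to the tail with k + 1 subtracted from its exponent. -/
theorem IsGap.familyCoeff_eq (hk : IsGap w b F k) (hred : IsReduced w W b F) (i : Fin r)
    (A : Fin (n + 1) →₀ ℕ) :
    familyCoeff w b F i A = Polynomial.C (if b i = A then 1 else 0) +
      Polynomial.X ^ k * Polynomial.C (gapCoeff w b F k i A) +
        Polynomial.X ^ (k + 1) * tailCoeff w b F k i A := by
  have hpos := hk.pos
  by_cases hA : b i = A
  · subst hA
    rw [hred.isGraphData.apply_eq, gapCoeff, tailCoeff, if_pos rfl, if_pos rfl,
      if_neg (by omega), if_neg (by omega)]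
    simp
  · rw [if_neg hA, familyCoeff, gapCoeff, tailCoeff]
    by_cases h0 : coeff A (F i).1 = 0
    · simp [h0]
    · have h1 := hk.wt_add_le i A h0 (Ne.symm hA)
      obtain h2 | h2 := h1.eq_or_lt
      · rw [if_pos h2, if_neg (by omega), show (wt w (b i) - wt w A).toNat = k by omega]
        rw [map_zero, zero_add, mul_zero, add_zero, mul_comm]
      · rw [if_neg (by omega), if_pos h2, show (wt w (b i) - wt w A).toNat =
          k + 1 + (wt w (b i) - wt w A - k - 1).toNat by omega, pow_add]
        simp only [map_zero, mul_zero, zero_add]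
        ring

theorem coeff_monoForm {A : Fin (n + 1) →₀ ℕ} (hA : A.degree = m) (B : Fin (n + 1) →₀ ℕ) :
    coeff B (monoForm K A hA).1 = if A = B then 1 else 0 :=
  coeff_monomial _ _ _

theorem IsGap.graphSection_eq (hk : IsGap w b F k) (hred : IsReduced w W b F) (i : Fin r) :
    graphSection m (familyCoeff w b F) i =
      coeffMap Polynomial.C (monoForm K (b i) (hred.degree_eq i)) +
        (Polynomial.X ^ k : K[X]) • coeffMap Polynomial.C (gapForm w b F k i) +
          (Polynomial.X ^ (k + 1) : K[X]) • tailForm w b F k i := by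
  refine Forms.ext_coeff fun A => ?_
  rw [hred.isGraphData.coeff_graphSection, hk.familyCoeff_eq hred, Forms.coeff_add,
    Forms.coeff_add, Forms.coeff_smul, Forms.coeff_smul, coeff_coeffMap, coeff_coeffMap,
    coeff_gapForm, coeff_tailForm, coeff_monoForm]

/-- The linear map sending the leading monomials to the derivative of the family. -/
def gapMap (w : Fin (n + 1) → ℤ) (b : Fin r → (Fin (n + 1) →₀ ℕ)) (F : Fin r → Forms K n m)
    (k : ℕ) : Forms K n m →ₗ[K] Forms K n m :=
  ∑ i, (coeffForm (b i)).smulRight (gapForm w b F k i)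

theorem gapMap_apply (v : Forms K n m) :
    gapMap w b F k v = ∑ i, coeff (b i) v.1 • gapForm w b F k i := by
  rw [gapMap, LinearMap.sum_apply]
  rfl

theorem coeff_gapMap (v : Forms K n m) (A : Fin (n + 1) →₀ ℕ) :
    coeff A (gapMap w b F k v).1 = ∑ i, coeff (b i) v.1 * gapCoeff w b F k i A := by
  rw [gapMap_apply, Forms.coeff_sum]
  exact Finset.sum_congr rfl fun i _ => by rw [Forms.coeff_smul, coeff_gapForm]

/-- The derivative of the family, as a tangent vector. -/
def gapTangent (w : Fin (n + 1) → ℤ) (b : Fin r → (Fin (n + 1) →₀ ℕ)) (F : Fin r → Forms K n m)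
    (k : ℕ) (V : Submodule K (Forms K n m)) : GrassTangent V :=
  V.mkQ ∘ₗ gapMap w b F k ∘ₗ V.subtype

theorem gapTangent_apply (V : Submodule K (Forms K n m)) (v : V) :
    gapTangent w b F k V v = V.mkQ (gapMap w b F k v) := rfl

theorem mkQ_eq_mkQ_iff {E : Type*} [AddCommGroup E] [Module K E] {V : Submodule K E} {x y : E} :
    V.mkQ x = V.mkQ y ↔ x - y ∈ V :=
  Submodule.Quotient.eq V

theorem IsReduced.mkQ_eq_mkQ_iff (hred : IsReduced w W b F) (hlt : StrictlyReduced w b F)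
    {x y : Forms K n m} :
    (fibre (graphForms b (familyCoeff w b F) : Submodule K[X] (Forms K[X] n m)) 0).mkQ x =
      (fibre (graphForms b (familyCoeff w b F) : Submodule K[X] (Forms K[X] n m)) 0).mkQ y ↔
      ∀ A, A ∉ Set.range b → coeff A x.1 = coeff A y.1 := by
  refine (InfGalligo.mkQ_eq_mkQ_iff (K := K)).trans ((hred.mem_fibre_zero_iff hlt).trans ?_)
  simp only [Forms.coeff_sub, sub_eq_zero]

/-- The monomials of the derivative lie outside b, so they survive modulo V and the derivative is
nonzero there. -/
theorem IsGap.isTangentVectorAtZero (hk : IsGap w b F k) (hred : IsReduced w W b F)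
    (hlt : StrictlyReduced w b F) :
    IsTangentVectorAtZero (graphForms b (familyCoeff w b F) : Submodule K[X] (Forms K[X] n m))
      (gapTangent w b F k _) := by
  refine ⟨fun h0 => ?_, k, hk.pos, fun v => ?_⟩
  · obtain ⟨i, A, hA⟩ := hk.exists_gapCoeff_ne_zero
    have hmem : monoForm K (b i) (hred.degree_eq i) ∈
        fibre (graphForms b (familyCoeff w b F) : Submodule K[X] (Forms K[X] n m)) 0 := by
      rw [hred.mem_fibre_zero_iff hlt]
      intro B hB
      exact (coeff_monoForm _ B).trans (if_neg fun h => hB ⟨i, h⟩)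
    have h1 := LinearMap.congr_fun h0 ⟨_, hmem⟩
    rw [gapTangent_apply, LinearMap.zero_apply, ← map_zero (Submodule.mkQ _), hred.mkQ_eq_mkQ_iff hlt] at h1
    have h2 := h1 A (hk.notMem_range hred hA)
    rw [coeff_gapMap, Forms.coeff_zero, Finset.sum_eq_single i] at h2
    · rw [coeff_monoForm, if_pos rfl, one_mul] at h2
      exact hA h2
    · intro j _ hj
      rw [coeff_monoForm, if_neg fun h => hj (hred.b_injective h).symm, zero_mul]
    · simp
  · refine ⟨gapMap w b F k v, ∑ i, Polynomial.C (coeff (b i) v.1.1) • tailForm w b F k i, rfl, ?_⟩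
    have h1 : ∑ i, Polynomial.C (coeff (b i) v.1.1) • graphSection m (familyCoeff w b F) i ∈
        (graphForms b (familyCoeff w b F) : Submodule K[X] (Forms K[X] n m)) :=
      Submodule.sum_mem _ fun i _ => Submodule.smul_mem _ _ (hred.isGraphData.graphSection_mem i)
    have hv := (hred.mem_fibre_zero_iff hlt).1 v.2
    have h2 : coeffMap Polynomial.C v.1 +
        (Polynomial.X ^ k : K[X]) • coeffMap Polynomial.C (gapMap w b F k v.1) +
          (Polynomial.X ^ (k + 1) : K[X]) •
            ∑ i, Polynomial.C (coeff (b i) v.1.1) • tailForm w b F k i =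
        ∑ i, Polynomial.C (coeff (b i) v.1.1) • graphSection m (familyCoeff w b F) i := ?_
    · rw [h2]
      exact h1
    refine Forms.ext_coeff fun A => ?_
    simp only [Forms.coeff_add, Forms.coeff_smul, Forms.coeff_sum, coeff_coeffMap, coeff_gapMap,
      hk.graphSection_eq hred, coeff_gapForm, mul_add, Finset.sum_add_distrib, Finset.mul_sum,
      map_sum, map_mul]
    refine congrArg₂ _ (congrArg₂ _ ?_ ?_) ?_
    · conv_lhs => rw [eq_sum_smul_of_coeff_eq_zero hred.b_injective hv]
      rw [MvPolynomial.coeff_sum, map_sum]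
      refine Finset.sum_congr rfl fun i _ => ?_
      rw [MvPolynomial.coeff_smul, smul_eq_mul, map_mul]
      rfl
    · exact Finset.sum_congr rfl fun i _ => by ring
    · exact Finset.sum_congr rfl fun i _ => by ring

theorem leadingTerm_compare {a c : ℕ} {u d : K} {q e : K[X]}
    (h : Polynomial.X ^ a * (Polynomial.C u + Polynomial.X * q) =
      Polynomial.X ^ c * (Polynomial.C d + Polynomial.X * e)) :
    (a < c → u = 0) ∧ (a = c → u = d) ∧ (c < a → d = 0) := by
  have key : ∀ {a c : ℕ} {u d : K} {q e : K[X]},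
      Polynomial.X ^ a * (Polynomial.C u + Polynomial.X * q) =
        Polynomial.X ^ c * (Polynomial.C d + Polynomial.X * e) → a < c → u = 0 := by
    intro a c u d q e h hac
    obtain ⟨s, rfl⟩ := Nat.exists_eq_add_of_lt hac
    rw [show a + s + 1 = a + (s + 1) by ring, pow_add, mul_assoc] at h
    have h1 := mul_left_cancel₀ (pow_ne_zero a Polynomial.X_ne_zero) h
    simpa using congrArg (Polynomial.eval 0) h1
  refine ⟨key h, ?_, key h.symm⟩
  rintro rfl
  have h1 := mul_left_cancel₀ (pow_ne_zero a Polynomial.X_ne_zero) h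
  simpa using congrArg (Polynomial.eval 0) h1

/-- A section is determined by its coefficients at b, which begin with those of v; outside b it
therefore begins with t^k times the gap derivative of v. A smaller order would make ψ zero, a larger
one the gap tangent zero, and equal order identifies them. -/
theorem IsGap.eq_gapTangent (hk : IsGap w b F k) (hred : IsReduced w W b F)
    (hlt : StrictlyReduced w b F) {ψ : GrassTangent (fibre (graphForms b (familyCoeff w b F) :
      Submodule K[X] (Forms K[X] n m)) 0)}
    (hψ : IsTangentVectorAtZero (graphForms b (familyCoeff w b F) :
      Submodule K[X] (Forms K[X] n m)) ψ) : ψ = gapTangent w b F k _ := by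
  obtain ⟨hψ0, l, hl, hψ⟩ := hψ
  choose u q hu hmem using hψ
  -- Positivity of the order matters: the corrections by u at the leading monomials then enter only
  -- beyond order t^k.
  obtain ⟨l, rfl⟩ : ∃ l', l = l' + 1 := ⟨l - 1, by omega⟩
  have key : ∀ v, ∀ A, A ∉ Set.range b → ∃ e : K[X],
      Polynomial.X ^ (l + 1) * (Polynomial.C (coeff A (u v).1) +
        Polynomial.X * coeff A (q v).1) = Polynomial.X ^ k *
          (Polynomial.C (coeff A (gapMap w b F k v.1).1) + Polynomial.X * e) := by
    intro v A hA
    have h1 := hmem v A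
    have hne : ∀ i, ¬ b i = A := fun i h => hA ⟨i, h⟩
    have hvA := (hred.mem_fibre_zero_iff hlt).1 v.2 A hA
    simp only [Forms.coeff_add, Forms.coeff_smul, coeff_coeffMap, hvA, map_zero, zero_add,
      hk.familyCoeff_eq hred, if_neg (hne _)] at h1
    refine ⟨∑ i, (Polynomial.X ^ l * Polynomial.C (coeff (b i) (u v).1) +
      Polynomial.X ^ (l + 1) * coeff (b i) (q v).1) * Polynomial.C (gapCoeff w b F k i A) +
      ∑ i, (Polynomial.C (coeff (b i) v.1.1) +
        Polynomial.X ^ (l + 1) * Polynomial.C (coeff (b i) (u v).1) +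
        Polynomial.X ^ (l + 2) * coeff (b i) (q v).1) * tailCoeff w b F k i A, ?_⟩
    rw [coeff_gapMap, map_sum]
    refine Eq.trans (by ring) (h1.trans ?_)
    simp only [mul_add, Finset.mul_sum, ← Finset.sum_add_distrib, map_mul]
    exact Finset.sum_congr rfl fun i _ => by ring
  obtain hlt' | heq | hgt := lt_trichotomy (l + 1) k
  · refine absurd (LinearMap.ext fun v => ?_) hψ0
    rw [← hu v, LinearMap.zero_apply, ← map_zero (Submodule.mkQ _), hred.mkQ_eq_mkQ_iff hlt]
    intro A hA
    obtain ⟨e, he⟩ := key v A hA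
    rw [Forms.coeff_zero]
    exact (leadingTerm_compare he).1 hlt'
  · refine LinearMap.ext fun v => ?_
    rw [← hu v, gapTangent_apply, hred.mkQ_eq_mkQ_iff hlt]
    intro A hA
    obtain ⟨e, he⟩ := key v A hA
    exact (leadingTerm_compare he).2.1 heq
  · refine absurd (LinearMap.ext fun v => ?_) (hk.isTangentVectorAtZero hred hlt).1
    rw [gapTangent_apply, LinearMap.zero_apply, ← map_zero (Submodule.mkQ _),
      hred.mkQ_eq_mkQ_iff hlt]
    intro A hA
    obtain ⟨e, he⟩ := key v A hA
    rw [Forms.coeff_zero]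
    exact (leadingTerm_compare he).2.2 hgt

end Tangent

/-! ### The tangent vector is an eigenvector -/

section Eigenvector

variable {K : Type*} [Field K] {n m r : ℕ} {w : Fin (n + 1) → ℤ}
  {b : Fin r → (Fin (n + 1) →₀ ℕ)} {F : Fin r → Forms K n m} {k : ℕ}

/-- Two nonzero coefficients of the derivative have the same character. -/
theorem add_eq_add_of_gapCoeff_ne_zero (hw : Distinguishes w (r * m))
    (hb : ∀ i, (b i).degree = m) {i j : Fin r} {A B : Fin (n + 1) →₀ ℕ}
    (hA : gapCoeff w b F k i A ≠ 0) (hB : gapCoeff w b F k j B ≠ 0) : A + b j = B + b i := by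
  classical
  have hsum : ∀ l, b l + ∑ i ∈ Finset.univ.erase l, b i = ∑ i, b i := fun l =>
    Finset.add_sum_erase Finset.univ b (Finset.mem_univ l)
  have hdeg : ∀ l, ∀ D : Fin (n + 1) →₀ ℕ, D.degree = m →
      (D + ∑ i ∈ Finset.univ.erase l, b i).degree = r * m := by
    intro l D hD
    have h1 : (∑ i, b i).degree = r * m := by
      rw [map_sum, Finset.sum_congr rfl fun i _ => hb i]
      simp
    rw [map_add, hD, ← hb l, ← map_add, hsum, h1, hb]
  have hwt : ∀ l, ∀ D : Fin (n + 1) →₀ ℕ, gapCoeff w b F k l D ≠ 0 →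
      wt w (D + ∑ i ∈ Finset.univ.erase l, b i) = wt w (∑ i, b i) - k := by
    intro l D hD
    have := wt_add_eq_of_gapCoeff_ne_zero hD
    rw [← hsum l, wt_add, wt_add]
    omega
  -- Completed by the other leading monomials, both have degree rm and weight Σ w·b_l − k, so the
  -- separating weight identifies them.
  have h1 : A + ∑ i ∈ Finset.univ.erase i, b i = B + ∑ i ∈ Finset.univ.erase j, b i := by
    by_contra hne
    exact hw _ _ (hdeg i A (degree_eq_of_gapCoeff_ne_zero hA))
      (hdeg j B (degree_eq_of_gapCoeff_ne_zero hB)) hne ((hwt i A hA).trans (hwt j B hB).symm)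
  have h2 : (A + b j) + ∑ i, b i = (B + b i) + ∑ i, b i := by
    conv_lhs => rw [← hsum i]
    conv_rhs => rw [← hsum j]
    rw [show A + b j + (b i + ∑ i ∈ Finset.univ.erase i, b i) =
      A + ∑ i ∈ Finset.univ.erase i, b i + b i + b j by abel, h1]
    abel
  exact add_right_cancel h2

/-- The hypothesis kills the term of order 0, so the expansion of the translated section at x^A
starts at t^k with the translated derivative. -/
theorem transCoeff_eq {W : Submodule K (Forms K n m)} (hk : IsGap w b F k)
    (hred : IsReduced w W b F) (h : GL (Fin (n + 1)) K) (i : Fin r) {A : Fin (n + 1) →₀ ℕ}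
    (hA : coeff A (linSubst (h : Matrix (Fin (n + 1)) (Fin (n + 1)) K) (monomial (b i) 1)) = 0) :
    transCoeff w b F h i A = Polynomial.X ^ k *
      (Polynomial.C (coeff A (glAct m h (gapForm w b F k i)).1) + Polynomial.X *
        coeff A (matAct m ((h : Matrix (Fin (n + 1)) (Fin (n + 1)) K).map Polynomial.C)
          (tailForm w b F k i)).1) := by
  have hC : ∀ p : Forms K n m,
      matAct m ((h : Matrix (Fin (n + 1)) (Fin (n + 1)) K).map Polynomial.C)
        (coeffMap Polynomial.C p) = coeffMap Polynomial.C (glAct m h p) :=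
    fun p => Subtype.ext (map_linSubst Polynomial.C _ p.1).symm
  have h1 : coeff A (glAct m h (monoForm K (b i) (hred.degree_eq i))).1 = 0 := hA
  change coeff A (matAct m ((h : Matrix (Fin (n + 1)) (Fin (n + 1)) K).map Polynomial.C)
    (graphSection m (familyCoeff w b F) i)).1 = _
  rw [hk.graphSection_eq hred, map_add, map_add, map_smul, map_smul, hC, hC, Forms.coeff_add,
    Forms.coeff_add, Forms.coeff_smul, Forms.coeff_smul, coeff_coeffMap, coeff_coeffMap, h1,
    map_zero]
  ring

theorem eq_sum_coeff_smul (p : MvPolynomial (Fin (n + 1)) K) :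
    p = ∑ A ∈ p.support, coeff A p • monomial A 1 := by
  conv_lhs => rw [p.as_sum]
  exact Finset.sum_congr rfl fun A _ => by rw [smul_monomial, smul_eq_mul, mul_one]

/-- The monomials of the i-th derivative weigh w·b_i − k ≥ w·A, and `h` only adds heavier ones, so
nothing but x^A itself contributes. -/
theorem coeff_glAct_gapForm (hw : StrictAnti w) {h : GL (Fin (n + 1)) K} (hh : IsUpperTri h)
    {i : Fin r} {A : Fin (n + 1) →₀ ℕ} (hA : wt w A + k ≤ wt w (b i)) :
    coeff A (glAct m h (gapForm w b F k i)).1 =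
      diagChar (h : Matrix (Fin (n + 1)) (Fin (n + 1)) K) A * gapCoeff w b F k i A := by
  rw [glAct_apply, eq_sum_coeff_smul (gapForm w b F k i).1, map_sum, coeff_sum,
    Finset.sum_eq_single A]
  · rw [map_smul, coeff_smul, (hasLowest_linSubst_monomial hw hh A).1, coeff_gapForm,
      smul_eq_mul, mul_comm]
  · intro B _ hB
    by_contra h0
    rw [map_smul, coeff_smul, smul_eq_mul, coeff_gapForm] at h0
    have h1 := wt_add_eq_of_gapCoeff_ne_zero (left_ne_zero_of_mul h0)
    obtain h2 | h2 := (hasLowest_linSubst_monomial hw hh B).2 A (right_ne_zero_of_mul h0)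
    · exact hB h2.symm
    · omega
  · intro hA
    rw [notMem_support_iff.1 hA, zero_smul, map_zero, coeff_zero]

/-- An off-diagonal term would need w·b_j > w·b_i from triangularity and w·b_j = w·A + k ≤ w·b_i
from the derivative. -/
theorem limitMatrix_mulVec_gapCoeff (hw : StrictAnti w) {W : Submodule K (Forms K n m)}
    (hred : IsReduced w W b F) {h : GL (Fin (n + 1)) K} (hh : IsUpperTri h)
    {i : Fin r} {A : Fin (n + 1) →₀ ℕ} (hA : wt w A + k ≤ wt w (b i)) :
    (limitMatrix b h).mulVec (fun j => gapCoeff w b F k j A) i =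
      diagChar (h : Matrix (Fin (n + 1)) (Fin (n + 1)) K) (b i) * gapCoeff w b F k i A := by
  rw [Matrix.mulVec, dotProduct, Finset.sum_eq_single i, limitMatrix_apply_self hw hh]
  · intro j _ hj
    by_contra h0
    have h1 := wt_add_eq_of_gapCoeff_ne_zero (right_ne_zero_of_mul h0)
    obtain h2 | h2 := limitMatrix_triangular hw hred hh i j (left_ne_zero_of_mul h0)
    · exact hj h2.symm
    · omega
  · simp

variable {J : Ideal (MvPolynomial (Fin (n + 1)) K)}

/-- An upper triangular matrix scales the derivative of the family. -/
theorem exists_coeff_glAct_gapForm_eq [Infinite K] (hw : StrictAnti w)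
    (hw' : Distinguishes w (r * m)) (hgen : IsGeneric r (gradedPiece J m))
    (hred : IsReduced w (gradedPiece J m) b F) (hlt : StrictlyReduced w b F)
    (hk : IsGap w b F k) {h : GL (Fin (n + 1)) K} (hh : IsUpperTri h) :
    ∃ c : K, ∀ A, A ∉ Set.range b → ∀ i, coeff A (glAct m h (gapForm w b F k i)).1 =
      c * (limitMatrix b h).mulVec (fun j => gapCoeff w b F k j A) i := by
  obtain ⟨i₀, A₀, h₀⟩ := hk.exists_gapCoeff_ne_zero
  let χ := diagChar (h : Matrix (Fin (n + 1)) (Fin (n + 1)) K)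
  have hχ0 : ∀ A, χ A ≠ 0 := diagChar_ne_zero hh
  -- All pairs in the derivative satisfy A + b_{i₀} = A₀ + b_i, so χ(A)/χ(b_i) is one scalar: the
  -- eigenvalue.
  have hχ : ∀ i A, χ A * gapCoeff w b F k i A =
      χ A₀ / χ (b i₀) * (χ (b i) * gapCoeff w b F k i A) := by
    intro i A
    by_cases hA : gapCoeff w b F k i A = 0
    · simp [hA]
    · have h1 := congrArg χ (add_eq_add_of_gapCoeff_ne_zero hw' hred.degree_eq hA h₀)
      rw [show χ (A + b i₀) = χ A * χ (b i₀) from diagChar_add _ _ _,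
        show χ (A₀ + b i) = χ A₀ * χ (b i) from diagChar_add _ _ _] at h1
      rw [← mul_assoc, div_mul_eq_mul_div, ← h1, mul_div_cancel_right₀ _ (hχ0 _)]
  refine ⟨χ A₀ / χ (b i₀), fun A hA => ?_⟩
  have hd := det_limitMatrix_ne_zero hw hred hh
  let q : Fin r → K := fun i => coeff A (glAct m h (gapForm w b F k i)).1
  let δ : Fin r → K := fun i => gapCoeff w b F k i A
  let Y := (limitMatrix b h).adjugate.mulVec q
  have hpY : (limitMatrix b h).mulVec Y = (limitMatrix b h).det • q := mulVec_adjugate_mulVec q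
  -- Stability of V removes the coefficients of order 0, so the exchange argument applies at order
  -- t^k; minimality of the gap then sharpens the bound by k.
  have hYs : ∀ i, Y i ≠ 0 → wt w A + k ≤ wt w (b i) := by
    intro i hi
    refine hk.wt_add_le i A (coeff_ne_zero_of_limitMatrix_adjugate hgen hred hlt hd
      (fun j => transCoeff_eq hk hred h j
        (coeff_linSubst_monomial_eq_zero hw hgen hred hlt hh hA j)) (i := i) ?_)
      fun h => hA ⟨i, h.symm⟩
    simpa only [Polynomial.eval_add, Polynomial.eval_C, Polynomial.eval_mul, Polynomial.eval_X,
      zero_mul, add_zero] using hi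
  -- `Z` measures the failure of the eigenvector equation. On its support w·A + k ≤ w·b_i, where h
  -- acts diagonally on both sides, so its heaviest index gives a contradiction.
  let Z : Fin r → K := Y - ((limitMatrix b h).det * (χ A₀ / χ (b i₀))) • δ
  have hpZ : (limitMatrix b h).mulVec Z = (limitMatrix b h).det •
      (q - (χ A₀ / χ (b i₀)) • (limitMatrix b h).mulVec δ) := by
    rw [Matrix.mulVec_sub, hpY, Matrix.mulVec_smul, smul_sub, mul_smul]
  have hZ : Z = 0 := by
    by_contra hZ
    obtain ⟨i, hi, hpi⟩ := exists_mulVec_eq_of_triangular (limitMatrix_triangular hw hred hh) hZ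
    have hAi : wt w A + k ≤ wt w (b i) := by
      by_contra hlt'
      refine hi ?_
      have h1 : Y i = 0 := by
        by_contra h1
        exact hlt' (hYs i h1)
      have h2 : δ i = 0 := by
        by_contra h2
        exact hlt' (wt_add_eq_of_gapCoeff_ne_zero h2).le
      simp [Z, h1, h2]
    have h1 : q i = χ A * δ i := coeff_glAct_gapForm hw hh hAi
    have h2 : (limitMatrix b h).mulVec δ i = χ (b i) * δ i :=
      limitMatrix_mulVec_gapCoeff hw hred hh hAi
    have h3 : (limitMatrix b h).mulVec Z i ≠ 0 := by
      rw [hpi, limitMatrix_apply_self hw hh]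
      exact mul_ne_zero (hχ0 _) hi
    refine h3 ?_
    rw [hpZ, Pi.smul_apply, Pi.sub_apply, Pi.smul_apply, h1, h2, hχ i A, smul_eq_mul, smul_eq_mul,
      sub_self, mul_zero]
  intro i
  rw [hZ, Matrix.mulVec_zero] at hpZ
  exact sub_eq_zero.1 ((mul_eq_zero.1 (congrFun hpZ.symm i)).resolve_left hd)

theorem tangentAct_eq_smul {V : Submodule K (Forms K n m)} {h : GL (Fin (n + 1)) K}
    (hV : V.map (glAct m h).toLinearMap = V) {φ : GrassTangent V} {c : K}
    (hφ : ∀ (v v' : V), glAct m h v.1 = v'.1 →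
      Submodule.Quotient.equiv V V (glAct m h) hV (φ v) = c • φ v') :
    tangentAct h hV φ = c • φ := by
  refine LinearMap.ext fun x => ?_
  refine hφ (((glAct m h).ofSubmodules V V hV).symm x) x ?_
  exact congrArg Subtype.val (((glAct m h).ofSubmodules V V hV).apply_symm_apply x)

/-- The tangent vector is an eigenvector for the Borel group. -/
theorem isBorelEigenvector_gapTangent [Infinite K] (hw : StrictAnti w)
    (hw' : Distinguishes w (r * m)) (hgen : IsGeneric r (gradedPiece J m))
    (hred : IsReduced w (gradedPiece J m) b F) (hlt : StrictlyReduced w b F)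
    (hk : IsGap w b F k)
    (hB : BorelFixed (fibre (graphForms b (familyCoeff w b F) :
      Submodule K[X] (Forms K[X] n m)) 0)) :
    IsBorelEigenvector hB (gapTangent w b F k _) := by
  refine ⟨(hk.isTangentVectorAtZero hred hlt).1, fun h hh => ?_⟩
  obtain ⟨c, hc⟩ := exists_coeff_glAct_gapForm_eq hw hw' hgen hred hlt hk hh
  refine ⟨c, tangentAct_eq_smul (hB h hh) fun v v' hv => ?_⟩
  have key : (fibre (graphForms b (familyCoeff w b F) : Submodule K[X] (Forms K[X] n m)) 0).mkQ
      (glAct m h (gapMap w b F k v.1)) =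
      (fibre (graphForms b (familyCoeff w b F) : Submodule K[X] (Forms K[X] n m)) 0).mkQ
        (c • gapMap w b F k v'.1) := by
    rw [hred.mkQ_eq_mkQ_iff hlt]
    intro A hA
    have hv0 := (hred.mem_fibre_zero_iff hlt).1 v.2
    have hv' : ∀ j, coeff (b j) v'.1.1 = ∑ i, coeff (b i) v.1.1 * limitMatrix b h i j := by
      intro j
      rw [← hv, glAct_apply]
      conv_lhs => rw [eq_sum_smul_of_coeff_eq_zero hred.b_injective hv0]
      rw [map_sum, coeff_sum]
      refine Finset.sum_congr rfl fun i _ => ?_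
      rw [map_smul, coeff_smul]
      rfl
    rw [Forms.coeff_smul, coeff_gapMap, gapMap_apply, map_sum, Forms.coeff_sum]
    simp only [map_smul, Forms.coeff_smul, hc A hA, hv', Matrix.mulVec, dotProduct,
      Finset.mul_sum, Finset.sum_mul]
    rw [Finset.sum_comm]
    exact Finset.sum_congr rfl fun j _ => Finset.sum_congr rfl fun i _ => by ring
  exact key

end Eigenvector

/-! ### The main theorem -/

section Main

variable {K : Type*} [Field K] {n m : ℕ}

/-- An index i exists only when r ≥ 1, and then m ≤ rm, so w separates monomials of degree m. -/
theorem IsReduced.strictlyReduced {r : ℕ} {w : Fin (n + 1) → ℤ} {W : Submodule K (Forms K n m)}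
    {b : Fin r → (Fin (n + 1) →₀ ℕ)} {F : Fin r → Forms K n m} (hred : IsReduced w W b F)
    (hw : ∀ d ≤ r * m, Distinguishes w d) : StrictlyReduced w b F := fun i _ hA hne =>
  hred.wt_lt (hw m (Nat.le_mul_of_pos_left m i.pos)) hA hne

theorem finrank_eq_of_basis {E : Type*} [AddCommGroup E] [Module K E] {r : ℕ}
    {W : Submodule K E} (f : Module.Basis (Fin r) K W) : Module.finrank K W = r := by
  rw [Module.finrank_eq_card_basis f, Fintype.card_fin]

/-- The limit of a generic translate is fixed by the Borel group, and the tangent vector there is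
an eigenvector. -/
theorem borelFixed_and_exists_tangent [CharZero K] {P : ℚ[X]} (hm : IsGotzmannNumber K n P m)
    {I : Ideal (MvPolynomial (Fin (n + 1)) K)} (hI : IsSaturatedIdeal I)
    (hP : HasHilbertPoly I P) {r : ℕ} (f : Module.Basis (Fin r) K (gradedPiece I m))
    {w : Fin (n + 1) → ℤ} (hw : StrictAnti w) (hdist : ∀ d ≤ r * m, Distinguishes w d)
    {g : GL (Fin (n + 1)) K} (hg : g ∈ genericSet m fun i => (f i).1.1)
    {M : Submodule K[X] (Forms K[X] n m)} (hM : M = idealForms (familyIdeal w (translate g I)) m) :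
    fibre M 0 ∈ hilb K n P m ∧ ∃ hB : BorelFixed (fibre M 0), I ≠ ⊥ → I ≠ ⊤ →
      ∃ φ : GrassTangent (fibre M 0), (∀ ψ : GrassTangent (fibre M 0),
        IsTangentVectorAtZero M ψ ↔ ψ = φ) ∧ IsHilbTangent (fibre M 0) φ ∧
          IsBorelEigenvector hB φ := by
  have hJ : IsSaturatedIdeal (translate g I) := isSaturatedIdeal_translate g hI
  have hPJ : HasHilbertPoly (translate g I) P := hasHilbertPoly_of_finrank_eq hP (N := 0)
    fun d _ => finrank_gradedPiece_translate g I d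
  have hrI : Module.finrank K (gradedPiece I m) = r := finrank_eq_of_basis f
  have hr : Module.finrank K (gradedPiece (translate g I) m) = r :=
    (finrank_gradedPiece_translate g I m).trans hrI
  have hgen : IsGeneric r (gradedPiece (translate g I) m) := isGeneric_gradedPiece_translate f hg
  obtain ⟨b, F, hred⟩ := exists_isReduced w hr
  have hlt := hred.strictlyReduced hdist
  have hfib : fibre M 0 = gradedPiece (limitIdeal w (translate g I)) m := by
    rw [hM]
    exact fibre_zero_idealForms_familyIdeal w hJ.1 m
  have hmem : fibre M 0 ∈ hilb K n P m := by
    rw [hfib]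
    exact gradedPiece_limitIdeal_mem_hilb w hm hJ hPJ
  -- Flatness uses that `M` comes from an ideal, so it is settled before `M` is rewritten as a
  -- graph.
  have hflat : ∀ φ : GrassTangent (fibre M 0), IsTangentVectorAtZero M φ →
      IsHilbTangent (fibre M 0) φ := by
    subst hM
    exact fun φ hφ => isHilbTangent_of_isTangentVectorAtZero
      (isHomogeneousIdeal_familyIdeal w hJ.1) (fun _ _ hq => mem_familyIdeal_of_X_pow_smul hq)
      (fun _ hd => gradedPiece_span_limitIdeal w hm hJ hPJ hd) hφ
  rw [hred.idealForms_familyIdeal_eq] at hM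
  refine ⟨hmem, ?_⟩
  clear hfib hmem
  subst hM
  have hB := borelFixed_fibre_zero hw hgen hred hlt
  refine ⟨hB, fun hbot htop => ?_⟩
  obtain ⟨A, hA, hAb⟩ := exists_notMem_range hI htop hrI hred.b_injective hred.degree_eq
  have hr0 : r ≠ 0 := by
    rintro rfl
    exact hbot (eq_bot_of_gradedPiece_eq_bot hI.1 (hm.1 I hI hP) (eq_bot_of_finrank_eq_zero hrI))
  obtain ⟨k, hk⟩ := exists_isGap hlt
    (exists_coeff_ne_zero hgen hred hlt ⟨0, Nat.pos_of_ne_zero hr0⟩ hA hAb)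
  have htan := hk.isTangentVectorAtZero hred hlt
  refine ⟨_, fun ψ => ⟨hk.eq_gapTangent hred hlt, ?_⟩, hflat _ htan,
    isBorelEigenvector_gapTangent hw (hdist _ le_rfl) hgen hred hlt hk hB⟩
  rintro rfl
  exact htan

end Main

end

end InfGalligo

theorem mainTheorem1 {K : Type*} [Field K] [IsAlgClosed K] [CharZero K] (n : ℕ)
    (P : Polynomial ℚ) (m : ℕ) (hm : InfGalligo.IsGotzmannNumber K n P m)
    (I : Ideal (MvPolynomial (Fin (n + 1)) K))
    (hI : InfGalligo.IsSaturatedIdeal I) (hP : InfGalligo.HasHilbertPoly I P)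
    (r : ℕ) (f : Module.Basis (Fin r) K (InfGalligo.gradedPiece I m))
    (w : Fin (n + 1) → ℤ) (hw : StrictAnti w)
    (hdist : ∀ d ≤ r * m, InfGalligo.Distinguishes w d)
    (U : Set (Matrix.GeneralLinearGroup (Fin (n + 1)) K))
    (hU : U = InfGalligo.genericSet m
      fun i => ((f i : InfGalligo.Forms K n m) : MvPolynomial (Fin (n + 1)) K)) :
    InfGalligo.IsZariskiOpen U ∧ InfGalligo.IsZariskiDense U ∧
    ∀ g ∈ U, ∃ M : Submodule (Polynomial K) (InfGalligo.Forms (Polynomial K) n m),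
      (∀ M' : Submodule (Polynomial K) (InfGalligo.Forms (Polynomial K) n m),
        InfGalligo.IsPath P w g (InfGalligo.gradedPiece I m) M' ↔ M' = M) ∧
      InfGalligo.fibre M 0 ∈ InfGalligo.hilb K n P m ∧
      ∃ hB : InfGalligo.BorelFixed (InfGalligo.fibre M 0),
        I ≠ ⊥ → I ≠ ⊤ →
          ∃ φ : InfGalligo.GrassTangent (InfGalligo.fibre M 0),
            (∀ ψ : InfGalligo.GrassTangent (InfGalligo.fibre M 0),
              InfGalligo.IsTangentVectorAtZero M ψ ↔ ψ = φ) ∧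
            InfGalligo.IsHilbTangent (InfGalligo.fibre M 0) φ ∧
            InfGalligo.IsBorelEigenvector hB φ := by
  subst hU
  refine ⟨InfGalligo.isZariskiOpen_genericSet m _, InfGalligo.isZariskiDense_genericSet m _,
    fun g hg => ⟨_, InfGalligo.isPath_iff w hm hI hP g, ?_⟩⟩
  exact InfGalligo.borelFixed_and_exists_tangent hm hI hP f hw hdist hg rfl
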